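/- Let $\Omega$ be the metric graph with vertices $v_1,\dots,v_4$ and edges $e_1,\dots,e_4$, where $e_1$ joins $v_1$ and $v_2$, the edges $e_2$ and $e_3$ both join $v_2$ and $v_3$, and $e_4$ joins $v_3$ and $v_4$ (a ring with two attached edges). Let $l_j>0$ be the length of $e_j$, let $q_j$ be a bounded continuous real function on $e_j\cong(0,l_j)$, and let $T>l_1$. For $f,g\in L^2(0,T)$ let $u=u^{f,g}$, with $u_j\in C([0,T];L^2(0,l_j))$, be the generalized solution on $\Omega\times(0,T)$ of $$u_{tt}-u_{xx}+q(x)u=0\ \text{ on the edges},\qquad u|_{t=0}=u_t|_{t=0}=0,$$ $$\sum_{j:\,e_j\ni v_i}\partial u_j(v_i,t)=0\quad(i=2,3),\qquad u_1(v_1,t)=f(t),\quad u_4(v_4,t)=0,$$ $$u_2(v_2,t)=u_1(v_2,t),\qquad u_3(v_2,t)-u_1(v_2,t)=g(t),\qquad u_2(v_3,t)=u_3(v_3,t)=u_4(v_3,t),$$ where $\partial$ is the derivative along the edge pointing away from the vertex. Here the boundary values $u_j(v_i,\cdot)$ are the limits in $L^2(0,T)$ of $u_j(x,\cdot)$ as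 $x\to v_i$ along $e_j$, and the wave equation, the zero initial conditions and the Kirchhoff--Neumann conditions are understood in the weak sense, that is, $$\sum_{j=1}^4\int_0^T\!\!\int_0^{l_j}u_j\,\bigl(\varphi_{j,tt}-\varphi_{j,xx}+q_j\varphi_j\bigr)\,dx\,dt=\sum_{j=1}^4\ \sum_{v\in\{\text{endpoints of }e_j\}}\int_0^T u_j(v,t)\,\partial\varphi_j(v,t)\,dt$$ for all $\varphi$ that are $C^2$ on each closed edge times $[0,T]$, continuous on $\Omega$, zero at $v_1$ and $v_4$, and such that $\varphi=\varphi_t=0$ at $t=T$. Functions in $L^2(l_1,T)$ are extended by zero to $(0,T)$. Then $u^{f,g}$ exists and is unique for all $f,g\in L^2(0,T)$. For every $f\in L^2(0,T)$ there is exactly one $g=g_f\in L^2(l_1,T)$ that satisfies the matching condition $$u_3^{0,g}(v_2,t)=-u_3^{f,0}(v_2,t)\quad\text{for almost every }t\in(0,T),$$ the function $u_1^{f,g_f}(v_2,\cdot)$ vanishes almost everywhere on $(0,l_1)$, and the map $$L^2(0,T)\to L^2(l_1,T),\qquad f\mapsto u_1^{f,g_f}(v_2,\cdot),$$ is surjective.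 -/

import Mathlib

open MeasureTheory Set Filter Topology

namespace RingGraph

/-- The four edges of the ring with two attached edges. -/
inductive Edge
  | e1 | e2 | e3 | e4
  deriving DecidableEq

instance : Fintype Edge := ⟨{.e1, .e2, .e3, .e4}, fun e => by cases e <;> decide⟩

/-- The four vertices. -/
inductive Vertex
  | v1 | v2 | v3 | v4
  deriving DecidableEq

/-- The endpoint of an edge that corresponds to the arclength coordinate `x = 0`. -/
def Edge.tail : Edge → Vertex
  | .e1 => .v2
  | .e2 => .v2
  | .e3 => .v2
  | .e4 => .v3

/-- The endpoint of an edge that corresponds to the arclength coordinate `x = l e`. -/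
def Edge.head : Edge → Vertex
  | .e1 => .v1
  | .e2 => .v3
  | .e3 => .v3
  | .e4 => .v4

/-- The edge `e` is incident to the vertex `v`. -/
def Incident (e : Edge) (v : Vertex) : Prop := e.tail = v ∨ e.head = v

/-- The boundary vertices. -/
def IsBoundary (v : Vertex) : Prop := v = .v1 ∨ v = .v4

/-- The arclength coordinate on the edge `e` (identified with `(0, l e)`) of its endpoint `v`. -/
def pos (l : Edge → ℝ) (e : Edge) (v : Vertex) : ℝ := if v = e.tail then 0 else l e

/-- The derivative at time `t` of `φ` at the endpoint `v` of the edge `e`, along `e`, in the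
direction pointing away from `v`. -/
noncomputable def outDeriv (l : Edge → ℝ) (φ : Edge → ℝ → ℝ → ℝ) (e : Edge) (v : Vertex)
    (t : ℝ) : ℝ :=
  if v = e.tail then deriv (fun x => φ e x t) 0 else -deriv (fun x => φ e x t) (l e)

/-- The expression `φ_tt - φ_xx + q φ` on the edge `e`; functions on the graph are written
`φ e x t`, with position `x` on the edge `e` and time `t`. -/
noncomputable def waveOp (q : Edge → ℝ → ℝ) (φ : Edge → ℝ → ℝ → ℝ) (e : Edge) (x t : ℝ) : ℝ :=
  iteratedDeriv 2 (fun s => φ e x s) t - iteratedDeriv 2 (fun y => φ e y t) x + q e x * φ e x t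

/-- Test functions: of class `C²` on every closed edge, continuous on the graph, vanishing at the
boundary vertices, and vanishing together with their time derivative at the final time `T`.
No condition is imposed at time `0`, nor on the derivatives of `φ` at the vertices. -/
structure IsTestFunction (l : Edge → ℝ) (T : ℝ) (φ : Edge → ℝ → ℝ → ℝ) : Prop where
  contDiff : ∀ e, ContDiff ℝ 2 (fun p : ℝ × ℝ => φ e p.1 p.2)
  continuous_at_vertex : ∀ v e e', Incident e v → Incident e' v → ∀ t ∈ Icc 0 T,
    φ e (pos l e v) t = φ e' (pos l e' v) t
  boundary : ∀ v e, IsBoundary v → Incident e v → ∀ t ∈ Icc 0 T, φ e (pos l e v) t = 0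
  final : ∀ e, ∀ x ∈ Icc 0 (l e), φ e x T = 0
  final_deriv : ∀ e, ∀ x ∈ Icc 0 (l e), deriv (fun t => φ e x t) T = 0

/-- The function `a` on `(0, T)` is the trace of `u` at the endpoint `v` of the edge `e`: it is
the limit in `L²(0, T)` of `u e x ·` as `x` tends to `v` from inside the edge. As `u` is only
relevant up to null sets, this is an essential limit: null sets of `x` are disregarded. -/
def HasTrace (l : Edge → ℝ) (T : ℝ) (u : Edge → ℝ → ℝ → ℝ) (e : Edge) (v : Vertex)
    (a : ℝ → ℝ) : Prop :=
  MemLp a 2 (volume.restrict (Ioo 0 T)) ∧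
  Tendsto (fun x => eLpNorm (fun t => u e x t - a t) 2 (volume.restrict (Ioo 0 T)))
    (𝓝[Ioo 0 (l e)] (pos l e v) ⊓ ae volume) (𝓝 0)

/-- `u` is a generalized solution on the graph, with controls `f` and `g`, of
* `u_tt - u_xx + q u = 0` on the edges, for `0 < t < T`,
* `∑ ∂u_j(v, t) = 0` (Kirchhoff-Neumann) at `v2` and `v3`,
* `u_1(v1, t) = f t`, `u_4(v4, t) = 0`,
* `u_2(v2, t) = u_1(v2, t)`, `u_3(v2, t) - u_1(v2, t) = g t`, `u_2 = u_3 = u_4` at `v3`,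
* `u = u_t = 0` at `t = 0`,

and `tr e v` is its boundary value `u_e(v, ·)` at the endpoint `v` of the edge `e`.
The wave equation, the zero initial conditions and the Kirchhoff-Neumann conditions are contained
in the identity `weak`, which is obtained by multiplying the wave equation by a test function `φ`
and integrating by parts twice in `t` and in `x`. (The terms that contain `∂u_j` at a vertex `v`
add up to `-φ(v, t) ∑ ∂u_j(v, t)`, which is zero exactly by the Kirchhoff-Neumann conditions.) -/
structure IsGeneralizedSolution (l : Edge → ℝ) (q : Edge → ℝ → ℝ) (T : ℝ) (f g : ℝ → ℝ)
    (u : Edge → ℝ → ℝ → ℝ) (tr : Edge → Vertex → ℝ → ℝ) : Prop where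
  aestronglyMeasurable : ∀ e, AEStronglyMeasurable (fun p : ℝ × ℝ => u e p.1 p.2)
    ((volume.restrict (Ioo 0 (l e))).prod (volume.restrict (Ioo 0 T)))
  /- `u` belongs to `C([0, T]; L²)` on every edge. -/
  memLp : ∀ e, ∀ t ∈ Icc 0 T, MemLp (fun x => u e x t) 2 (volume.restrict (Ioo 0 (l e)))
  continuous_time : ∀ e, ∀ t₀ ∈ Icc 0 T,
    Tendsto (fun t => eLpNorm (fun x => u e x t - u e x t₀) 2 (volume.restrict (Ioo 0 (l e))))
      (𝓝[Icc 0 T] t₀) (𝓝 0)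
  hasTrace : ∀ e v, Incident e v → HasTrace l T u e v (tr e v)
  bc_v1 : ∀ᵐ t, t ∈ Ioo 0 T → tr .e1 .v1 t = f t
  bc_v4 : ∀ᵐ t, t ∈ Ioo 0 T → tr .e4 .v4 t = 0
  dc_v2 : ∀ᵐ t, t ∈ Ioo 0 T →
    tr .e2 .v2 t - tr .e1 .v2 t = 0 ∧ tr .e3 .v2 t - tr .e1 .v2 t = g t
  dc_v3 : ∀ᵐ t, t ∈ Ioo 0 T → tr .e2 .v3 t = tr .e3 .v3 t ∧ tr .e3 .v3 t = tr .e4 .v3 t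
  weak : ∀ φ, IsTestFunction l T φ →
    ∑ e, ∫ t in 0..T, ∫ x in 0..l e, u e x t * waveOp q φ e x t =
      ∑ e, ((∫ t in 0..T, tr e e.tail t * outDeriv l φ e e.tail t) +
        ∫ t in 0..T, tr e e.head t * outDeriv l φ e e.head t)

/-- The space `L²(a, b)` of real functions. -/
abbrev L2 (a b : ℝ) : Type := Lp ℝ 2 (volume.restrict (Ioo a b))

/-- Extension of an element of `L²(a, b)` by zero to the whole line. -/
noncomputable def zeroExt {a b : ℝ} (f : L2 a b) : ℝ → ℝ := (Ioo a b).indicator f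

/-- `u^{f,g}_e(v, ·) = a` almost everywhere on `(0, T)`. -/
def IsVertexValue (l : Edge → ℝ) (q : Edge → ℝ → ℝ) (T : ℝ) (f g : ℝ → ℝ) (e : Edge)
    (v : Vertex) (a : ℝ → ℝ) : Prop :=
  ∃ u tr, IsGeneralizedSolution l q T f g u tr ∧ ∀ᵐ t, t ∈ Ioo 0 T → tr e v t = a t

/-- The matching condition `u^{0,g}_3(v2, t) = -u^{f,0}_3(v2, t)` for almost every `t` in
`(0, T)`. -/
def Matching (l : Edge → ℝ) (q : Edge → ℝ → ℝ) (T : ℝ) (f g : ℝ → ℝ) : Prop :=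
  ∃ a b : ℝ → ℝ, IsVertexValue l q T 0 g .e3 .v2 b ∧ IsVertexValue l q T f 0 .e3 .v2 a ∧
    ∀ᵐ t, t ∈ Ioo 0 T → b t = -a t

/-- `u^{f,g}` and its boundary values are well defined: there is a generalized solution, and any
two coincide (as elements of `C([0, T]; L²)`) and have the same boundary values. -/
def HasUniqueSolution (l : Edge → ℝ) (q : Edge → ℝ → ℝ) (T : ℝ) (f g : ℝ → ℝ) : Prop :=
  (∃ u tr, IsGeneralizedSolution l q T f g u tr) ∧
  ∀ u tr u' tr', IsGeneralizedSolution l q T f g u tr → IsGeneralizedSolution l q T f g u' tr' →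
    (∀ e, ∀ t ∈ Icc 0 T, ∀ᵐ x, x ∈ Ioo 0 (l e) → u e x t = u' e x t) ∧
    ∀ e v, Incident e v → ∀ᵐ t, t ∈ Ioo 0 T → tr e v t = tr' e v t

end RingGraph

open RingGraph

/-! The equation is read as an evolution in the position. On each edge a solution is a continuous
function U of x with values in L²(0,T). If p and r are the waves emitted from the endpoints 0 and l,
the formulas of d'Alembert and Duhamel give U(x) = `shift x p` + `shift (l - x) r` + D(x), where D
is the Duhamel integral of the source -qU (`IsEdgeWave`). At an endpoint the outward derivative of
such a wave is the time derivative of U - 2p (or U - 2r). As everything starts from rest, the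
Kirchhoff condition at a vertex becomes the algebraic identity ΣU = 2Σ(emitted waves), so the
problem on the graph is a finite linear system for the emitted waves (`IsSystem`).

Delays and integration in time are causal: in the norm with weight exp(-ct) they become arbitrarily
small as c grows. Hence the wave that arrives at an endpoint is a small linear function of the
emitted waves, and every system o = b + N o with small N is uniquely solvable
(`exists_solution_of_isSmallOn`). This yields existence for given f and g, and uniqueness both for
given g and for g replaced by the condition u_3(v2) = 0 (`exists_isSystem`, `IsSystem.eq_zero`).

By linearity the matching condition says that u_3(v2) = 0 for the data (f, g), and then g =
-u_1(v2). The wave emitted from v1 reaches v2 as `shift l (r + E r)` with E small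
(`EdgeResponse.G01_eq`). When the travel time l of e1 is factored out of every wave emitted
elsewhere, a system of the same small type remains, and u_1(v2) = `shift l c`, where c is r plus
small terms. It can be solved with f prescribed, which gives g and its vanishing before l, and
equally with c prescribed, which gives surjectivity (`isSystem_of_hat`, `exists_isSystem_matching`,
`exists_isSystem_surjective`).

It remains to identify generalized solutions with systems of waves. Green's formula along
characteristics shows that, for waves with the right traces, the weak identity is a condition on
vertex terms only (`weak_iff`). Conversely, a weak solution u on an edge is compared with the wave V
that has the same traces and the source -qu. Test functions sin(nπx/l)k(t) show that all sine
coefficients of u - V vanish, so u = V (`IsRegular.exists_isEdgeWave`). -/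

namespace RingGraph

/-! ### Extension by zero and the pairing of square integrable functions. -/

section ZeroExt

variable {a b : ℝ}

lemma zeroExt_ae (h : L2 a b) : zeroExt h =ᵐ[volume.restrict (Ioo a b)] h :=
  indicator_ae_eq_restrict measurableSet_Ioo

lemma zeroExt_of_notMem (h : L2 a b) {t : ℝ} (ht : t ∉ Ioo a b) : zeroExt h t = 0 :=
  indicator_of_notMem ht _

lemma measurable_zeroExt (h : L2 a b) : Measurable (zeroExt h) :=
  (Lp.stronglyMeasurable h).measurable.indicator measurableSet_Ioo

lemma memLp_zeroExt (h : L2 a b) : MemLp (zeroExt h) 2 volume :=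
  (memLp_indicator_iff_restrict measurableSet_Ioo).2 (Lp.memLp h)

lemma zeroExt_congr {h : L2 a b} {f : ℝ → ℝ} (hf : h =ᵐ[volume.restrict (Ioo a b)] f) :
    zeroExt h =ᵐ[volume] (Ioo a b).indicator f :=
  (ae_eq_restrict_iff_indicator_ae_eq measurableSet_Ioo).1 hf

lemma zeroExt_add (h k : L2 a b) : zeroExt (h + k) =ᵐ[volume] zeroExt h + zeroExt k := by
  refine (zeroExt_congr (Lp.coeFn_add h k)).trans (Eventually.of_forall fun t => ?_)
  by_cases ht : t ∈ Ioo a b <;> simp [zeroExt, ht]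

lemma zeroExt_smul (c : ℝ) (h : L2 a b) : zeroExt (c • h) =ᵐ[volume] c • zeroExt h := by
  refine (zeroExt_congr (Lp.coeFn_smul c h)).trans (Eventually.of_forall fun t => ?_)
  by_cases ht : t ∈ Ioo a b <;> simp [zeroExt, ht]

lemma integrable_zeroExt (h : L2 a b) : Integrable (zeroExt h) := by
  have : IntegrableOn h (Ioo a b) := (Lp.memLp h).integrable (by norm_num)
  exact (integrable_indicator_iff measurableSet_Ioo).2 this

/-- Extension by zero as a map into `L²(ℝ)`. -/
noncomputable def extL : L2 a b →L[ℝ] Lp ℝ 2 (volume : Measure ℝ) :=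
  LinearMap.mkContinuous
    { toFun := fun h => (memLp_zeroExt h).toLp
      map_add' := fun h k => by
        rw [← MemLp.toLp_add]
        exact MemLp.toLp_congr _ _ (zeroExt_add h k)
      map_smul' := fun c h => by
        rw [RingHom.id_apply, ← MemLp.toLp_const_smul]
        exact MemLp.toLp_congr _ _ (zeroExt_smul c h) } 1 fun h => by
    simp only [LinearMap.coe_mk, AddHom.coe_mk, one_mul]
    rw [Lp.norm_toLp, Lp.norm_def]
    refine ENNReal.toReal_mono (Lp.eLpNorm_ne_top _) ?_
    rw [zeroExt, eLpNorm_indicator_eq_eLpNorm_restrict measurableSet_Ioo]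

lemma coeFn_extL (h : L2 a b) : extL h =ᵐ[volume] zeroExt h := (memLp_zeroExt h).coeFn_toLp

lemma norm_extL_le (h : L2 a b) : ‖extL h‖ ≤ ‖h‖ := by
  simpa using (LinearMap.mkContinuous_norm_le _ zero_le_one _).trans' le_rfl |>
    fun hh => (extL (a := a) (b := b)).le_of_opNorm_le hh h

/-- The integral of the product of two square integrable functions. -/
lemma abs_integral_mul_le {α : Type*} [MeasurableSpace α] {μ : Measure α} {f g : α → ℝ}
    (hf : MemLp f 2 μ) (hg : MemLp g 2 μ) :
    |∫ x, f x * g x ∂μ| ≤ ‖hf.toLp‖ * ‖hg.toLp‖ := by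
  have h := abs_real_inner_le_norm hg.toLp hf.toLp
  rw [L2.inner_def] at h
  rw [mul_comm]
  refine le_trans (le_of_eq ?_) h
  congr 1
  refine integral_congr_ae ?_
  filter_upwards [hf.coeFn_toLp, hg.coeFn_toLp] with x h1 h2
  simp [h1, h2]

lemma norm_toLp_sq {α : Type*} [MeasurableSpace α] {μ : Measure α} {f : α → ℝ}
    (hf : MemLp f 2 μ) : ‖hf.toLp‖ ^ 2 = ∫ x, f x ^ 2 ∂μ := by
  rw [← real_inner_self_eq_norm_sq, L2.inner_def]
  refine integral_congr_ae ?_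
  filter_upwards [hf.coeFn_toLp] with x h1
  simp [h1, sq]

end ZeroExt

/-! ### Delay operators on L²(0,T). -/

section Shift

variable {T : ℝ}

/-- Translation by `-σ` as a continuous map. -/
def subMap (σ : ℝ) : C(ℝ, ℝ) := ⟨fun t => t - σ, by fun_prop⟩

lemma measurePreserving_subMap (σ : ℝ) : MeasurePreserving (subMap σ) volume volume :=
  measurePreserving_sub_right volume σ

lemma continuous_subMap : Continuous subMap := by
  have : Continuous fun p : ℝ × ℝ => p.2 - p.1 := by fun_prop
  exact ContinuousMap.continuous_of_continuous_uncurry _ this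

/-- Right translation by `σ` on `L²(0, T)`, with zeros shifted in. -/
noncomputable def shift (σ : ℝ) : L2 0 T →L[ℝ] L2 0 T :=
  (LpToLpRestrictCLM ℝ ℝ ℝ volume 2 (Ioo 0 T)).comp
    ((Lp.compMeasurePreservingₗᵢ ℝ (subMap σ)
      (measurePreserving_subMap σ)).toContinuousLinearMap.comp extL)

lemma coeFn_shift (σ : ℝ) (h : L2 0 T) :
    shift σ h =ᵐ[volume.restrict (Ioo 0 T)] fun t => zeroExt h (t - σ) := by
  refine (LpToLpRestrictCLM_coeFn ℝ _ _).trans (ae_restrict_of_ae ?_)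
  refine (Lp.coeFn_compMeasurePreserving (extL h) (measurePreserving_subMap σ)).trans ?_
  exact (measurePreserving_subMap σ).quasiMeasurePreserving.ae_eq_comp (coeFn_extL h)

lemma zeroExt_shift (σ : ℝ) (h : L2 0 T) :
    zeroExt (shift σ h) =ᵐ[volume] (Ioo 0 T).indicator fun t => zeroExt h (t - σ) :=
  zeroExt_congr (coeFn_shift σ h)

lemma ae_sub {p : ℝ → Prop} (σ : ℝ) (hp : ∀ᵐ t, p t) : ∀ᵐ t, p (t - σ) :=
  (measurePreserving_subMap σ).quasiMeasurePreserving.ae hp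

/-- With nonnegative delays the intermediate cut-off to (0,T) loses nothing: at a time before T only
values at earlier times enter, and these are zero before time 0. -/
lemma shift_shift {σ τ : ℝ} (hσ : 0 ≤ σ) (hτ : 0 ≤ τ) (h : L2 0 T) :
    shift σ (shift τ h) = shift (σ + τ) h := by
  apply Lp.ext
  refine (coeFn_shift _ _).trans (EventuallyEq.trans ?_ (coeFn_shift _ _).symm)
  rw [EventuallyEq, ae_restrict_iff' measurableSet_Ioo]
  filter_upwards [ae_sub σ (zeroExt_shift τ h)] with t ht ht'
  rw [ht, ← sub_sub]
  by_cases h1 : 0 < t - σ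
  · have h2 : t - σ ∈ Ioo 0 T := ⟨h1, by linarith [ht'.2]⟩
    rw [indicator_of_mem h2]
  · rw [indicator_of_notMem (fun h2 => h1 h2.1), zeroExt_of_notMem]
    intro h2
    linarith [h2.1]

lemma shift_comm {σ τ : ℝ} (hσ : 0 ≤ σ) (hτ : 0 ≤ τ) (h : L2 0 T) :
    shift σ (shift τ h) = shift τ (shift σ h) := by
  rw [shift_shift hσ hτ, shift_shift hτ hσ, add_comm]

@[simp] lemma shift_zero (h : L2 0 T) : shift 0 h = h := by
  apply Lp.ext
  refine (coeFn_shift _ _).trans ?_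
  simpa using zeroExt_ae h

lemma norm_shift_le (σ : ℝ) (h : L2 0 T) : ‖shift σ h‖ ≤ ‖h‖ := by
  refine (norm_Lp_toLp_restrict_le _ _).trans ?_
  exact ((Lp.norm_compMeasurePreserving _ (measurePreserving_subMap σ)).le).trans (norm_extL_le h)

lemma continuous_shift : Continuous fun p : ℝ × L2 0 T => shift p.1 p.2 := by
  refine (LpToLpRestrictCLM ℝ ℝ ℝ volume 2 (Ioo 0 T)).continuous.comp ?_
  exact Continuous.compMeasurePreservingLp (extL.continuous.comp continuous_snd)
    (continuous_subMap.comp continuous_fst) (fun p => measurePreserving_subMap p.1) (by norm_num)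

end Shift

/-! ### Exponentially weighted norms. -/

section Weight

variable {T : ℝ}

lemma memLp_exp_mul (c : ℝ) (h : L2 0 T) :
    MemLp (fun t => Real.exp (c * t) * h t) 2 (volume.restrict (Ioo 0 T)) := by
  refine MemLp.of_le_mul (c := Real.exp (|c| * T)) (Lp.memLp h) ?_ ?_
  · exact (by fun_prop : Continuous fun t => Real.exp (c * t)).aestronglyMeasurable.mul
      (Lp.aestronglyMeasurable h)
  · rw [ae_restrict_iff' measurableSet_Ioo]
    refine Eventually.of_forall fun t ht => ?_
    rw [norm_mul, Real.norm_of_nonneg (Real.exp_pos _).le]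
    refine mul_le_mul_of_nonneg_right (Real.exp_le_exp.2 ?_) (norm_nonneg _)
    calc c * t ≤ |c| * t := mul_le_mul_of_nonneg_right (le_abs_self c) ht.1.le
      _ ≤ |c| * T := mul_le_mul_of_nonneg_left ht.2.le (abs_nonneg c)

/-- Multiplication by `exp (c t)`. -/
noncomputable def expMul (c : ℝ) : L2 0 T →L[ℝ] L2 0 T :=
  LinearMap.mkContinuous
    { toFun := fun h => (memLp_exp_mul c h).toLp
      map_add' := fun h k => by
        rw [← MemLp.toLp_add]
        refine MemLp.toLp_congr _ _ ?_
        filter_upwards [Lp.coeFn_add h k] with t ht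
        rw [ht, Pi.add_apply, Pi.add_apply, mul_add]
      map_smul' := fun r h => by
        rw [RingHom.id_apply, ← MemLp.toLp_const_smul]
        refine MemLp.toLp_congr _ _ ?_
        filter_upwards [Lp.coeFn_smul r h] with t ht
        rw [ht]
        simp [mul_left_comm] } (Real.exp (|c| * T)) fun h => by
    simp only [LinearMap.coe_mk, AddHom.coe_mk]
    refine Lp.norm_le_mul_norm_of_ae_le_mul ?_
    filter_upwards [(memLp_exp_mul c h).coeFn_toLp, ae_restrict_mem measurableSet_Ioo]
      with t ht ht'
    rw [ht, norm_mul, Real.norm_of_nonneg (Real.exp_pos _).le]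
    refine mul_le_mul_of_nonneg_right (Real.exp_le_exp.2 ?_) (norm_nonneg _)
    calc c * t ≤ |c| * t := mul_le_mul_of_nonneg_right (le_abs_self c) ht'.1.le
      _ ≤ |c| * T := mul_le_mul_of_nonneg_left ht'.2.le (abs_nonneg c)

lemma coeFn_expMul (c : ℝ) (h : L2 0 T) :
    expMul c h =ᵐ[volume.restrict (Ioo 0 T)] fun t => Real.exp (c * t) * h t :=
  (memLp_exp_mul c h).coeFn_toLp

lemma expMul_expMul (c d : ℝ) (h : L2 0 T) : expMul c (expMul d h) = expMul (c + d) h := by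
  apply Lp.ext
  filter_upwards [coeFn_expMul c (expMul d h), coeFn_expMul d h, coeFn_expMul (c + d) h]
    with t h1 h2 h3
  rw [h1, h2, h3, add_mul, Real.exp_add, mul_assoc]

@[simp] lemma expMul_zero (h : L2 0 T) : expMul 0 h = h := by
  apply Lp.ext
  filter_upwards [coeFn_expMul 0 h] with t h1
  simp [h1]

/-- The weight turns a delay by σ into a scalar factor; with -c in place of c this factor exp(-cσ)
makes delays small. -/
lemma expMul_shift (c σ : ℝ) (h : L2 0 T) :
    expMul c (shift σ h) = Real.exp (c * σ) • shift σ (expMul c h) := by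
  apply Lp.ext
  rw [EventuallyEq, ae_restrict_iff' measurableSet_Ioo]
  have e1 := (ae_restrict_iff' measurableSet_Ioo).1 (coeFn_expMul c (shift σ h))
  have e2 := (ae_restrict_iff' measurableSet_Ioo).1 (coeFn_shift σ h)
  have e3 := (ae_restrict_iff' measurableSet_Ioo).1
    (Lp.coeFn_smul (Real.exp (c * σ)) (shift σ (expMul c h)))
  have e4 := (ae_restrict_iff' measurableSet_Ioo).1 (coeFn_shift σ (expMul c h))
  have e5 := ae_sub σ (zeroExt_congr (coeFn_expMul c h))
  filter_upwards [e1, e2, e3, e4, e5] with t h1 h2 h3 h4 h5 ht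
  rw [h1 ht, h2 ht, h3 ht, Pi.smul_apply, h4 ht, h5, smul_eq_mul, zeroExt]
  by_cases hm : t - σ ∈ Ioo 0 T
  · rw [indicator_of_mem hm, indicator_of_mem hm, ← mul_assoc, ← Real.exp_add]
    ring_nf
  · rw [indicator_of_notMem hm, indicator_of_notMem hm]
    simp

/-- The exponentially weighted norm. -/
noncomputable def wnorm (c : ℝ) (h : L2 0 T) : ℝ := ‖expMul (-c) h‖

lemma wnorm_nonneg (c : ℝ) (h : L2 0 T) : 0 ≤ wnorm c h := norm_nonneg _

@[simp] lemma wnorm_zero (c : ℝ) : wnorm c (0 : L2 0 T) = 0 := by simp [wnorm]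

lemma wnorm_add_le (c : ℝ) (h k : L2 0 T) : wnorm c (h + k) ≤ wnorm c h + wnorm c k := by
  simp only [wnorm, map_add]
  exact norm_add_le _ _

lemma wnorm_smul (c r : ℝ) (h : L2 0 T) : wnorm c (r • h) = |r| * wnorm c h := by
  simp [wnorm, norm_smul]

lemma wnorm_shift_le {c σ : ℝ} (h : L2 0 T) :
    wnorm c (shift σ h) ≤ Real.exp (-c * σ) * wnorm c h := by
  rw [wnorm, expMul_shift, norm_smul, Real.norm_of_nonneg (Real.exp_pos _).le]
  gcongr
  exact norm_shift_le _ _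

lemma wnorm_shift_le' {c σ : ℝ} (hc : 0 ≤ c) (hσ : 0 ≤ σ) (h : L2 0 T) :
    wnorm c (shift σ h) ≤ wnorm c h := by
  refine (wnorm_shift_le h).trans (mul_le_of_le_one_left (wnorm_nonneg _ _) ?_)
  rw [Real.exp_le_one_iff]
  nlinarith [mul_nonneg hc hσ]

lemma wnorm_setIntegral_le {c : ℝ} {s : Set ℝ} (F : ℝ → L2 0 T)
    {K : ℝ} (hfin : volume s ≠ ⊤) (hK : ∀ y ∈ s, wnorm c (F y) ≤ K) :
    wnorm c (∫ y in s, F y) ≤ K * volume.real s := by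
  -- No integrability is assumed: otherwise the integral is 0, and the bound on the right is
  -- nonnegative, either because s has a point or because its measure is 0.
  by_cases hF : IntegrableOn F s
  · rw [wnorm, ← ContinuousLinearMap.integral_comp_comm _ hF]
    exact norm_setIntegral_le_of_norm_le_const hfin.lt_top hK
  · rw [integral_undef hF, wnorm_zero]
    by_cases hn : s.Nonempty
    · obtain ⟨y, hy⟩ := hn
      have := (wnorm_nonneg _ _).trans (hK y hy)
      positivity
    · rw [not_nonempty_iff_eq_empty.1 hn]; simp

end Weight

/-! ### Integration in time and its smallness in the weighted norms. -/

section Primitive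

variable {T : ℝ}

/-- The primitive of a function on `(0, T)`, extended by zero to negative times. -/
noncomputable def primFun (h : L2 0 T) (t : ℝ) : ℝ := ∫ s in (0 : ℝ)..t, zeroExt h s

lemma continuous_primFun (h : L2 0 T) : Continuous (primFun h) :=
  intervalIntegral.continuous_primitive (fun _ _ => (integrable_zeroExt h).intervalIntegrable) 0

lemma primFun_of_nonpos (h : L2 0 T) {t : ℝ} (ht : t ≤ 0) : primFun h t = 0 := by
  rw [primFun, intervalIntegral.integral_symm, intervalIntegral.integral_of_le ht]
  rw [setIntegral_eq_zero_of_forall_eq_zero, neg_zero]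
  exact fun s hs => zeroExt_of_notMem _ fun h' => absurd h'.1 (not_lt.2 hs.2)

lemma primFun_add (h k : L2 0 T) (t : ℝ) : primFun (h + k) t = primFun h t + primFun k t := by
  rw [primFun, primFun, primFun, ← intervalIntegral.integral_add
    (integrable_zeroExt h).intervalIntegrable (integrable_zeroExt k).intervalIntegrable]
  refine intervalIntegral.integral_congr_ae ?_
  filter_upwards [zeroExt_add h k] with s hs _ using hs

lemma primFun_smul (c : ℝ) (h : L2 0 T) (t : ℝ) : primFun (c • h) t = c * primFun h t := by
  rw [primFun, primFun, ← intervalIntegral.integral_const_mul]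
  refine intervalIntegral.integral_congr_ae ?_
  filter_upwards [zeroExt_smul c h] with s hs _ using hs

/-- The weighted bound for the primitive. -/
lemma exp_mul_abs_primFun_le {c : ℝ} (hc : 0 < c) (h : L2 0 T) {t : ℝ} (ht : t ∈ Ioo 0 T) :
    Real.exp (-c * t) * |primFun h t| ≤ (√(2 * c))⁻¹ * wnorm c h := by
  have hsub : Ioo 0 t ⊆ Ioo 0 T := Ioo_subset_Ioo_right ht.2.le
  have hk : MemLp (expMul (-c) h) 2 (volume.restrict (Ioo 0 t)) :=
    (Lp.memLp (expMul (-c) h)).mono_measure (Measure.restrict_mono hsub le_rfl)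
  have hE : MemLp (fun s => Real.exp (-c * (t - s))) 2 (volume.restrict (Ioo 0 t)) := by
    refine MemLp.of_bound (by fun_prop) 1 ?_
    rw [ae_restrict_iff' measurableSet_Ioo]
    refine Eventually.of_forall fun s hs => ?_
    rw [Real.norm_of_nonneg (Real.exp_pos _).le, Real.exp_le_one_iff]
    nlinarith [mul_pos hc (sub_pos.2 hs.2)]
  have e1 : Real.exp (-c * t) * primFun h t
      = ∫ s in Ioo 0 t, Real.exp (-c * (t - s)) * expMul (-c) h s := by
    rw [primFun, intervalIntegral.integral_of_le ht.1.le, integral_Ioc_eq_integral_Ioo,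
      ← integral_const_mul]
    refine setIntegral_congr_ae measurableSet_Ioo ?_
    have e2 := (ae_restrict_iff' measurableSet_Ioo).1 (coeFn_expMul (-c) h)
    filter_upwards [e2] with s hs hst
    rw [hs (hsub hst), zeroExt, indicator_of_mem (hsub hst), ← mul_assoc, ← Real.exp_add]
    ring_nf
  rw [← abs_of_pos (Real.exp_pos (-c * t)), ← abs_mul, e1]
  refine (abs_integral_mul_le hE hk).trans ?_
  gcongr
  -- The constant of the Cauchy-Schwarz inequality: the integral of exp(-2c(t-s)) over 0 < s < t is
  -- less than 1/(2c).
  · rw [← abs_of_nonneg (norm_nonneg (MemLp.toLp _ hE)), ← Real.sqrt_inv]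
    refine Real.abs_le_sqrt ?_
    rw [norm_toLp_sq]
    have e3 : ∀ s ∈ uIcc 0 t, HasDerivAt (fun s => (2 * c)⁻¹ * Real.exp (-(2 * c) * (t - s)))
        (Real.exp (-c * (t - s)) ^ 2) s := by
      intro s _
      have := (((hasDerivAt_id s).const_sub t).const_mul (-(2 * c))).exp.const_mul (2 * c)⁻¹
      convert! this using 1
      rw [← Real.exp_nat_mul]
      simp only [id]
      field_simp
      push_cast
      ring_nf
    rw [← integral_Ioc_eq_integral_Ioo, ← intervalIntegral.integral_of_le ht.1.le,
      intervalIntegral.integral_eq_sub_of_hasDerivAt e3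
        ((by fun_prop : Continuous _).intervalIntegrable _ _)]
    have : 0 < (2 * c)⁻¹ * Real.exp (-(2 * c) * (t - 0)) := by positivity
    simp only [sub_self, mul_zero, Real.exp_zero, mul_one]
    linarith
  · rw [wnorm, Lp.norm_toLp, Lp.norm_def]
    exact ENNReal.toReal_mono (Lp.eLpNorm_ne_top _)
      (eLpNorm_mono_measure _ (Measure.restrict_mono hsub le_rfl))

lemma abs_primFun_le (h : L2 0 T) (t : ℝ) : |primFun h t| ≤ √(volume.real (Ioo 0 T)) * ‖h‖ := by
  have h1 : |primFun h t| ≤ ∫ s in Ioo 0 T, 1 * |h s| := by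
    have h3 : ∫ s, |zeroExt h s| = ∫ s in Ioo 0 T, 1 * |h s| := by
      rw [← integral_indicator measurableSet_Ioo]
      refine integral_congr_ae (Eventually.of_forall fun s => ?_)
      by_cases hs : s ∈ Ioo 0 T <;> simp [zeroExt, hs]
    rw [← h3, primFun]
    rw [← Real.norm_eq_abs]
    refine (intervalIntegral.norm_integral_le_integral_norm_uIoc).trans ?_
    exact setIntegral_le_integral (integrable_zeroExt h).abs
      (Eventually.of_forall fun s => abs_nonneg _)
  have m1 : MemLp (fun _ : ℝ => (1 : ℝ)) 2 (volume.restrict (Ioo 0 T)) := memLp_const 1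
  have h2 := abs_integral_mul_le m1 (Lp.memLp h).abs
  refine (h1.trans (le_abs_self _)).trans (h2.trans ?_)
  gcongr
  · rw [← abs_of_nonneg (norm_nonneg (MemLp.toLp _ m1))]
    refine Real.abs_le_sqrt ?_
    rw [norm_toLp_sq]
    simp
  · rw [Lp.norm_toLp, Lp.norm_def]
    refine ENNReal.toReal_mono (Lp.eLpNorm_ne_top _) (le_of_eq ?_)
    exact eLpNorm_norm (h : ℝ → ℝ)

/-- The primitive as a bounded continuous function of time. -/
noncomputable def primB : L2 0 T →L[ℝ] BoundedContinuousFunction ℝ ℝ :=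
  LinearMap.mkContinuous
    { toFun := fun h => BoundedContinuousFunction.ofNormedAddCommGroup (primFun h)
        (continuous_primFun h) _ (abs_primFun_le h)
      map_add' := fun h k => by ext t; exact primFun_add h k t
      map_smul' := fun c h => by ext t; exact primFun_smul c h t }
    (√(volume.real (Ioo 0 T))) fun h =>
      BoundedContinuousFunction.norm_ofNormedAddCommGroup_le (f := primFun h)
        (continuous_primFun h) (by positivity) (abs_primFun_le h)

/-- Integration in time, on `L²(0, T)`. -/
noncomputable def prim : L2 0 T →L[ℝ] L2 0 T :=
  (BoundedContinuousFunction.toLp 2 (volume.restrict (Ioo 0 T)) ℝ).comp primB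

lemma coeFn_prim (h : L2 0 T) : prim h =ᵐ[volume.restrict (Ioo 0 T)] primFun h :=
  BoundedContinuousFunction.coeFn_toLp 2 (volume.restrict (Ioo 0 T)) ℝ (primB h)

/-- For t ≤ T the cut-off of `shift` at time T is not seen by the integral, and the part over
negative times is zero. -/
lemma primFun_shift {σ : ℝ} (hσ : 0 ≤ σ) (h : L2 0 T) {t : ℝ} (ht : t ≤ T) :
    primFun (shift σ h) t = primFun h (t - σ) := by
  rcases le_or_gt t 0 with h0 | h0
  · rw [primFun_of_nonpos _ h0, primFun_of_nonpos _ (by linarith)]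
  have e1 : primFun (shift σ h) t = ∫ s in (0 : ℝ)..t, zeroExt h (s - σ) := by
    rw [primFun, intervalIntegral.integral_of_le h0.le, intervalIntegral.integral_of_le h0.le,
      integral_Ioc_eq_integral_Ioo, integral_Ioc_eq_integral_Ioo]
    refine setIntegral_congr_ae measurableSet_Ioo ?_
    filter_upwards [zeroExt_shift σ h] with s hs hst
    rw [hs, indicator_of_mem (Ioo_subset_Ioo_right ht hst)]
  have e2 := primFun_of_nonpos h (t := 0 - σ) (by linarith)
  rw [e1, intervalIntegral.integral_comp_sub_right (fun s => zeroExt h s) σ]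
  have := intervalIntegral.integral_add_adjacent_intervals (μ := volume) (a := 0) (b := 0 - σ)
    (c := t - σ) (f := zeroExt h) (integrable_zeroExt h).intervalIntegrable
    (integrable_zeroExt h).intervalIntegrable
  rw [primFun] at e2 ⊢
  rw [← this, e2, zero_add]

lemma coeFn_prim_shift {σ : ℝ} (hσ : 0 ≤ σ) (h : L2 0 T) :
    prim (shift σ h) =ᵐ[volume.restrict (Ioo 0 T)] fun t => primFun h (t - σ) := by
  filter_upwards [coeFn_prim (shift σ h), ae_restrict_mem measurableSet_Ioo] with t h1 h2
  rw [h1, primFun_shift hσ h h2.2.le]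

lemma prim_shift {σ : ℝ} (hσ : 0 ≤ σ) (h : L2 0 T) : prim (shift σ h) = shift σ (prim h) := by
  apply Lp.ext
  refine (coeFn_prim_shift hσ h).trans (EventuallyEq.trans ?_ (coeFn_shift _ _).symm)
  rw [EventuallyEq, ae_restrict_iff' measurableSet_Ioo]
  filter_upwards [ae_sub σ (zeroExt_congr (coeFn_prim h))] with t h1 ht
  rw [h1]
  by_cases hm : t - σ ∈ Ioo 0 T
  · rw [indicator_of_mem hm]
  · rw [indicator_of_notMem hm, primFun_of_nonpos]
    by_contra h0
    exact hm ⟨not_le.1 h0, by linarith [ht.2]⟩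

lemma wnorm_prim_le {c : ℝ} (hc : 0 < c) (h : L2 0 T) :
    wnorm c (prim h) ≤ √(volume.real (Ioo 0 T)) * ((√(2 * c))⁻¹ * wnorm c h) := by
  rw [wnorm]
  have h0 := Lp.norm_le_of_ae_bound (f := expMul (-c) (prim h))
    (C := (√(2 * c))⁻¹ * wnorm c h) (mul_nonneg (by positivity) (wnorm_nonneg _ _)) (by
      filter_upwards [coeFn_expMul (-c) (prim h), coeFn_prim h,
        ae_restrict_mem measurableSet_Ioo] with t h1 h2 h3
      rw [h1, h2, norm_mul, Real.norm_of_nonneg (Real.exp_pos _).le]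
      exact exp_mul_abs_primFun_le hc h h3)
  refine h0.trans (le_of_eq ?_)
  congr 1
  rw [Real.sqrt_eq_rpow, measureUnivNNReal]
  simp only [Measure.real, Measure.restrict_apply_univ, ENNReal.toReal_ofNat, one_div]
  rfl

/-- The primitive is small in the weighted norms. -/
lemma eventually_wnorm_prim_le {ε : ℝ} (hε : 0 < ε) :
    ∀ᶠ c in atTop, ∀ h : L2 0 T, wnorm c (prim h) ≤ ε * wnorm c h := by
  have h1 : Tendsto (fun c : ℝ => √(volume.real (Ioo 0 T)) * (√(2 * c))⁻¹) atTop (𝓝 0) := by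
    have h2 : Tendsto (fun c : ℝ => (√(2 * c))⁻¹) atTop (𝓝 0) :=
      tendsto_inv_atTop_zero.comp (Real.tendsto_sqrt_atTop.comp
        (tendsto_id.const_mul_atTop (two_pos : (0 : ℝ) < 2)))
    simpa only [mul_zero] using h2.const_mul (√(volume.real (Ioo 0 T)))
  filter_upwards [h1.eventually_le_const hε, eventually_gt_atTop (0 : ℝ)] with c h2 hc h
  refine (wnorm_prim_le hc h).trans ?_
  rw [← mul_assoc]
  exact mul_le_mul_of_nonneg_right h2 (wnorm_nonneg _ _)

end Primitive

/-! ### Fixed points of contractions in an equivalent norm. -/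

section FixedPoint

/-- If `N` is a contraction in an equivalent norm, then `x = b + N x` is uniquely solvable. -/
lemma exists_resolvent {X : Type*} [NormedAddCommGroup X] [NormedSpace ℝ X] [CompleteSpace X]
    (M M' : X →L[ℝ] X) (h1 : ∀ x, M (M' x) = x) (h2 : ∀ x, M' (M x) = x) (N : X →ₗ[ℝ] X)
    {k : ℝ} (hk0 : 0 ≤ k) (hk : k < 1) (hN : ∀ x, ‖M' (N x)‖ ≤ k * ‖M' x‖) :
    ∃ R : X →ₗ[ℝ] X, (∀ b, R b = b + N (R b)) ∧ ∀ b x, x = b + N x → x = R b := by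
  -- Conjugation with M turns the estimate in the equivalent norm into an operator norm below 1, so
  -- that 1 - N' is inverted by a Neumann series.
  let N' : X →L[ℝ] X := LinearMap.mkContinuous
    ((M' : X →ₗ[ℝ] X) ∘ₗ N ∘ₗ (M : X →ₗ[ℝ] X)) k fun x => by
      simpa [h2] using hN (M x)
  have hN' : ∀ x, N' x = M' (N (M x)) := fun x => rfl
  have hnorm : ‖N'‖ < 1 := (LinearMap.mkContinuous_norm_le _ hk0 _).trans_lt hk
  obtain ⟨A, hA⟩ := isUnit_one_sub_of_norm_lt_one hnorm
  have hr : ∀ x, (↑A⁻¹ : X →L[ℝ] X) x - N' ((↑A⁻¹ : X →L[ℝ] X) x) = x := fun x => by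
    have := congrArg (fun B : X →L[ℝ] X => B x) A.mul_inv
    rw [hA] at this
    simpa using this
  have hl : ∀ x, (↑A⁻¹ : X →L[ℝ] X) (x - N' x) = x := fun x => by
    have := congrArg (fun B : X →L[ℝ] X => B x) A.inv_mul
    rw [hA] at this
    simpa using this
  refine ⟨(M : X →ₗ[ℝ] X) ∘ₗ ((↑A⁻¹ : X →L[ℝ] X) : X →ₗ[ℝ] X) ∘ₗ (M' : X →ₗ[ℝ] X),
    fun b => ?_, fun b x hx => ?_⟩
  · have := congrArg M (hr (M' b))
    rw [hN', map_sub, h1, h1, sub_eq_iff_eq_add] at this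
    exact this
  · have h3 : M' x - N' (M' x) = M' b := by
      rw [hN', h1, ← map_sub]
      congr 1
      rw [sub_eq_iff_eq_add]
      exact hx
    have := hl (M' x)
    rw [h3] at this
    change x = M _
    simp only [LinearMap.coe_comp, ContinuousLinearMap.coe_coe, Function.comp_apply]
    rw [this, h1]

variable {T : ℝ}

/-- Linear maps whose exponentially weighted norms become arbitrarily small. -/
def IsSmall (A : L2 0 T →ₗ[ℝ] L2 0 T) : Prop :=
  ∀ ε > 0, ∀ᶠ c in atTop, ∀ h, wnorm c (A h) ≤ ε * wnorm c h

lemma isSmall_shift {σ : ℝ} (hσ : 0 < σ) :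
    IsSmall ((shift σ : L2 0 T →L[ℝ] L2 0 T) : L2 0 T →ₗ[ℝ] L2 0 T) := by
  intro ε hε
  have h1 : Tendsto (fun c : ℝ => Real.exp (-c * σ)) atTop (𝓝 0) := by
    refine Real.tendsto_exp_atBot.comp ?_
    exact tendsto_neg_atTop_atBot.atBot_mul_const hσ
  filter_upwards [h1.eventually_le_const hε] with c hc h
  exact (wnorm_shift_le h).trans (mul_le_mul_of_nonneg_right hc (wnorm_nonneg _ _))

end FixedPoint

/-! ### Duhamel integrals with general delays. -/

section Duhamel

variable {T : ℝ}

/-- The Duhamel integral with delays `κ x y`. -/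
noncomputable def duhamel (l : ℝ) (κ : ℝ → ℝ → ℝ) (F : ℝ → L2 0 T) (x : ℝ) : L2 0 T :=
  (1 / 2 : ℝ) • ∫ y in Ioo 0 l, prim (shift (κ x y) (F y))

variable {l : ℝ} {κ : ℝ → ℝ → ℝ} {F : ℝ → L2 0 T}

lemma continuous_prim_shift : Continuous fun p : ℝ × L2 0 T => prim (shift p.1 p.2) :=
  prim.continuous.comp continuous_shift

lemma aestronglyMeasurable_prim_shift {α : Type*} [MeasurableSpace α] {μ : Measure α}
    {k : α → ℝ} {G : α → L2 0 T} (hk : AEStronglyMeasurable k μ) (hG : AEStronglyMeasurable G μ) :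
    AEStronglyMeasurable (fun y => prim (shift (k y) (G y))) μ :=
  Continuous.comp_aestronglyMeasurable (g := fun p : ℝ × L2 0 T => prim (shift p.1 p.2))
    (f := fun y => (k y, G y)) continuous_prim_shift (hk.prodMk hG)

lemma norm_prim_shift_le (σ : ℝ) (h : L2 0 T) :
    ‖prim (shift σ h)‖ ≤ ‖(prim : L2 0 T →L[ℝ] L2 0 T)‖ * ‖h‖ :=
  (prim.le_opNorm _).trans (mul_le_mul_of_nonneg_left (norm_shift_le _ _) (norm_nonneg _))

lemma integrableOn_prim_shift (hκ : Continuous (Function.uncurry κ)) (hF : IntegrableOn F (Ioo 0 l))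
    (x : ℝ) : IntegrableOn (fun y => prim (shift (κ x y) (F y))) (Ioo 0 l) := by
  have hκx : Continuous (κ x) := hκ.comp (Continuous.prodMk_right x)
  exact (hF.norm.const_mul ‖(prim : L2 0 T →L[ℝ] L2 0 T)‖).mono'
    (aestronglyMeasurable_prim_shift hκx.aestronglyMeasurable hF.aestronglyMeasurable)
    (Eventually.of_forall fun y => norm_prim_shift_le _ _)

lemma continuous_duhamel (hκ : Continuous (Function.uncurry κ)) (hF : IntegrableOn F (Ioo 0 l)) :
    Continuous (duhamel l κ F) := by
  have h1 : Continuous fun x => ∫ y in Ioo 0 l, prim (shift (κ x y) (F y)) := ?_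
  · exact h1.const_smul (1 / 2 : ℝ)
  refine continuous_of_dominated
    (bound := fun y => ‖(prim : L2 0 T →L[ℝ] L2 0 T)‖ * ‖F y‖) (fun x =>
    (integrableOn_prim_shift hκ hF x).aestronglyMeasurable)
    (fun x => Eventually.of_forall fun y => norm_prim_shift_le _ _)
    (hF.norm.const_mul _) (Eventually.of_forall fun y => ?_)
  have hκy : Continuous fun x => κ x y := hκ.comp (Continuous.prodMk_left y)
  exact Continuous.comp (g := fun p : ℝ × L2 0 T => prim (shift p.1 p.2))
    (f := fun x => (κ x y, F y)) continuous_prim_shift (hκy.prodMk continuous_const)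

lemma shift_duhamel (hκ : Continuous (Function.uncurry κ)) (hF : IntegrableOn F (Ioo 0 l))
    {σ x : ℝ} (hσ : 0 ≤ σ) (hx : ∀ y ∈ Ioo 0 l, 0 ≤ κ x y) :
    shift σ (duhamel l κ F x) = duhamel l κ (fun y => shift σ (F y)) x := by
  rw [duhamel, duhamel, map_smul, ← ContinuousLinearMap.integral_comp_comm _
    (integrableOn_prim_shift hκ hF x)]
  congr 1
  refine setIntegral_congr_fun measurableSet_Ioo fun y hy => ?_
  rw [shift_comm (hx y hy) hσ, prim_shift hσ]

lemma duhamel_congr {κ' : ℝ → ℝ → ℝ} {F' : ℝ → L2 0 T} {x : ℝ}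
    (h : ∀ y ∈ Ioo 0 l, shift (κ x y) (F y) = shift (κ' x y) (F' y)) :
    duhamel l κ F x = duhamel l κ' F' x := by
  rw [duhamel, duhamel]
  congr 1
  exact setIntegral_congr_fun measurableSet_Ioo fun y hy => by simp only [h y hy]

lemma duhamel_add (hκ : Continuous (Function.uncurry κ)) {G : ℝ → L2 0 T}
    (hF : IntegrableOn F (Ioo 0 l)) (hG : IntegrableOn G (Ioo 0 l)) (x : ℝ) :
    duhamel l κ (fun y => F y + G y) x = duhamel l κ F x + duhamel l κ G x := by
  simp only [duhamel, map_add]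
  rw [integral_add (integrableOn_prim_shift hκ hF x) (integrableOn_prim_shift hκ hG x), smul_add]

lemma duhamel_smul (r : ℝ) (x : ℝ) :
    duhamel l κ (fun y => r • F y) x = r • duhamel l κ F x := by
  simp only [duhamel, map_smul]
  rw [integral_smul, smul_comm]

/-- The delay may vanish, so the small factor comes from `prim` alone. The estimate is uniform in
the kernel, the source and the position. -/
lemma eventually_wnorm_duhamel_le (l : ℝ) {ε : ℝ} (hε : 0 < ε) :
    ∀ᶠ c in atTop, ∀ (κ : ℝ → ℝ → ℝ) (F : ℝ → L2 0 T) (B x : ℝ), 0 ≤ B →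
      (∀ y ∈ Ioo 0 l, 0 ≤ κ x y) → (∀ y ∈ Ioo 0 l, wnorm c (F y) ≤ B) →
      wnorm c (duhamel l κ F x) ≤ ε * B := by
  have hδ : 0 < ε / (volume.real (Ioo 0 l) + 1) := by positivity
  filter_upwards [eventually_wnorm_prim_le (T := T) hδ, eventually_ge_atTop (0 : ℝ)]
    with c hc hc0 κ F B x hB hκ hF
  have h1 := wnorm_setIntegral_le (c := c) (s := Ioo 0 l) (fun y => prim (shift (κ x y) (F y)))
    (K := ε / (volume.real (Ioo 0 l) + 1) * B) measure_Ioo_lt_top.ne fun y hy => by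
      refine (hc _).trans (mul_le_mul_of_nonneg_left ?_ hδ.le)
      exact (wnorm_shift_le' hc0 (hκ y hy) _).trans (hF y hy)
  rw [duhamel, wnorm_smul]
  have h2 : ε / (volume.real (Ioo 0 l) + 1) * volume.real (Ioo 0 l) ≤ ε := by
    rw [div_mul_eq_mul_div, div_le_iff₀ (by positivity)]
    nlinarith
  have h3 : |(1 / 2 : ℝ)| ≤ 1 := by norm_num
  have h4 := mul_le_mul_of_nonneg_right h2 hB
  calc _ ≤ 1 * _ := mul_le_mul_of_nonneg_right h3 (wnorm_nonneg _ _)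
    _ ≤ ε / (volume.real (Ioo 0 l) + 1) * B * volume.real (Ioo 0 l) := by rw [one_mul]; exact h1
    _ ≤ _ := by nlinarith

end Duhamel

/-! ### The Volterra equation on one edge. -/

section EdgeResolvent

variable {T l : ℝ} {q : ℝ → ℝ}

lemma integrableOn_potential (hq : ContinuousOn q (Ioo 0 l)) {Q : ℝ}
    (hQ : ∀ x ∈ Ioo 0 l, |q x| ≤ Q) {U : ℝ → L2 0 T} (hU : ContinuousOn U (Icc 0 l)) :
    IntegrableOn (fun y => -q y • U y) (Ioo 0 l) := by
  obtain ⟨C, hC⟩ := isCompact_Icc.exists_bound_of_continuousOn hU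
  refine Integrable.of_bound
    ((hq.neg.smul (hU.mono Ioo_subset_Icc_self)).aestronglyMeasurable measurableSet_Ioo) (Q * C) ?_
  rw [ae_restrict_iff' measurableSet_Ioo]
  refine Eventually.of_forall fun y hy => ?_
  rw [norm_smul, norm_neg, Real.norm_eq_abs]
  have h1 := hQ y hy
  exact mul_le_mul h1 (hC y (Ioo_subset_Icc_self hy)) (norm_nonneg _) ((abs_nonneg _).trans h1)

/-- The Duhamel operator with source `-q U`, on continuous functions. -/
noncomputable def potOp (hl : 0 ≤ l) (hq : ContinuousOn q (Ioo 0 l)) {Q : ℝ}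
    (hQ : ∀ x ∈ Ioo 0 l, |q x| ≤ Q) {κ : ℝ → ℝ → ℝ} (hκ : Continuous (Function.uncurry κ)) :
    C(Icc 0 l, L2 0 T) →ₗ[ℝ] C(Icc 0 l, L2 0 T) where
  toFun U := ⟨fun x => duhamel l κ (fun y => -q y • IccExtend hl U y) x,
    (continuous_duhamel hκ (integrableOn_potential hq hQ
      U.continuous.Icc_extend'.continuousOn)).comp continuous_subtype_val⟩
  map_add' U V := by
    ext1 x
    simp only [ContinuousMap.coe_mk, ContinuousMap.add_apply]
    rw [← duhamel_add hκ (integrableOn_potential hq hQ U.continuous.Icc_extend'.continuousOn)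
      (integrableOn_potential hq hQ V.continuous.Icc_extend'.continuousOn)]
    simp [IccExtend, smul_add]
  map_smul' r U := by
    ext1 x
    simp only [ContinuousMap.coe_mk, ContinuousMap.smul_apply, RingHom.id_apply]
    rw [← duhamel_smul]
    simp [IccExtend, smul_comm r]

/-- The operator with source -qU is a contraction in the supremum over x of a weighted norm, so U =
V + `potOp` U has a resolvent. The delays are kept general because two kernels are needed: |x-y|,
and 2 max(x-y, 0) for waves whose travel time has been removed. -/
lemma exists_edge_resolvent (hl : 0 ≤ l) (hq : ContinuousOn q (Ioo 0 l)) {Q : ℝ}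
    (hQ : ∀ x ∈ Ioo 0 l, |q x| ≤ Q) {κ : ℝ → ℝ → ℝ} (hκ : Continuous (Function.uncurry κ))
    (hκ0 : ∀ x ∈ Icc 0 l, ∀ y ∈ Icc 0 l, 0 ≤ κ x y) :
    (∀ ε > 0, ∀ᶠ c in atTop, ∀ (U : C(Icc 0 l, L2 0 T)) (K : ℝ), 0 ≤ K →
      (∀ x, wnorm c (U x) ≤ K) → ∀ x, wnorm c (potOp hl hq hQ hκ U x) ≤ ε * K) ∧
    ∃ R : C(Icc 0 l, L2 0 T) →ₗ[ℝ] C(Icc 0 l, L2 0 T),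
      (∀ V, R V = V + potOp hl hq hQ hκ (R V)) ∧
      (∀ V U, U = V + potOp hl hq hQ hκ U → U = R V) ∧
      ∀ᶠ c in atTop, ∀ (V : C(Icc 0 l, L2 0 T)) (K : ℝ), 0 ≤ K →
        (∀ x, wnorm c (V x) ≤ K) → ∀ x, wnorm c (R V x) ≤ 2 * K := by
  have key : ∀ ε > 0, ∀ᶠ c in atTop, ∀ (U : C(Icc 0 l, L2 0 T)) (K : ℝ), 0 ≤ K →
      (∀ x, wnorm c (U x) ≤ K) → ∀ x, wnorm c (potOp hl hq hQ hκ U x) ≤ ε * K := by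
    intro ε hε
    have hQ1 : 0 < |Q| + 1 := by positivity
    filter_upwards [eventually_wnorm_duhamel_le (T := T) l (div_pos hε hQ1)]
      with c hc U K hK hU x
    have := hc κ (fun y => -q y • IccExtend hl U y) ((|Q| + 1) * K) x (by positivity)
      (fun y hy => hκ0 x x.2 y (Ioo_subset_Icc_self hy)) fun y hy => by
        rw [wnorm_smul, abs_neg]
        refine mul_le_mul ?_ (hU _) (wnorm_nonneg _ _) hQ1.le
        linarith [hQ y hy, le_abs_self Q]
    refine this.trans (le_of_eq ?_)
    field_simp
  refine ⟨key, ?_⟩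
  let M : ℝ → C(Icc 0 l, L2 0 T) →L[ℝ] C(Icc 0 l, L2 0 T) := fun c =>
    ContinuousLinearMap.compLeftContinuous ℝ (Icc 0 l) (expMul c)
  have hM : ∀ c U x, M c U x = expMul c (U x) := fun c U x => rfl
  have hMn : ∀ c U x, wnorm c (U x) ≤ ‖M (-c) U‖ := fun c U x =>
    (M (-c) U).norm_coe_le_norm x
  -- A single weight suffices to construct R. The bound by 2K for all large weights then follows
  -- from the fixed point equation, by absorbing half of the norm.
  obtain ⟨c, hc⟩ := (key (1 / 2) (by norm_num)).exists
  obtain ⟨R, hR1, hR2⟩ := exists_resolvent (M c) (M (-c))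
    (fun U => by ext1 x; rw [hM, hM, expMul_expMul]; simp)
    (fun U => by ext1 x; rw [hM, hM, expMul_expMul]; simp) (potOp hl hq hQ hκ)
    (k := 1 / 2) (by norm_num) (by norm_num) (fun U => by
      rw [ContinuousMap.norm_le _ (by positivity)]
      exact hc U _ (norm_nonneg _) (hMn c U))
  refine ⟨R, hR1, hR2, ?_⟩
  filter_upwards [key (1 / 2) (by norm_num)] with d hd V K hK hV
  have hB : ‖M (-d) (R V)‖ ≤ K + 1 / 2 * ‖M (-d) (R V)‖ := by
    rw [ContinuousMap.norm_le _ (by positivity)]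
    intro x
    have h1 := hd (R V) _ (norm_nonneg _) (hMn d (R V)) x
    change wnorm d (R V x) ≤ _
    conv_lhs => rw [hR1 V]
    exact (wnorm_add_le _ _ _).trans (add_le_add (hV x) h1)
  intro x
  have := hMn d (R V) x
  linarith

end EdgeResolvent

/-! ### Waves on an edge and the linear response at its endpoints. -/

section EdgeWave

variable {T : ℝ}

/-- `U` is a wave on the edge `(0, l)` with potential `q`, as a function of the position with
values in `L²(0, T)`; `p` and `r` are the waves emitted from the endpoints `0` and `l`. -/
structure IsEdgeWave (l : ℝ) (q : ℝ → ℝ) (p r : L2 0 T) (U : ℝ → L2 0 T) : Prop where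
  continuousOn : ContinuousOn U (Icc 0 l)
  eq : ∀ x ∈ Icc 0 l, U x = shift x p + shift (l - x) r +
    duhamel l (fun x y => |x - y|) (fun y => -q y • U y) x

lemma continuous_dist_kernel : Continuous (Function.uncurry fun x y : ℝ => |x - y|) := by
  unfold Function.uncurry; fun_prop

variable {l : ℝ} {q : ℝ → ℝ}

lemma integrableOn_potential' (hq : ContinuousOn q (Ioo 0 l))
    (hQ : ∃ Q, ∀ x ∈ Ioo 0 l, |q x| ≤ Q) {U : ℝ → L2 0 T} (hU : ContinuousOn U (Icc 0 l)) :
    IntegrableOn (fun y => -q y • U y) (Ioo 0 l) :=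
  integrableOn_potential hq hQ.choose_spec hU

lemma IsEdgeWave.add (hq : ContinuousOn q (Ioo 0 l)) (hQ : ∃ Q, ∀ x ∈ Ioo 0 l, |q x| ≤ Q)
    {p r p' r' : L2 0 T} {U U' : ℝ → L2 0 T} (h : IsEdgeWave l q p r U)
    (h' : IsEdgeWave l q p' r' U') :
    IsEdgeWave l q (p + p') (r + r') (fun x => U x + U' x) := by
  refine ⟨h.continuousOn.add h'.continuousOn, fun x hx => ?_⟩
  have := duhamel_add continuous_dist_kernel (integrableOn_potential' hq hQ h.continuousOn)
    (integrableOn_potential' hq hQ h'.continuousOn) x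
  simp only [← smul_add] at this
  rw [this, h.eq x hx, h'.eq x hx, map_add, map_add]
  abel

lemma IsEdgeWave.smul (c : ℝ) {p r : L2 0 T} {U : ℝ → L2 0 T} (h : IsEdgeWave l q p r U) :
    IsEdgeWave l q (c • p) (c • r) (fun x => c • U x) := by
  refine ⟨h.continuousOn.const_smul c, fun x hx => ?_⟩
  have := duhamel_smul (l := l) (κ := fun x y => |x - y|) (F := fun y => -q y • U y) c x
  simp only [smul_comm c] at this
  rw [this, h.eq x hx, map_smul, map_smul, smul_add, smul_add]

/-- The potential does not depend on time, so delaying the emitted waves delays the whole wave. -/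
lemma IsEdgeWave.shift (hq : ContinuousOn q (Ioo 0 l)) (hQ : ∃ Q, ∀ x ∈ Ioo 0 l, |q x| ≤ Q)
    {p r : L2 0 T} {U : ℝ → L2 0 T} (h : IsEdgeWave l q p r U) {σ : ℝ} (hσ : 0 ≤ σ) :
    IsEdgeWave l q (shift σ p) (shift σ r) (fun x => shift σ (U x)) := by
  refine ⟨(RingGraph.shift σ).continuous.comp_continuousOn h.continuousOn, fun x hx => ?_⟩
  have := shift_duhamel continuous_dist_kernel (integrableOn_potential' hq hQ h.continuousOn)
    hσ (x := x) fun y _ => abs_nonneg _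
  simp only [map_smul] at this
  rw [← this]
  conv_lhs => rw [h.eq x hx]
  rw [map_add, map_add, shift_comm hσ hx.1, shift_comm hσ (sub_nonneg.2 hx.2)]

/-- The linear response of an edge: the waves arriving at the endpoints `0` and `l` are
`G00 p + G01 r` and `G10 p + G11 r`. -/
structure EdgeResponse (T l : ℝ) (q : ℝ → ℝ) where
  (G00 G01 G10 G11 E : L2 0 T →ₗ[ℝ] L2 0 T)
  small00 : IsSmall G00
  small01 : IsSmall G01
  small10 : IsSmall G10
  small11 : IsSmall G11
  smallE : IsSmall E
  G01_eq : ∀ h, G01 h = shift l (h + E h)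
  exists_wave : ∀ p r : L2 0 T, ∃ U, IsEdgeWave l q p r U
  unique : ∀ {p r : L2 0 T} {U U' : ℝ → L2 0 T}, IsEdgeWave l q p r U →
    IsEdgeWave l q p r U' → EqOn U U' (Icc 0 l)
  value_tail : ∀ {p r : L2 0 T} {U : ℝ → L2 0 T}, IsEdgeWave l q p r U → U 0 = p + (G00 p + G01 r)
  value_head : ∀ {p r : L2 0 T} {U : ℝ → L2 0 T}, IsEdgeWave l q p r U → U l = r + (G10 p + G11 r)

/-- The wave emitted from the endpoint `0`. -/
noncomputable def tailWave (l : ℝ) : L2 0 T →ₗ[ℝ] C(Icc 0 l, L2 0 T) where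
  toFun p := ⟨fun x => shift x p, continuous_shift.comp (g := fun a : ℝ × L2 0 T => shift a.1 a.2)
    (f := fun x : Icc 0 l => (x.1, p)) (by fun_prop)⟩
  map_add' p p' := by ext1 x; simp
  map_smul' c p := by ext1 x; simp

/-- The wave emitted from the endpoint `l`. -/
noncomputable def headWave (l : ℝ) : L2 0 T →ₗ[ℝ] C(Icc 0 l, L2 0 T) where
  toFun r := ⟨fun x => shift (l - x) r,
    continuous_shift.comp (g := fun a : ℝ × L2 0 T => shift a.1 a.2)
    (f := fun x : Icc 0 l => (l - x.1, r)) (by fun_prop)⟩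
  map_add' p p' := by ext1 x; simp
  map_smul' c p := by ext1 x; simp

/-- The constant function. -/
noncomputable def constWave (l : ℝ) : L2 0 T →ₗ[ℝ] C(Icc 0 l, L2 0 T) where
  toFun r := ContinuousMap.const _ r
  map_add' p p' := by ext1 x; simp
  map_smul' c p := by ext1 x; simp

/-- Evaluation. -/
noncomputable def evalAt {l : ℝ} (x : Icc 0 l) : C(Icc 0 l, L2 0 T) →ₗ[ℝ] L2 0 T where
  toFun U := U x
  map_add' _ _ := rfl
  map_smul' _ _ := rfl

lemma wnorm_tailWave_le {c : ℝ} (hc : 0 ≤ c) (p : L2 0 T) (x : Icc 0 l) :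
    wnorm c (tailWave l p x) ≤ wnorm c p := wnorm_shift_le' hc x.2.1 p

lemma wnorm_headWave_le {c : ℝ} (hc : 0 ≤ c) (p : L2 0 T) (x : Icc 0 l) :
    wnorm c (headWave l p x) ≤ wnorm c p := wnorm_shift_le' hc (sub_nonneg.2 x.2.2) p

/-- The resolvent costs at most a factor 2, while P contributes an arbitrarily small one. -/
lemma isSmall_response {P R : C(Icc 0 l, L2 0 T) →ₗ[ℝ] C(Icc 0 l, L2 0 T)}
    {B : L2 0 T →ₗ[ℝ] C(Icc 0 l, L2 0 T)}
    (hB : ∀ c, 0 ≤ c → ∀ h x, wnorm c (B h x) ≤ wnorm c h)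
    (hP : ∀ ε > 0, ∀ᶠ c in atTop, ∀ (U : C(Icc 0 l, L2 0 T)) (K : ℝ), 0 ≤ K →
      (∀ x, wnorm c (U x) ≤ K) → ∀ x, wnorm c (P U x) ≤ ε * K)
    (hR : ∀ᶠ c in atTop, ∀ (V : C(Icc 0 l, L2 0 T)) (K : ℝ), 0 ≤ K →
        (∀ x, wnorm c (V x) ≤ K) → ∀ x, wnorm c (R V x) ≤ 2 * K) (x : Icc 0 l) :
    IsSmall (evalAt x ∘ₗ P ∘ₗ R ∘ₗ B) := by
  intro ε hε
  filter_upwards [hP (ε / 2) (by positivity), hR, eventually_ge_atTop 0] with c h1 h2 h3 h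
  have h4 := h1 (R (B h)) (2 * wnorm c h) (by linarith [wnorm_nonneg c h])
    (h2 (B h) _ (wnorm_nonneg c h) (hB c h3 h)) x
  refine h4.trans (le_of_eq ?_)
  ring

lemma IsSmall.add {A B : L2 0 T →ₗ[ℝ] L2 0 T} (hA : IsSmall A) (hB : IsSmall B) :
    IsSmall (A + B) := by
  intro ε hε
  filter_upwards [hA (ε / 2) (by positivity), hB (ε / 2) (by positivity)] with c h1 h2 h
  refine (wnorm_add_le _ _ _).trans ?_
  linarith [h1 h, h2 h]

/-- The responses are endpoint values of the scattered part P R of the wave; the direct wave `shift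
l` is added in G01 and G10. The map E comes from a second resolvent R', for the wave emitted at l
with its travel time removed. -/
lemma nonempty_edgeResponse (T : ℝ) (hl : 0 < l) (hq : ContinuousOn q (Ioo 0 l))
    (hQ : ∃ Q, ∀ x ∈ Ioo 0 l, |q x| ≤ Q) : Nonempty (EdgeResponse T l q) := by
  obtain ⟨Q, hQ'⟩ := hQ
  have hκ := continuous_dist_kernel
  have hκ' : Continuous (Function.uncurry fun x y : ℝ => 2 * max (x - y) 0) := by
    unfold Function.uncurry; fun_prop
  obtain ⟨hP, R, hR1, hR2, hR3⟩ := exists_edge_resolvent (T := T) hl.le hq hQ' hκ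
    fun x _ y _ => abs_nonneg (x - y)
  obtain ⟨hP', R', hR1', hR2', hR3'⟩ := exists_edge_resolvent (T := T) hl.le hq hQ' hκ'
    fun x _ y _ => by positivity
  set P := potOp (T := T) hl.le hq hQ' hκ with hPdef
  set P' := potOp (T := T) hl.le hq hQ' hκ' with hPdef'
  let x0 : Icc 0 l := ⟨0, left_mem_Icc.2 hl.le⟩
  let x1 : Icc 0 l := ⟨l, right_mem_Icc.2 hl.le⟩
  have htail : ∀ c, 0 ≤ c → ∀ (h : L2 0 T) x, wnorm c (tailWave l h x) ≤ wnorm c h :=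
    fun c hc h x => wnorm_tailWave_le hc h x
  have hhead : ∀ c, 0 ≤ c → ∀ (h : L2 0 T) x, wnorm c (headWave l h x) ≤ wnorm c h :=
    fun c hc h x => wnorm_headWave_le hc h x
  have hext : ∀ (U : C(Icc 0 l, L2 0 T)), ∀ x (hx : x ∈ Icc 0 l),
      IccExtend hl.le U x = U ⟨x, hx⟩ := fun U x hx => IccExtend_of_mem _ _ hx
  have hPval : ∀ (U : C(Icc 0 l, L2 0 T)) x, P U x =
      duhamel l (fun x y => |x - y|) (fun y => -q y • IccExtend hl.le U y) x := fun U x => rfl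
  have hPval' : ∀ (U : C(Icc 0 l, L2 0 T)) x, P' U x =
      duhamel l (fun x y => 2 * max (x - y) 0) (fun y => -q y • IccExtend hl.le U y) x :=
    fun U x => rfl
  have hwave : ∀ {p r : L2 0 T} {U}, IsEdgeWave l q p r U → ∀ x (hx : x ∈ Icc 0 l),
      U x = R (tailWave l p + headWave l r) ⟨x, hx⟩ := by
    intro p r U hU
    let W : C(Icc 0 l, L2 0 T) := ⟨fun x => U x, continuousOn_iff_continuous_domRestrict.1
      hU.continuousOn⟩
    have hW : W = (tailWave l p + headWave l r) + P W := by
      ext1 x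
      change U x = shift (x : ℝ) p + shift (l - x) r + P W x
      rw [hU.eq x x.2, hPval]
      congr 1
      refine duhamel_congr fun y hy => ?_
      rw [hext W y (Ioo_subset_Icc_self hy)]
      rfl
    intro x hx
    rw [← hR2 _ _ hW]
    rfl
  have hex : ∀ p r : L2 0 T, IsEdgeWave l q p r
      (IccExtend hl.le (R (tailWave l p + headWave l r))) := by
    intro p r
    refine ⟨(R _).continuous.Icc_extend'.continuousOn, fun x hx => ?_⟩
    rw [hext _ x hx]
    conv_lhs => rw [hR1]
    rw [ContinuousMap.add_apply, hPval]
    rfl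
  have hval : ∀ {p r : L2 0 T} {U}, IsEdgeWave l q p r U → ∀ x (hx : x ∈ Icc 0 l),
      U x = shift x p + shift (l - x) r + ((evalAt ⟨x, hx⟩ ∘ₗ P ∘ₗ R ∘ₗ tailWave l) p +
        (evalAt ⟨x, hx⟩ ∘ₗ P ∘ₗ R ∘ₗ headWave l) r) := by
    intro p r U hU x hx
    rw [hwave hU x hx, hR1, ContinuousMap.add_apply, map_add R, map_add P]
    rfl
  -- Everything caused at x by the wave emitted at l is delayed by at least l - x. This delay
  -- factors out because |x-y| + (l-y) = (l-x) + 2 max(x-y, 0), which is how the kernel of R'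
  -- arises.
  have hhat : ∀ r : L2 0 T, ∀ x : Icc 0 l,
      R (headWave l r) x = shift (l - x) (R' (constWave l r) x) := by
    intro r
    let W : C(Icc 0 l, L2 0 T) := ⟨fun x => shift (l - x) (R' (constWave l r) x),
      Continuous.comp (g := fun a : ℝ × L2 0 T => shift a.1 a.2)
        (f := fun x : Icc 0 l => (l - x.1, R' (constWave l r) x)) continuous_shift (by fun_prop)⟩
    have hW : W = headWave l r + P W := by
      ext1 x
      have hx : 0 ≤ l - (x : ℝ) := sub_nonneg.2 x.2.2
      change shift (l - (x : ℝ)) (R' (constWave l r) x) = shift (l - (x : ℝ)) r + P W x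
      conv_lhs => rw [hR1', ContinuousMap.add_apply, map_add, hPval', shift_duhamel hκ'
        (integrableOn_potential hq hQ' (R' _).continuous.Icc_extend'.continuousOn) hx
        fun y _ => by positivity]
      rw [hPval]
      congr 1
      refine duhamel_congr fun y hy => ?_
      have hy0 : 0 ≤ l - y := sub_nonneg.2 hy.2.le
      rw [hext W y (Ioo_subset_Icc_self hy), hext _ y (Ioo_subset_Icc_self hy)]
      change shift _ (shift _ _) = shift _ (-q y • shift (l - y) _)
      rw [map_smul, map_smul, map_smul, shift_shift (by positivity) hx,
        shift_shift (abs_nonneg _) hy0]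
      congr 3
      rcases le_total y (x : ℝ) with h | h
      · rw [abs_of_nonneg (sub_nonneg.2 h), max_eq_left (sub_nonneg.2 h)]
        ring
      · rw [abs_of_nonpos (sub_nonpos.2 h), max_eq_right (sub_nonpos.2 h)]
        ring
    intro x
    rw [← hR2 _ _ hW]
    rfl
  let A00 := evalAt x0 ∘ₗ P ∘ₗ R ∘ₗ tailWave l
  let A01 := evalAt x0 ∘ₗ P ∘ₗ R ∘ₗ headWave l
  let A10 := evalAt x1 ∘ₗ P ∘ₗ R ∘ₗ tailWave l
  let A11 := evalAt x1 ∘ₗ P ∘ₗ R ∘ₗ headWave l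
  let E := evalAt x0 ∘ₗ P' ∘ₗ R' ∘ₗ constWave l
  have hconst : ∀ c, 0 ≤ c → ∀ (h : L2 0 T) x, wnorm c (constWave l h x) ≤ wnorm c h :=
    fun c _ h x => le_of_eq rfl
  have s00 : IsSmall A00 := isSmall_response (P := P) (R := R) (B := tailWave l) htail hP hR3 x0
  have s01 : IsSmall A01 := isSmall_response (P := P) (R := R) (B := headWave l) hhead hP hR3 x0
  have s10 : IsSmall A10 := isSmall_response (P := P) (R := R) (B := tailWave l) htail hP hR3 x1
  have s11 : IsSmall A11 := isSmall_response (P := P) (R := R) (B := headWave l) hhead hP hR3 x1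
  have sE : IsSmall E :=
    isSmall_response (P := P') (R := R') (B := constWave l) hconst hP' hR3' x0
  -- The direct wave between the two endpoints is small as well, because l > 0.
  let S : L2 0 T →ₗ[ℝ] L2 0 T := (shift l : L2 0 T →L[ℝ] L2 0 T)
  have hS : IsSmall S := isSmall_shift hl
  refine ⟨{
    G00 := A00
    G01 := S + A01
    G10 := S + A10
    G11 := A11
    E := E
    small00 := s00
    small01 := hS.add s01
    small10 := hS.add s10
    small11 := s11
    smallE := sE
    G01_eq := fun h => ?_
    exists_wave := fun p r => ⟨_, hex p r⟩
    unique := fun h h' x hx => by rw [hwave h x hx, hwave h' x hx]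
    value_tail := fun {p r U} h => ?_
    value_head := fun {p r U} h => ?_ }⟩
  · have h1 : shift l h + P (R (headWave l h)) x0 = R (headWave l h) x0 := by
      conv_rhs => rw [hR1, ContinuousMap.add_apply]
      congr 1
      change shift l h = shift (l - 0) h
      rw [sub_zero]
    change shift l h + P (R (headWave l h)) x0 = _
    rw [h1, hhat, hR1', ContinuousMap.add_apply]
    change shift (l - 0) (h + P' (R' (constWave l h)) x0) = _
    rw [sub_zero]
    rfl
  · rw [hval h 0 x0.2, shift_zero, sub_zero]
    change _ = p + (_ + (shift l r + _))
    rw [add_left_comm _ (shift l r), add_assoc]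
  · rw [hval h l x1.2, sub_self, shift_zero]
    change _ = r + ((shift l p + _) + _)
    rw [add_comm (shift l p) r, add_assoc, add_assoc]

/-- Delay the waves with r = 0 and with p = 0, and compare their endpoint values. -/
lemma EdgeResponse.shift_G (R : EdgeResponse T l q) (hq : ContinuousOn q (Ioo 0 l))
    (hQ : ∃ Q, ∀ x ∈ Ioo 0 l, |q x| ≤ Q) {σ : ℝ} (hσ : 0 ≤ σ) (h : L2 0 T) :
    R.G00 (shift σ h) = shift σ (R.G00 h) ∧ R.G01 (shift σ h) = shift σ (R.G01 h) ∧
    R.G10 (shift σ h) = shift σ (R.G10 h) ∧ R.G11 (shift σ h) = shift σ (R.G11 h) := by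
  obtain ⟨U, hU⟩ := R.exists_wave h 0
  obtain ⟨V, hV⟩ := R.exists_wave 0 h
  have hU' := hU.shift hq hQ hσ
  have hV' := hV.shift hq hQ hσ
  have u0 := R.value_tail hU'
  have u1 := R.value_head hU'
  have v0 := R.value_tail hV'
  have v1 := R.value_head hV'
  rw [R.value_tail hU] at u0
  rw [R.value_head hU] at u1
  rw [R.value_tail hV] at v0
  rw [R.value_head hV] at v1
  simp only [map_add, map_zero, add_zero, zero_add, add_right_inj] at u0 u1 v0 v1
  exact ⟨u0.symm, v0.symm, u1.symm, v1.symm⟩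

end EdgeWave

/-! ### Linear systems with small coefficients. -/

section SmallSystems

variable {T : ℝ} {ι : Type*}

/-- Linear maps of several components that are small in the exponentially weighted norms. -/
def IsSmallOn (A : (ι → L2 0 T) →ₗ[ℝ] L2 0 T) : Prop :=
  ∀ ε > 0, ∀ᶠ c in atTop, ∀ (o : ι → L2 0 T) (K : ℝ), 0 ≤ K → (∀ j, wnorm c (o j) ≤ K) →
    wnorm c (A o) ≤ ε * K

lemma IsSmall.comp_proj {A : L2 0 T →ₗ[ℝ] L2 0 T} (hA : IsSmall A) (j : ι) :
    IsSmallOn (A ∘ₗ LinearMap.proj j) := by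
  intro ε hε
  filter_upwards [hA ε hε] with c hc o K hK ho
  exact (hc (o j)).trans (mul_le_mul_of_nonneg_left (ho j) hε.le)

lemma IsSmall.comp_shift {A : L2 0 T →ₗ[ℝ] L2 0 T} (hA : IsSmall A) {σ : ℝ} (hσ : 0 ≤ σ) :
    IsSmall (A ∘ₗ ((shift σ : L2 0 T →L[ℝ] L2 0 T) : L2 0 T →ₗ[ℝ] L2 0 T)) := by
  intro ε hε
  filter_upwards [hA ε hε, eventually_ge_atTop 0] with c hc hc0 h
  exact (hc (shift σ h)).trans (mul_le_mul_of_nonneg_left (wnorm_shift_le' hc0 hσ h) hε.le)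

lemma IsSmallOn.add {A B : (ι → L2 0 T) →ₗ[ℝ] L2 0 T} (hA : IsSmallOn A) (hB : IsSmallOn B) :
    IsSmallOn (A + B) := by
  intro ε hε
  filter_upwards [hA (ε / 2) (by positivity), hB (ε / 2) (by positivity)] with c h1 h2 o K hK ho
  refine (wnorm_add_le _ _ _).trans ?_
  linarith [h1 o K hK ho, h2 o K hK ho]

lemma IsSmallOn.smul {A : (ι → L2 0 T) →ₗ[ℝ] L2 0 T} (hA : IsSmallOn A) (r : ℝ) :
    IsSmallOn (r • A) := by
  intro ε hε
  filter_upwards [hA (ε / (|r| + 1)) (by positivity)] with c h1 o K hK ho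
  rw [LinearMap.smul_apply, wnorm_smul]
  calc |r| * wnorm c (A o) ≤ (|r| + 1) * (ε / (|r| + 1) * K) :=
        mul_le_mul (by linarith) (h1 o K hK ho) (wnorm_nonneg _ _) (by positivity)
    _ = ε * K := by field_simp

lemma IsSmallOn.neg {A : (ι → L2 0 T) →ₗ[ℝ] L2 0 T} (hA : IsSmallOn A) : IsSmallOn (-A) := by
  simpa using hA.smul (-1)

lemma IsSmallOn.sub {A B : (ι → L2 0 T) →ₗ[ℝ] L2 0 T} (hA : IsSmallOn A) (hB : IsSmallOn B) :
    IsSmallOn (A - B) := by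
  simpa [sub_eq_add_neg] using hA.add hB.neg

/-- Since there are finitely many components, one weight makes all of them contract by 1/2 in the
maximum of the weighted norms. -/
lemma exists_solution_of_isSmallOn [Fintype ι] {N : ι → (ι → L2 0 T) →ₗ[ℝ] L2 0 T}
    (hN : ∀ i, IsSmallOn (N i)) :
    (∀ b : ι → L2 0 T, ∃ o : ι → L2 0 T, ∀ i, o i = b i + N i o) ∧
    ∀ o : ι → L2 0 T, (∀ i, o i = N i o) → o = 0 := by
  let M : ℝ → (ι → L2 0 T) →L[ℝ] (ι → L2 0 T) := fun c =>
    ContinuousLinearMap.pi fun i => (expMul c).comp (ContinuousLinearMap.proj i)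
  have hM : ∀ c o i, M c o i = expMul c (o i) := fun c o i => rfl
  have hall := eventually_all.2 fun i => hN i (1 / 2) (by norm_num)
  obtain ⟨c, hc⟩ := hall.exists
  obtain ⟨R, hR1, hR2⟩ := exists_resolvent (M c) (M (-c))
    (fun o => by ext1 i; rw [hM, hM, expMul_expMul]; simp)
    (fun o => by ext1 i; rw [hM, hM, expMul_expMul]; simp) (LinearMap.pi N)
    (k := 1 / 2) (by norm_num) (by norm_num) (fun o => by
      rw [pi_norm_le_iff_of_nonneg (by positivity)]
      exact fun i => hc i o _ (norm_nonneg _) fun j => norm_le_pi_norm (M (-c) o) j)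
  refine ⟨fun b => ⟨R b, fun i => congrFun (hR1 b) i⟩, fun o ho => ?_⟩
  rw [hR2 0 o (by ext1 i; simpa using ho i), map_zero]

end SmallSystems

/-! ### Systems of waves on the graph. -/

section System

variable {T : ℝ} {l : Edge → ℝ} {q : Edge → ℝ → ℝ}

/-- The generalized solution in terms of waves on the edges; `p e` and `r e` are the waves
emitted from the tail and the head of `e`. -/
structure IsSystem (l : Edge → ℝ) (q : Edge → ℝ → ℝ) (f g : L2 0 T) (p r : Edge → L2 0 T)
    (U : Edge → ℝ → L2 0 T) : Prop where
  wave : ∀ e, IsEdgeWave (l e) (q e) (p e) (r e) (U e)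
  bc_v1 : U .e1 (l .e1) = f
  bc_v4 : U .e4 (l .e4) = 0
  dc_v2 : U .e2 0 = U .e1 0
  dc_v2' : U .e3 0 = U .e1 0 + g
  dc_v3 : U .e2 (l .e2) = U .e3 (l .e3)
  dc_v3' : U .e3 (l .e3) = U .e4 0
  -- At an endpoint the outward derivative of a wave is d/dt (U - 2p): the emitted part moves away
  -- from the vertex, all the rest towards it. Integration in time from rest gives this form of the
  -- Kirchhoff condition.
  kirchhoff_v2 : U .e1 0 + U .e2 0 + U .e3 0 = (2 : ℝ) • (p .e1 + p .e2 + p .e3)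
  kirchhoff_v3 : U .e2 (l .e2) + U .e3 (l .e3) + U .e4 0 = (2 : ℝ) • (r .e2 + r .e3 + p .e4)

lemma IsSystem.add (hq : ∀ e, ContinuousOn (q e) (Ioo 0 (l e)))
    (hqb : ∀ e, ∃ M, ∀ x ∈ Ioo 0 (l e), |q e x| ≤ M) {f g f' g' : L2 0 T}
    {p r p' r' : Edge → L2 0 T} {U U' : Edge → ℝ → L2 0 T} (h : IsSystem l q f g p r U)
    (h' : IsSystem l q f' g' p' r' U') :
    IsSystem l q (f + f') (g + g') (p + p') (r + r') (fun e x => U e x + U' e x) where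
  wave e := (h.wave e).add (hq e) (hqb e) (h'.wave e)
  bc_v1 := by rw [h.bc_v1, h'.bc_v1]
  bc_v4 := by rw [h.bc_v4, h'.bc_v4, add_zero]
  dc_v2 := by rw [h.dc_v2, h'.dc_v2]
  dc_v2' := by rw [h.dc_v2', h'.dc_v2']; abel
  dc_v3 := by rw [h.dc_v3, h'.dc_v3]
  dc_v3' := by rw [h.dc_v3', h'.dc_v3']
  kirchhoff_v2 := by
    have h1 := h.kirchhoff_v2
    have h2 := h'.kirchhoff_v2
    simp only [Pi.add_apply]
    linear_combination (norm := module) h1 + h2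
  kirchhoff_v3 := by
    have h1 := h.kirchhoff_v3
    have h2 := h'.kirchhoff_v3
    simp only [Pi.add_apply]
    linear_combination (norm := module) h1 + h2

lemma IsSystem.smul (c : ℝ) {f g : L2 0 T} {p r : Edge → L2 0 T} {U : Edge → ℝ → L2 0 T}
    (h : IsSystem l q f g p r U) :
    IsSystem l q (c • f) (c • g) (c • p) (c • r) (fun e x => c • U e x) where
  wave e := (h.wave e).smul c
  bc_v1 := by rw [h.bc_v1]
  bc_v4 := by rw [h.bc_v4, smul_zero]
  dc_v2 := by rw [h.dc_v2]
  dc_v2' := by rw [h.dc_v2', smul_add]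
  dc_v3 := by rw [h.dc_v3]
  dc_v3' := by rw [h.dc_v3']
  kirchhoff_v2 := by
    have h1 := h.kirchhoff_v2
    simp only [Pi.smul_apply]
    linear_combination (norm := module) c • h1
  kirchhoff_v3 := by
    have h1 := h.kirchhoff_v3
    simp only [Pi.smul_apply]
    linear_combination (norm := module) c • h1

/-! ### Solving for the emitted waves. -/

section Solve

variable (R : ∀ e, EdgeResponse T (l e) (q e))

/-- The wave arriving at the tail of `e`. -/
noncomputable def atTail (e : Edge) : (Edge × Bool → L2 0 T) →ₗ[ℝ] L2 0 T :=
  (R e).G00 ∘ₗ LinearMap.proj (e, false) + (R e).G01 ∘ₗ LinearMap.proj (e, true)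

/-- The wave arriving at the head of `e`. -/
noncomputable def atHead (e : Edge) : (Edge × Bool → L2 0 T) →ₗ[ℝ] L2 0 T :=
  (R e).G10 ∘ₗ LinearMap.proj (e, false) + (R e).G11 ∘ₗ LinearMap.proj (e, true)

lemma isSmallOn_atTail (e : Edge) : IsSmallOn (atTail R e) :=
  ((R e).small00.comp_proj _).add ((R e).small01.comp_proj _)

lemma isSmallOn_atHead (e : Edge) : IsSmallOn (atHead R e) :=
  ((R e).small10.comp_proj _).add ((R e).small11.comp_proj _)

/-- The delayed part of the wave arriving at the tail of `e1`, without the travel time. -/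
noncomputable def atTailHat : (Edge × Bool → L2 0 T) →ₗ[ℝ] L2 0 T :=
  (R .e1).G00 ∘ₗ LinearMap.proj (.e1, false) + (R .e1).E ∘ₗ LinearMap.proj (.e1, true)

/-- The wave arriving at the head of `e1`, for a wave emitted from the tail after the travel
time. -/
noncomputable def atHeadHat : (Edge × Bool → L2 0 T) →ₗ[ℝ] L2 0 T :=
  ((R .e1).G10 ∘ₗ ((shift (l .e1) : L2 0 T →L[ℝ] L2 0 T) : L2 0 T →ₗ[ℝ] L2 0 T)) ∘ₗ
    LinearMap.proj (.e1, false) + (R .e1).G11 ∘ₗ LinearMap.proj (.e1, true)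

lemma isSmallOn_atTailHat : IsSmallOn (atTailHat R) :=
  ((R .e1).small00.comp_proj _).add ((R .e1).smallE.comp_proj _)

lemma isSmallOn_atHeadHat (hl : ∀ e, 0 < l e) : IsSmallOn (atHeadHat R) :=
  (((R .e1).small10.comp_shift (hl .e1).le).comp_proj _).add ((R .e1).small11.comp_proj _)

/-- The common value at `v3`, in terms of the arriving waves. -/
noncomputable def meanHead : (Edge × Bool → L2 0 T) →ₗ[ℝ] L2 0 T :=
  (2 / 3 : ℝ) • (atHead R .e2 + atHead R .e3 + atTail R .e4)

lemma isSmallOn_meanHead : IsSmallOn (meanHead R) :=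
  (((isSmallOn_atHead R _).add (isSmallOn_atHead R _)).add (isSmallOn_atTail R _)).smul _

/-- The common value at `v2`, in terms of the arriving waves. -/
noncomputable def meanTail : (Edge × Bool → L2 0 T) →ₗ[ℝ] L2 0 T :=
  (2 / 3 : ℝ) • (atTail R .e1 + atTail R .e2 + atTail R .e3)

lemma isSmallOn_meanTail : IsSmallOn (meanTail R) :=
  (((isSmallOn_atTail R _).add (isSmallOn_atTail R _)).add (isSmallOn_atTail R _)).smul _

/-- Emitted waves in terms of the arriving waves, on the part of the graph behind `v2`, with
given maps for the waves emitted from `v2` and `v1`. -/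
noncomputable def scatter (A1 A2 A3 B : (Edge × Bool → L2 0 T) →ₗ[ℝ] L2 0 T) :
    Edge × Bool → (Edge × Bool → L2 0 T) →ₗ[ℝ] L2 0 T
  | (.e1, false) => A1
  | (.e2, false) => A2
  | (.e3, false) => A3
  | (.e4, false) => meanHead R - atTail R .e4
  | (.e1, true) => B
  | (.e2, true) => meanHead R - atHead R .e2
  | (.e3, true) => meanHead R - atHead R .e3
  | (.e4, true) => -atHead R .e4

lemma isSmallOn_scatter {A1 A2 A3 B : (Edge × Bool → L2 0 T) →ₗ[ℝ] L2 0 T} (h1 : IsSmallOn A1)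
    (h2 : IsSmallOn A2) (h3 : IsSmallOn A3) (hB : IsSmallOn B) (i : Edge × Bool) :
    IsSmallOn (scatter R A1 A2 A3 B i) := by
  obtain ⟨e, b⟩ := i
  cases e <;> cases b
  · exact h1
  · exact hB
  · exact h2
  · exact (isSmallOn_meanHead R).sub (isSmallOn_atHead R _)
  · exact h3
  · exact (isSmallOn_meanHead R).sub (isSmallOn_atHead R _)
  · exact (isSmallOn_meanHead R).sub (isSmallOn_atTail R _)
  · exact (isSmallOn_atHead R _).neg

/-- Free terms for `scatter`. -/
noncomputable def freeTerm (b1 b2 b3 b : L2 0 T) : Edge × Bool → L2 0 T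
  | (.e1, false) => b1
  | (.e2, false) => b2
  | (.e3, false) => b3
  | (.e1, true) => b
  | _ => 0

/-- Let w be the value of u_1 and u_2 at v2, and a_e the arriving waves. The emitted waves are w -
a_1, w - a_2 and w + g - a_3, and the Kirchhoff condition gives 3w + g = 2(a_1 + a_2 + a_3). Hence
the weights 2/3 in `meanTail` and the free terms -g/3, -g/3, 2g/3. At v3 there is no jump, and the
same computation gives `meanHead`. -/
lemma exists_isSystem (R : ∀ e, EdgeResponse T (l e) (q e)) (f g : L2 0 T) :
    ∃ p r U, IsSystem l q f g p r U := by
  obtain ⟨o, ho⟩ := (exists_solution_of_isSmallOn (isSmallOn_scatter R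
    ((isSmallOn_meanTail R).sub (isSmallOn_atTail R .e1))
    ((isSmallOn_meanTail R).sub (isSmallOn_atTail R .e2))
    ((isSmallOn_meanTail R).sub (isSmallOn_atTail R .e3))
    (isSmallOn_atHead R .e1).neg)).1
    (freeTerm (-(1 / 3 : ℝ) • g) (-(1 / 3 : ℝ) • g) ((2 / 3 : ℝ) • g) f)
  choose U hU using fun e => (R e).exists_wave (o (e, false)) (o (e, true))
  have t : ∀ e, U e 0 = o (e, false) + atTail R e o := fun e => (R e).value_tail (hU e)
  have h : ∀ e, U e (l e) = o (e, true) + atHead R e o := fun e => (R e).value_head (hU e)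
  have p1 := ho (.e1, false)
  have p2 := ho (.e2, false)
  have p3 := ho (.e3, false)
  have p4 := ho (.e4, false)
  have r1 := ho (.e1, true)
  have r2 := ho (.e2, true)
  have r3 := ho (.e3, true)
  have r4 := ho (.e4, true)
  simp only [freeTerm, scatter, meanTail, meanHead, LinearMap.add_apply, LinearMap.sub_apply,
    LinearMap.smul_apply, LinearMap.neg_apply] at p1 p2 p3 p4 r1 r2 r3 r4
  refine ⟨fun e => o (e, false), fun e => o (e, true), U, hU, ?_, ?_, ?_, ?_, ?_, ?_, ?_, ?_⟩
  · rw [h, r1]; module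
  · rw [h, r4]; module
  · rw [t, t, p1, p2]; module
  · rw [t, t, p1, p3]; module
  · rw [h, h, r2, r3]; module
  · rw [h, t, r3, p4]; module
  · rw [t, t, t, p1, p2, p3]; module
  · rw [h, h, t, r2, r3, p4]; module

/-- A homogeneous problem, with `g = 0` or with `u_3(v2, ·) = 0`, has only the zero solution. -/
lemma IsSystem.eq_zero (R : ∀ e, EdgeResponse T (l e) (q e)) {g : L2 0 T} {p r : Edge → L2 0 T}
    {U : Edge → ℝ → L2 0 T} (hU : IsSystem l q 0 g p r U) (hg : g = 0 ∨ U .e3 0 = 0) :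
    p = 0 ∧ r = 0 := by
  let o : Edge × Bool → L2 0 T := fun i => if i.2 then r i.1 else p i.1
  have t : ∀ e, U e 0 = p e + atTail R e o := fun e => (R e).value_tail (hU.wave e)
  have h : ∀ e, U e (l e) = r e + atHead R e o := fun e => (R e).value_head (hU.wave e)
  have a1 := hU.bc_v1
  have a2 := hU.bc_v4
  have a3 := hU.dc_v2
  have a4 := hU.dc_v2'
  have a5 := hU.dc_v3
  have a6 := hU.dc_v3'
  have a7 := hU.kirchhoff_v2
  have a8 := hU.kirchhoff_v3
  simp only [t, h] at a1 a2 a3 a4 a5 a6 a7 a8 hg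
  have ho : o = 0 := by
    rcases hg with rfl | hg
    -- With g = 0 this is the system of `exists_isSystem` without free terms.
    · refine (exists_solution_of_isSmallOn (isSmallOn_scatter R
        ((isSmallOn_meanTail R).sub (isSmallOn_atTail R .e1))
        ((isSmallOn_meanTail R).sub (isSmallOn_atTail R .e2))
        ((isSmallOn_meanTail R).sub (isSmallOn_atTail R .e3))
        (isSmallOn_atHead R .e1).neg)).2 o ?_
      rintro ⟨e, b⟩
      cases e <;> cases b <;> simp only [scatter, meanTail, meanHead, LinearMap.add_apply,
        LinearMap.sub_apply, LinearMap.smul_apply, LinearMap.neg_apply]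
      · change p .e1 = _
        linear_combination (norm := module) (1 / 3 : ℝ) • (-a7 - a3 - a4)
      · change r .e1 = _
        linear_combination (norm := module) a1
      · change p .e2 = _
        linear_combination (norm := module) (1 / 3 : ℝ) • (-a7 + (2 : ℝ) • a3 - a4)
      · change r .e2 = _
        linear_combination (norm := module) (1 / 3 : ℝ) • (-a8 + (2 : ℝ) • a5 + a6)
      · change p .e3 = _
        linear_combination (norm := module) (1 / 3 : ℝ) • (-a7 - a3 + (2 : ℝ) • a4)
      · change r .e3 = _
        linear_combination (norm := module) (1 / 3 : ℝ) • (-a8 - a5 + a6)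
      · change p .e4 = _
        linear_combination (norm := module) (1 / 3 : ℝ) • (-a8 - a5 - (2 : ℝ) • a6)
      · change r .e4 = _
        linear_combination (norm := module) a2
    -- With u_3(v2) = 0 the wave emitted into e3 is -a_3. The Kirchhoff condition gives the value
    -- a_1 + a_2 + a_3 for u_1 and u_2 at v2, hence a_2 + a_3 and a_1 + a_3 for the waves emitted
    -- into e1 and e2.
    · refine (exists_solution_of_isSmallOn (isSmallOn_scatter R
        ((isSmallOn_atTail R .e2).add (isSmallOn_atTail R .e3))
        ((isSmallOn_atTail R .e1).add (isSmallOn_atTail R .e3))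
        (isSmallOn_atTail R .e3).neg
        (isSmallOn_atHead R .e1).neg)).2 o ?_
      rintro ⟨e, b⟩
      cases e <;> cases b <;> simp only [scatter, meanHead, LinearMap.add_apply,
        LinearMap.sub_apply, LinearMap.smul_apply, LinearMap.neg_apply]
      · change p .e1 = _
        linear_combination (norm := module) (1 / 2 : ℝ) • (-a7 - a3 - hg)
      · change r .e1 = _
        linear_combination (norm := module) a1
      · change p .e2 = _
        linear_combination (norm := module) (1 / 2 : ℝ) • (-a7 + a3 - hg)
      · change r .e2 = _
        linear_combination (norm := module) (1 / 3 : ℝ) • (-a8 + (2 : ℝ) • a5 + a6)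
      · change p .e3 = _
        linear_combination (norm := module) hg
      · change r .e3 = _
        linear_combination (norm := module) (1 / 3 : ℝ) • (-a8 - a5 + a6)
      · change p .e4 = _
        linear_combination (norm := module) (1 / 3 : ℝ) • (-a8 - a5 - (2 : ℝ) • a6)
      · change r .e4 = _
        linear_combination (norm := module) a2
  exact ⟨funext fun e => congrFun ho (e, false), funext fun e => congrFun ho (e, true)⟩

/-- Solutions with `u_3(v2, ·) = 0`, in terms of waves that start at `v2` after the time `l e1`. -/
lemma isSystem_of_hat (R : ∀ e, EdgeResponse T (l e) (q e)) (hl : ∀ e, 0 < l e)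
    (hq : ∀ e, ContinuousOn (q e) (Ioo 0 (l e)))
    (hqb : ∀ e, ∃ M, ∀ x ∈ Ioo 0 (l e), |q e x| ≤ M) {o : Edge × Bool → L2 0 T} {c : L2 0 T}
    (hc : c = o (.e1, true) + atTailHat R o + atTail R .e2 o + atTail R .e3 o)
    (p1 : o (.e1, false) = atTail R .e2 o + atTail R .e3 o)
    (p2 : o (.e2, false) = c - atTail R .e2 o)
    (p3 : o (.e3, false) = -atTail R .e3 o)
    (p4 : o (.e4, false) = meanHead R o - atTail R .e4 o)
    (r2 : o (.e2, true) = meanHead R o - atHead R .e2 o)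
    (r3 : o (.e3, true) = meanHead R o - atHead R .e3 o)
    (r4 : o (.e4, true) = -atHead R .e4 o) :
    ∃ p r U, IsSystem l q (o (.e1, true) + atHeadHat R o) (-shift (l .e1) c) p r U ∧
      U .e3 0 = 0 ∧ U .e1 0 = shift (l .e1) c := by
  let S : L2 0 T →L[ℝ] L2 0 T := shift (l .e1)
  let p : Edge → L2 0 T := fun e => S (o (e, false))
  -- The wave emitted from v1 is the only one that is not delayed by the travel time of e1.
  let r : Edge → L2 0 T := fun e => if e = .e1 then o (.e1, true) else S (o (e, true))
  choose U hU using fun e => (R e).exists_wave (p e) (r e)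
  have G := fun e h => (R e).shift_G (hq e) (hqb e) (hl .e1).le h
  have t : ∀ e, e ≠ .e1 → U e 0 = S (o (e, false)) + S (atTail R e o) := fun e he => by
    rw [(R e).value_tail (hU e)]
    have hr : r e = S (o (e, true)) := if_neg he
    have hp : p e = S (o (e, false)) := rfl
    rw [hr, hp, (G e _).1, (G e _).2.1, ← map_add S]
    rfl
  have h : ∀ e, e ≠ .e1 → U e (l e) = S (o (e, true)) + S (atHead R e o) := fun e he => by
    rw [(R e).value_head (hU e)]
    have hr : r e = S (o (e, true)) := if_neg he
    have hp : p e = S (o (e, false)) := rfl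
    rw [hr, hp, (G e _).2.2.1, (G e _).2.2.2, ← map_add S]
    rfl
  -- Here `G01_eq` extracts the delay from the undelayed wave emitted at v1, so that all terms at v2
  -- carry the common factor S.
  have t1 : U .e1 0 = S (o (.e1, false)) + (S (o (.e1, true)) + S (atTailHat R o)) := by
    rw [(R .e1).value_tail (hU .e1)]
    have hr : r .e1 = o (.e1, true) := if_pos rfl
    have hp : p .e1 = S (o (.e1, false)) := rfl
    rw [hr, hp, (G .e1 _).1, (R .e1).G01_eq]
    have hh := congrArg S (add_left_comm ((R .e1).G00 (o (.e1, false))) (o (.e1, true))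
      ((R .e1).E (o (.e1, true))))
    rw [map_add S ((R .e1).G00 (o (.e1, false))), map_add S (o (.e1, true)) (_ + _)] at hh
    exact congrArg (S (o (.e1, false)) + ·) hh
  have h1 : U .e1 (l .e1) = o (.e1, true) + atHeadHat R o := by
    rw [(R .e1).value_head (hU .e1)]
    rfl
  have t2 := t .e2 (by decide)
  have t3 := t .e3 (by decide)
  have t4 := t .e4 (by decide)
  have h2 := h .e2 (by decide)
  have h3 := h .e3 (by decide)
  have h4 := h .e4 (by decide)
  have m : meanHead R o = (2 / 3 : ℝ) • (atHead R .e2 o + atHead R .e3 o + atTail R .e4 o) := rfl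
  have q1 : p .e1 = S (atTail R .e2 o) + S (atTail R .e3 o) := by
    rw [← map_add S, ← p1]
  have q2 : p .e2 = S c - S (atTail R .e2 o) := by rw [← map_sub S, ← p2]
  have q3 : p .e3 = -S (atTail R .e3 o) := by rw [← map_neg S, ← p3]
  have q4 : p .e4 = S (meanHead R o) - S (atTail R .e4 o) := by rw [← map_sub S, ← p4]
  have s2 : r .e2 = S (meanHead R o) - S (atHead R .e2 o) := by
    rw [← map_sub S, ← r2]; rfl
  have s3 : r .e3 = S (meanHead R o) - S (atHead R .e3 o) := by
    rw [← map_sub S, ← r3]; rfl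
  have hm := congrArg S m
  have hcS := congrArg S hc
  have P1 := congrArg S p1
  have P2 := congrArg S p2
  have P3 := congrArg S p3
  have P4 := congrArg S p4
  have R2 := congrArg S r2
  have R3 := congrArg S r3
  have R4 := congrArg S r4
  simp only [map_add, map_sub, map_neg, map_smul] at hm hcS P1 P2 P3 P4 R2 R3 R4
  have u1 : U .e1 0 = S c := by rw [t1]; linear_combination (norm := module) P1 - hcS
  have u2 : U .e2 0 = S c := by rw [t2]; linear_combination (norm := module) P2
  have u3 : U .e3 0 = 0 := by rw [t3]; linear_combination (norm := module) P3
  have v2 : U .e2 (l .e2) = S (meanHead R o) := by rw [h2]; linear_combination (norm := module) R2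
  have v3 : U .e3 (l .e3) = S (meanHead R o) := by rw [h3]; linear_combination (norm := module) R3
  have v4 : U .e4 0 = S (meanHead R o) := by rw [t4]; linear_combination (norm := module) P4
  refine ⟨p, r, U, ⟨hU, h1, ?_, ?_, ?_, ?_, ?_, ?_, ?_⟩, u3, u1⟩
  · rw [h4]; linear_combination (norm := module) R4
  · rw [u1, u2]
  · rw [u1, u3]; exact (add_neg_cancel _).symm
  · rw [v2, v3]
  · rw [v3, v4]
  · rw [u1, u2, u3, q1, q2, q3]; module
  · rw [v2, v3, v4, s2, s3, q4]; linear_combination (norm := module) (-3 : ℝ) • hm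

/-- For every `f` there is a solution with `u_3(v2, ·) = 0`, which vanishes at `v2` before the
time `l e1`. -/
lemma exists_isSystem_matching (R : ∀ e, EdgeResponse T (l e) (q e)) (hl : ∀ e, 0 < l e)
    (hq : ∀ e, ContinuousOn (q e) (Ioo 0 (l e)))
    (hqb : ∀ e, ∃ M, ∀ x ∈ Ioo 0 (l e), |q e x| ≤ M) (f : L2 0 T) :
    ∃ c p r U, IsSystem l q f (-shift (l .e1) c) p r U ∧
      U .e3 0 = 0 ∧ U .e1 0 = shift (l .e1) c := by
  -- The wave emitted from v1 is r_1 = f - `atHeadHat`. Inserting it into c, the wave emitted into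
  -- e2 is c - a_2 = f + `atTailHat` - `atHeadHat` + a_3; thus f is a free term twice.
  obtain ⟨o, ho⟩ := (exists_solution_of_isSmallOn (isSmallOn_scatter R
    ((isSmallOn_atTail R .e2).add (isSmallOn_atTail R .e3))
    (((isSmallOn_atTailHat R).sub (isSmallOn_atHeadHat R hl)).add (isSmallOn_atTail R .e3))
    (isSmallOn_atTail R .e3).neg
    (isSmallOn_atHeadHat R hl).neg)).1 (freeTerm 0 f 0 f)
  have p1 := ho (.e1, false)
  have p2 := ho (.e2, false)
  have p3 := ho (.e3, false)
  have p4 := ho (.e4, false)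
  have r1 := ho (.e1, true)
  have r2 := ho (.e2, true)
  have r3 := ho (.e3, true)
  have r4 := ho (.e4, true)
  simp only [freeTerm, scatter, LinearMap.add_apply, LinearMap.sub_apply,
    LinearMap.neg_apply, zero_add] at p1 p2 p3 p4 r1 r2 r3 r4
  have hf : o (.e1, true) + atHeadHat R o = f := by linear_combination (norm := module) r1
  obtain ⟨p, r, U, h⟩ := isSystem_of_hat R hl hq hqb rfl p1
    (by linear_combination (norm := module) p2 - r1) p3 p4 r2 r3 r4
  rw [hf] at h
  exact ⟨_, p, r, U, h⟩

/-- Every function that vanishes before the time `l e1` is the value at `v2` of a solution with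
`u_3(v2, ·) = 0`. -/
lemma exists_isSystem_surjective (R : ∀ e, EdgeResponse T (l e) (q e)) (hl : ∀ e, 0 < l e)
    (hq : ∀ e, ContinuousOn (q e) (Ioo 0 (l e)))
    (hqb : ∀ e, ∃ M, ∀ x ∈ Ioo 0 (l e), |q e x| ≤ M) (c : L2 0 T) :
    ∃ f p r U, IsSystem l q f (-shift (l .e1) c) p r U ∧
      U .e3 0 = 0 ∧ U .e1 0 = shift (l .e1) c := by
  -- Now c is given and its defining relation is solved for the wave emitted from v1. The control f
  -- is read off afterwards, as the value at v1.
  obtain ⟨o, ho⟩ := (exists_solution_of_isSmallOn (isSmallOn_scatter R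
    ((isSmallOn_atTail R .e2).add (isSmallOn_atTail R .e3))
    (isSmallOn_atTail R .e2).neg
    (isSmallOn_atTail R .e3).neg
    (((isSmallOn_atTailHat R).add (isSmallOn_atTail R .e2)).add
      (isSmallOn_atTail R .e3)).neg)).1 (freeTerm 0 c 0 c)
  have p1 := ho (.e1, false)
  have p2 := ho (.e2, false)
  have p3 := ho (.e3, false)
  have p4 := ho (.e4, false)
  have r1 := ho (.e1, true)
  have r2 := ho (.e2, true)
  have r3 := ho (.e3, true)
  have r4 := ho (.e4, true)
  simp only [freeTerm, scatter, LinearMap.add_apply, LinearMap.sub_apply,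
    LinearMap.neg_apply, zero_add] at p1 p2 p3 p4 r1 r2 r3 r4
  obtain ⟨p, r, U, h⟩ := isSystem_of_hat (c := c) R hl hq hqb
    (by linear_combination (norm := module) -r1) p1 (by linear_combination (norm := module) p2)
    p3 p4 r2 r3 r4
  exact ⟨_, p, r, U, h⟩

end Solve

end System

/-! ### Derivatives of test functions along lines. -/

section Calculus

/-- The derivative with respect to the position. -/
noncomputable def dx (φ : ℝ → ℝ → ℝ) (x t : ℝ) : ℝ := deriv (fun y => φ y t) x

/-- The derivative with respect to time. -/
noncomputable def dt (φ : ℝ → ℝ → ℝ) (x t : ℝ) : ℝ := deriv (fun s => φ x s) t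

/-- The wave operator without potential. -/
noncomputable def box (φ : ℝ → ℝ → ℝ) (x t : ℝ) : ℝ :=
  iteratedDeriv 2 (fun s => φ x s) t - iteratedDeriv 2 (fun y => φ y t) x

variable {φ : ℝ → ℝ → ℝ}

lemma hasFDerivAt_uncurry (hφ : ContDiff ℝ 2 fun p : ℝ × ℝ => φ p.1 p.2) (p : ℝ × ℝ) :
    HasFDerivAt (fun p : ℝ × ℝ => φ p.1 p.2) (fderiv ℝ (fun p : ℝ × ℝ => φ p.1 p.2) p) p :=
  (hφ.differentiable (by norm_num) p).hasFDerivAt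

lemma hasFDerivAt_fderiv (hφ : ContDiff ℝ 2 fun p : ℝ × ℝ => φ p.1 p.2) (p : ℝ × ℝ) :
    HasFDerivAt (fderiv ℝ fun p : ℝ × ℝ => φ p.1 p.2)
      (fderiv ℝ (fderiv ℝ fun p : ℝ × ℝ => φ p.1 p.2) p) p :=
  ((hφ.fderiv_right (m := 1) (by norm_num)).differentiable (by norm_num) p).hasFDerivAt

lemma hasDerivAt_line_left (x t : ℝ) : HasDerivAt (fun y : ℝ => (y, t)) ((1 : ℝ), (0 : ℝ)) x :=
  (hasDerivAt_id x).prodMk (hasDerivAt_const x t)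

lemma hasDerivAt_line_right (x t : ℝ) : HasDerivAt (fun s : ℝ => (x, s)) ((0 : ℝ), (1 : ℝ)) t :=
  (hasDerivAt_const t x).prodMk (hasDerivAt_id t)

lemma hasDerivAt_along {E : Type*} [NormedAddCommGroup E] [NormedSpace ℝ E] {Φ : ℝ × ℝ → E}
    {Φ' : ℝ × ℝ →L[ℝ] E} {γ : ℝ → ℝ × ℝ} {v : ℝ × ℝ} {s : ℝ} (h : HasFDerivAt Φ Φ' (γ s))
    (hγ : HasDerivAt γ v s) : HasDerivAt (fun s => Φ (γ s)) (Φ' v) s :=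
  h.comp_hasDerivAt s hγ

lemma hasDerivAt_along_apply {D : ℝ × ℝ → ℝ × ℝ →L[ℝ] ℝ} {D' : ℝ × ℝ →L[ℝ] ℝ × ℝ →L[ℝ] ℝ}
    {γ : ℝ → ℝ × ℝ} {v : ℝ × ℝ} {s : ℝ} (h : HasFDerivAt D D' (γ s))
    (hγ : HasDerivAt γ v s) (w : ℝ × ℝ) : HasDerivAt (fun s => D (γ s) w) (D' v w) s := by
  have h1 := (hasDerivAt_along h hγ).clm_apply (hasDerivAt_const s w)
  simpa using h1

lemma hasDerivAt_dx (hφ : ContDiff ℝ 2 fun p : ℝ × ℝ => φ p.1 p.2) (x t : ℝ) :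
    HasDerivAt (fun y => φ y t) (fderiv ℝ (fun p : ℝ × ℝ => φ p.1 p.2) (x, t) (1, 0)) x :=
  hasDerivAt_along (γ := fun y => (y, t)) (hasFDerivAt_uncurry hφ (x, t)) (hasDerivAt_line_left x t)

lemma hasDerivAt_dt (hφ : ContDiff ℝ 2 fun p : ℝ × ℝ => φ p.1 p.2) (x t : ℝ) :
    HasDerivAt (fun s => φ x s) (fderiv ℝ (fun p : ℝ × ℝ => φ p.1 p.2) (x, t) (0, 1)) t :=
  hasDerivAt_along (γ := fun s => (x, s)) (hasFDerivAt_uncurry hφ (x, t)) (hasDerivAt_line_right x t)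

lemma dx_eq (hφ : ContDiff ℝ 2 fun p : ℝ × ℝ => φ p.1 p.2) (x t : ℝ) :
    dx φ x t = fderiv ℝ (fun p : ℝ × ℝ => φ p.1 p.2) (x, t) (1, 0) := (hasDerivAt_dx hφ x t).deriv

lemma dt_eq (hφ : ContDiff ℝ 2 fun p : ℝ × ℝ => φ p.1 p.2) (x t : ℝ) :
    dt φ x t = fderiv ℝ (fun p : ℝ × ℝ => φ p.1 p.2) (x, t) (0, 1) := (hasDerivAt_dt hφ x t).deriv

lemma box_eq (hφ : ContDiff ℝ 2 fun p : ℝ × ℝ => φ p.1 p.2) (x t : ℝ) :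
    box φ x t =
      fderiv ℝ (fderiv ℝ fun p : ℝ × ℝ => φ p.1 p.2) (x, t) (0, 1) (0, 1) -
      fderiv ℝ (fderiv ℝ fun p : ℝ × ℝ => φ p.1 p.2) (x, t) (1, 0) (1, 0) := by
  rw [box, iteratedDeriv_succ, iteratedDeriv_one, iteratedDeriv_succ, iteratedDeriv_one]
  have e1 : deriv (fun s => φ x s) =
      fun s => fderiv ℝ (fun p : ℝ × ℝ => φ p.1 p.2) (x, s) (0, 1) :=
    funext fun s => dt_eq hφ x s
  have e2 : deriv (fun y => φ y t) =
      fun y => fderiv ℝ (fun p : ℝ × ℝ => φ p.1 p.2) (y, t) (1, 0) :=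
    funext fun y => dx_eq hφ y t
  rw [e1, e2]
  congr 1
  · exact (hasDerivAt_along_apply (γ := fun s => (x, s)) (hasFDerivAt_fderiv hφ (x, t))
      (hasDerivAt_line_right x t) _).deriv
  · exact (hasDerivAt_along_apply (γ := fun y => (y, t)) (hasFDerivAt_fderiv hφ (x, t))
      (hasDerivAt_line_left x t) _).deriv

lemma continuous_fderiv_apply (hφ : ContDiff ℝ 2 fun p : ℝ × ℝ => φ p.1 p.2) (v : ℝ × ℝ) :
    Continuous fun p => fderiv ℝ (fun p : ℝ × ℝ => φ p.1 p.2) p v :=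
  (hφ.fderiv_right (m := 1) (by norm_num)).continuous.clm_apply continuous_const

lemma continuous_dx (hφ : ContDiff ℝ 2 fun p : ℝ × ℝ => φ p.1 p.2) :
    Continuous (Function.uncurry (dx φ)) :=
  (continuous_fderiv_apply hφ (1, 0)).congr fun p => (dx_eq hφ p.1 p.2).symm

lemma continuous_dt (hφ : ContDiff ℝ 2 fun p : ℝ × ℝ => φ p.1 p.2) :
    Continuous (Function.uncurry (dt φ)) :=
  (continuous_fderiv_apply hφ (0, 1)).congr fun p => (dt_eq hφ p.1 p.2).symm

lemma continuous_box (hφ : ContDiff ℝ 2 fun p : ℝ × ℝ => φ p.1 p.2) :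
    Continuous (Function.uncurry (box φ)) := by
  have h1 : Continuous (fderiv ℝ (fderiv ℝ fun p : ℝ × ℝ => φ p.1 p.2)) :=
    ((hφ.fderiv_right (m := 1) (by norm_num)).fderiv_right (m := 0) (by norm_num)).continuous
  have h2 : ∀ v : ℝ × ℝ, Continuous fun p : ℝ × ℝ =>
      fderiv ℝ (fderiv ℝ fun p : ℝ × ℝ => φ p.1 p.2) p v v := fun v =>
    (h1.clm_apply continuous_const).clm_apply continuous_const
  exact ((h2 (0, 1)).sub (h2 (1, 0))).congr fun p => (box_eq hφ p.1 p.2).symm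

/-- The wave operator as a derivative along a characteristic. -/
lemma hasDerivAt_characteristic (hφ : ContDiff ℝ 2 fun p : ℝ × ℝ => φ p.1 p.2) (s x : ℝ) :
    HasDerivAt (fun x => dt φ x (s + x) - dx φ x (s + x)) (box φ x (s + x)) x := by
  have hl : HasDerivAt (fun x : ℝ => (x, s + x)) ((1 : ℝ), (1 : ℝ)) x :=
    (hasDerivAt_id x).prodMk ((hasDerivAt_id x).const_add s)
  have h1 := hasDerivAt_along_apply (γ := fun x => (x, s + x)) (hasFDerivAt_fderiv hφ (x, s + x))
    hl (-1, 1)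
  -- In the second derivative along (1,1) and (-1,1) the mixed terms cancel by symmetry, which
  -- leaves φ_tt - φ_xx.
  have hsymm := (hφ.contDiffAt (x := (x, s + x))).isSymmSndFDerivAt (by simp)
  have hs := hsymm (1, 0) (0, 1)
  refine (h1.congr_deriv ?_).congr_of_eventuallyEq (Eventually.of_forall fun y => ?_)
  · rw [box_eq hφ]
    have e1 : ((1 : ℝ), (1 : ℝ)) = (1, 0) + (0, 1) := by simp
    have e2 : ((-1 : ℝ), (1 : ℝ)) = -(1, 0) + (0, 1) := by simp
    rw [e1, e2]
    simp only [map_add, map_neg, add_apply]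
    rw [hs]
    ring
  · simp only [dt_eq hφ, dx_eq hφ]
    have e2 : ((-1 : ℝ), (1 : ℝ)) = -(1, 0) + (0, 1) := by simp
    rw [e2, map_add, map_neg]
    ring

/-- Reflection in x reduces waves travelling to the left to waves travelling to the right. -/
lemma contDiff_reflect (hφ : ContDiff ℝ 2 fun p : ℝ × ℝ => φ p.1 p.2) :
    ContDiff ℝ 2 fun p : ℝ × ℝ => (fun x t => φ (-x) t) p.1 p.2 :=
  hφ.comp (contDiff_fst.neg.prodMk contDiff_snd)

lemma dx_reflect (x t : ℝ) : dx (fun x t => φ (-x) t) x t = -dx φ (-x) t :=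
  deriv_comp_neg (fun y => φ y t) x

lemma dt_reflect (x t : ℝ) : dt (fun x t => φ (-x) t) x t = dt φ (-x) t := rfl

lemma box_reflect (x t : ℝ) : box (fun x t => φ (-x) t) x t = box φ (-x) t := by
  rw [box, box, iteratedDeriv_comp_neg 2 (fun y => φ y t) x]
  simp

end Calculus

/-! ### Functions as elements of L²(0,T), and their inner products. -/

section Pairing

variable {T : ℝ}

open Classical in
/-- The element of `L²(0, T)` given by a function (zero if it is not square integrable). -/
noncomputable def toH (ψ : ℝ → ℝ) : L2 0 T :=
  if h : MemLp ψ 2 (volume.restrict (Ioo 0 T)) then h.toLp else 0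

lemma coeFn_toH {ψ : ℝ → ℝ} (h : MemLp ψ 2 (volume.restrict (Ioo 0 T))) :
    (toH ψ : L2 0 T) =ᵐ[volume.restrict (Ioo 0 T)] ψ := by
  rw [toH, dif_pos h]
  exact h.coeFn_toLp

lemma memLp_of_continuous {ψ : ℝ → ℝ} (h : Continuous ψ) :
    MemLp ψ 2 (volume.restrict (Ioo 0 T)) := by
  obtain ⟨C, hC⟩ := (isCompact_Icc (a := (0 : ℝ)) (b := T)).exists_bound_of_continuousOn
    h.continuousOn
  refine MemLp.of_bound h.aestronglyMeasurable C ?_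
  rw [ae_restrict_iff' measurableSet_Ioo]
  exact Eventually.of_forall fun t ht => hC t (Ioo_subset_Icc_self ht)

lemma inner_eq (h k : L2 0 T) : inner ℝ h k = ∫ t in Ioo 0 T, h t * k t := by
  rw [L2.inner_def]
  simp [mul_comm]

lemma inner_toH (h : L2 0 T) {ψ : ℝ → ℝ} (hψ : MemLp ψ 2 (volume.restrict (Ioo 0 T))) :
    inner ℝ h (toH ψ) = ∫ t in Ioo 0 T, h t * ψ t := by
  rw [inner_eq]
  refine integral_congr_ae ?_
  filter_upwards [coeFn_toH hψ] with t ht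
  rw [ht]

lemma toH_add {ψ χ : ℝ → ℝ} (hψ : MemLp ψ 2 (volume.restrict (Ioo 0 T)))
    (hχ : MemLp χ 2 (volume.restrict (Ioo 0 T))) :
    (toH (fun t => ψ t + χ t) : L2 0 T) = toH ψ + toH χ := by
  apply Lp.ext
  filter_upwards [coeFn_toH (hψ.add hχ), coeFn_toH hψ, coeFn_toH hχ,
    Lp.coeFn_add (toH ψ : L2 0 T) (toH χ)] with t h1 h2 h3 h4
  rw [h4, Pi.add_apply, h2, h3]
  exact h1

lemma toH_smul {ψ : ℝ → ℝ} (hψ : MemLp ψ 2 (volume.restrict (Ioo 0 T))) (c : ℝ) :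
    (toH (fun t => c * ψ t) : L2 0 T) = c • toH ψ := by
  apply Lp.ext
  filter_upwards [coeFn_toH (hψ.const_smul c), coeFn_toH hψ,
    Lp.coeFn_smul c (toH ψ : L2 0 T)] with t h1 h2 h4
  rw [h4, Pi.smul_apply, h2]
  exact h1

lemma toH_sub {ψ χ : ℝ → ℝ} (hψ : MemLp ψ 2 (volume.restrict (Ioo 0 T)))
    (hχ : MemLp χ 2 (volume.restrict (Ioo 0 T))) :
    (toH (fun t => ψ t - χ t) : L2 0 T) = toH ψ - toH χ := by
  apply Lp.ext
  filter_upwards [coeFn_toH (hψ.sub hχ), coeFn_toH hψ, coeFn_toH hχ,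
    Lp.coeFn_sub (toH ψ : L2 0 T) (toH χ)] with t h1 h2 h3 h4
  rw [h4, Pi.sub_apply, h2, h3]
  exact h1

lemma toH_congr {ψ χ : ℝ → ℝ} (h : ψ =ᵐ[volume.restrict (Ioo 0 T)] χ) :
    (toH ψ : L2 0 T) = toH χ := by
  by_cases hψ : MemLp ψ 2 (volume.restrict (Ioo 0 T))
  · exact Lp.ext ((coeFn_toH hψ).trans (h.trans (coeFn_toH (hψ.ae_eq h)).symm))
  · rw [toH, toH, dif_neg hψ, dif_neg fun h' => hψ (h'.ae_eq h.symm)]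

lemma toH_coe (h : L2 0 T) : toH h = h := Lp.ext (coeFn_toH (Lp.memLp h))

lemma continuous_toH {ψ : ℝ → ℝ → ℝ} (hψ : Continuous (Function.uncurry ψ)) :
    Continuous fun x => (toH (ψ x) : L2 0 T) := by
  have hc : ∀ x, Continuous (ψ x) := fun x => hψ.comp (Continuous.prodMk_right x)
  let Ψ : ℝ → C(ℝ, ℝ) := fun x => ⟨ψ x, hc x⟩
  have hΨ : Continuous Ψ := ContinuousMap.continuous_of_continuous_uncurry _ hψ
  rw [continuous_iff_continuousAt]
  intro x
  have h1 := ContinuousMap.tendsto_iff_forall_isCompact_tendstoUniformlyOn.1 (hΨ.tendsto x)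
    (Icc 0 T) isCompact_Icc
  rw [Metric.tendstoUniformlyOn_iff] at h1
  refine Metric.tendsto_nhds.2 fun ε hε => ?_
  set A : ℝ := (measureUnivNNReal (volume.restrict (Ioo 0 T)) : ℝ) ^ (2 : ENNReal).toReal⁻¹
    with hA
  have hA0 : 0 ≤ A := by positivity
  filter_upwards [h1 (ε / (A + 1)) (by positivity)] with y hy
  rw [dist_eq_norm, ← toH_sub (memLp_of_continuous (hc y)) (memLp_of_continuous (hc x))]
  have h2 := Lp.norm_le_of_ae_bound (f := (toH (fun t => ψ y t - ψ x t) : L2 0 T))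
    (C := ε / (A + 1)) (by positivity) (by
      filter_upwards [coeFn_toH (T := T) (ψ := fun t => ψ y t - ψ x t)
        (memLp_of_continuous ((hc y).sub (hc x))),
        ae_restrict_mem measurableSet_Ioo] with t ht ht'
      rw [ht]
      have := (hy t (Ioo_subset_Icc_self ht')).le
      rw [dist_comm, Real.dist_eq] at this
      exact this)
  refine h2.trans_lt ?_
  rw [← hA, mul_div_assoc', div_lt_iff₀ (by positivity)]
  nlinarith

end Pairing

/-! ### Green's formula for travelling waves. -/

section Travelling

variable {T : ℝ} {φ : ℝ → ℝ → ℝ}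

/-- Substitution moves the delay to the test function. The cut-off of `shift` at T becomes an
indicator there, so that the integral runs over the whole line. -/
lemma inner_shift_toH {σ : ℝ} (hσ : 0 ≤ σ) (p : L2 0 T) {ψ : ℝ → ℝ} (hψ : Continuous ψ) :
    inner ℝ (shift σ p) (toH ψ) = ∫ s, zeroExt p s * (Iio T).indicator ψ (s + σ) := by
  rw [inner_toH _ (memLp_of_continuous hψ)]
  have h1 : ∫ t in Ioo 0 T, shift σ p t * ψ t =
      ∫ t, zeroExt p (t - σ) * (Iio T).indicator ψ t := by
    rw [← integral_indicator measurableSet_Ioo]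
    refine integral_congr_ae ?_
    filter_upwards [(ae_restrict_iff' measurableSet_Ioo).1 (coeFn_shift σ p)] with t ht
    by_cases hm : t ∈ Ioo 0 T
    · rw [indicator_of_mem hm, indicator_of_mem (show t ∈ Iio T from hm.2), ht hm]
    · rw [indicator_of_notMem hm]
      by_cases h2 : t < T
      · rw [zeroExt_of_notMem, zero_mul]
        intro h3
        exact hm ⟨by linarith [h3.1], h2⟩
      · rw [indicator_of_notMem (show t ∉ Iio T from h2), mul_zero]
  rw [h1, ← integral_add_right_eq_self _ σ]
  simp

lemma integrable_zeroExt_mul {ψ : ℝ → ℝ} (hψ : Continuous ψ) (p : L2 0 T) {σ : ℝ} (hσ : 0 ≤ σ) :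
    Integrable fun s => zeroExt p s * (Iio T).indicator ψ (s + σ) := by
  obtain ⟨C, hC⟩ := (isCompact_Icc (a := (0 : ℝ)) (b := T)).exists_bound_of_continuousOn
    hψ.continuousOn
  refine ((integrable_zeroExt p).norm.mul_const |C|).mono' ?_ (Eventually.of_forall fun s => ?_)
  · exact ((measurable_zeroExt p).mul ((hψ.measurable.indicator measurableSet_Iio).comp
      (measurable_id.add_const σ))).aestronglyMeasurable
  · rw [norm_mul]
    by_cases hs : s ∈ Ioo 0 T
    · gcongr
      by_cases h2 : s + σ ∈ Iio T
      · rw [indicator_of_mem h2]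
        exact (hC _ ⟨by linarith [hs.1], le_of_lt h2⟩).trans (le_abs_self C)
      · rw [indicator_of_notMem h2, norm_zero]; positivity
    · rw [zeroExt_of_notMem _ hs]; simp

/-- Integration of the wave operator along a characteristic up to the final time. -/
lemma integral_characteristic (hφ : ContDiff ℝ 2 fun p : ℝ × ℝ => φ p.1 p.2) {a b s : ℝ}
    (hab : a ≤ b) (hs : s < T) (hfin : ∀ x ∈ Icc a b, dt φ x T - dx φ x T = 0) :
    ∫ x in a..b, (Iio T).indicator (box φ x) (s + (x - a)) =
      (Iio T).indicator (fun t => dt φ b t - dx φ b t) (s + (b - a)) - (dt φ a s - dx φ a s) := by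
  have hbox := continuous_box hφ
  -- The characteristic that starts in (a, s) leaves the rectangle at x = b'. If it leaves through t
  -- = T, the boundary term is killed by the final data.
  set b' := min b (T - s + a) with hb'
  have hab' : a ≤ b' := le_min hab (by linarith)
  have hFTC : ∫ x in a..b', box φ x (s - a + x) =
      (dt φ b' (s - a + b') - dx φ b' (s - a + b')) -
        (dt φ a (s - a + a) - dx φ a (s - a + a)) := by
    refine intervalIntegral.integral_eq_sub_of_hasDerivAt
      (f := fun x => dt φ x (s - a + x) - dx φ x (s - a + x))
      (fun x _ => hasDerivAt_characteristic hφ (s - a) x) ?_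
    exact (hbox.comp (f := fun x => (x, s - a + x)) (by fun_prop)).intervalIntegrable _ _
  have h1 : ∫ x in a..b, (Iio T).indicator (box φ x) (s + (x - a)) =
      ∫ x in a..b', box φ x (s - a + x) := by
    rw [intervalIntegral.integral_of_le hab, intervalIntegral.integral_of_le hab',
      integral_Ioc_eq_integral_Ioo, integral_Ioc_eq_integral_Ioo]
    have h2 : (fun x => (Iio T).indicator (box φ x) (s + (x - a))) =
        (Iio (T - s + a)).indicator fun x => box φ x (s - a + x) := by
      ext x
      have e : s + (x - a) = s - a + x := by ring
      by_cases hx : x < T - s + a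
      · rw [indicator_of_mem (show s + (x - a) ∈ Iio T by simp only [mem_Iio]; linarith),
          indicator_of_mem (show x ∈ Iio _ from hx), e]
      · rw [indicator_of_notMem (show s + (x - a) ∉ Iio T by
          simp only [mem_Iio, not_lt] at hx ⊢; linarith),
          indicator_of_notMem (show x ∉ Iio _ from hx)]
    rw [h2, setIntegral_indicator measurableSet_Iio]
    congr 2
    ext x
    simp only [mem_inter_iff, mem_Ioo, mem_Iio, hb', lt_min_iff]
    tauto
  rw [h1, hFTC]
  have e1 : s - a + a = s := by ring
  rw [e1]
  congr 1
  rcases lt_or_ge (s + (b - a)) T with h | h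
  · rw [indicator_of_mem (show s + (b - a) ∈ Iio T from h)]
    have e2 : b' = b := min_eq_left (by linarith)
    have e3 : s - a + b = s + (b - a) := by ring
    rw [e2, e3]
  · rw [indicator_of_notMem (show s + (b - a) ∉ Iio T from not_lt.2 h)]
    have e2 : b' = T - s + a := min_eq_right (by linarith)
    have e3 : s - a + b' = T := by rw [e2]; ring
    rw [e3]
    exact hfin b' ⟨hab', min_le_left _ _⟩

lemma continuous_fst_toH {ψ : ℝ → ℝ → ℝ} (hψ : Continuous (Function.uncurry ψ)) (x : ℝ) :
    Continuous (ψ x) := hψ.comp (Continuous.prodMk_right x)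

/-- Green's formula for a wave travelling to the right. -/
lemma integral_inner_shift_right (hφ : ContDiff ℝ 2 fun p : ℝ × ℝ => φ p.1 p.2) {a b : ℝ}
    (hab : a ≤ b) (hfin : ∀ x ∈ Icc a b, dt φ x T - dx φ x T = 0) (p : L2 0 T) :
    ∫ x in a..b, inner ℝ (shift (x - a) p) (toH (box φ x)) =
      inner ℝ (shift (b - a) p) (toH fun t => dt φ b t - dx φ b t) -
        inner ℝ p (toH fun t => dt φ a t - dx φ a t) := by
  have hbox := continuous_box hφ
  have hG : Continuous (Function.uncurry fun x t => dt φ x t - dx φ x t) :=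
    (continuous_dt hφ).sub (continuous_dx hφ)
  have e1 : ∫ x in a..b, inner ℝ (shift (x - a) p) (toH (box φ x)) =
      ∫ x in a..b, ∫ s, zeroExt p s * (Iio T).indicator (box φ x) (s + (x - a)) := by
    refine intervalIntegral.integral_congr fun x hx => ?_
    rw [uIcc_of_le hab] at hx
    exact inner_shift_toH (sub_nonneg.2 hx.1) p (continuous_fst_toH hbox x)
  -- After the exchange of integrals, s is the time at which the characteristic starts, and the
  -- inner integral runs along that characteristic.
  have e2 : ∫ x in a..b, ∫ s, zeroExt p s * (Iio T).indicator (box φ x) (s + (x - a)) =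
      ∫ s, ∫ x in a..b, zeroExt p s * (Iio T).indicator (box φ x) (s + (x - a)) := by
    simp only [intervalIntegral.integral_of_le hab]
    refine integral_integral_swap ?_
    obtain ⟨C, hC⟩ := ((isCompact_Icc (a := a) (b := b)).prod
      (isCompact_Icc (a := (0 : ℝ)) (b := T))).exists_bound_of_continuousOn hbox.continuousOn
    have hI : Integrable (fun z : ℝ × ℝ => |C| * ‖zeroExt p z.2‖)
        ((volume.restrict (Ioc a b)).prod volume) :=
      (integrable_const |C|).mul_prod (integrable_zeroExt p).norm
    refine hI.mono' ?_ ?_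
    · refine Measurable.aestronglyMeasurable ?_
      refine ((measurable_zeroExt p).comp measurable_snd).mul ?_
      have h2 : (fun z : ℝ × ℝ => (Iio T).indicator (box φ z.1) (z.2 + (z.1 - a))) =
          {z : ℝ × ℝ | z.2 + (z.1 - a) < T}.indicator
            fun z => Function.uncurry (box φ) (z.1, z.2 + (z.1 - a)) := by
        ext z
        simp only [indicator, mem_Iio, mem_ofPred_eq, Function.uncurry]
      rw [h2]
      refine Measurable.indicator ?_ (measurableSet_lt (by fun_prop) measurable_const)
      exact (hbox.comp (by fun_prop)).measurable
    · have h3 : ∀ᵐ z : ℝ × ℝ ∂((volume.restrict (Ioc a b)).prod volume), z.1 ∈ Ioc a b :=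
        Measure.quasiMeasurePreserving_fst.ae (ae_restrict_mem measurableSet_Ioc)
      filter_upwards [h3] with z hz
      simp only [Function.uncurry]
      rw [norm_mul, mul_comm]
      by_cases hs : z.2 ∈ Ioo 0 T
      · gcongr
        by_cases h2 : z.2 + (z.1 - a) ∈ Iio T
        · rw [indicator_of_mem h2]
          refine (hC (z.1, z.2 + (z.1 - a)) ⟨Ioc_subset_Icc_self hz, ?_⟩).trans (le_abs_self C)
          exact ⟨by dsimp only; linarith [hs.1, hz.1], le_of_lt h2⟩
        · rw [indicator_of_notMem h2, norm_zero]; positivity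
      · rw [zeroExt_of_notMem _ hs]; simp
  have e3 : ∀ s, ∫ x in a..b, zeroExt p s * (Iio T).indicator (box φ x) (s + (x - a)) =
      zeroExt p s * (Iio T).indicator (fun t => dt φ b t - dx φ b t) (s + (b - a)) -
        zeroExt p s * (Iio T).indicator (fun t => dt φ a t - dx φ a t) (s + 0) := by
    intro s
    rw [intervalIntegral.integral_const_mul]
    by_cases hs : s ∈ Ioo 0 T
    · rw [integral_characteristic hφ hab hs.2 hfin, add_zero,
        indicator_of_mem (show s ∈ Iio T from hs.2), mul_sub]
    · rw [zeroExt_of_notMem _ hs]; simp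
  rw [e1, e2]
  simp only [e3]
  rw [integral_sub (integrable_zeroExt_mul (continuous_fst_toH hG b) p (sub_nonneg.2 hab))
    (integrable_zeroExt_mul (continuous_fst_toH hG a) p le_rfl),
    ← inner_shift_toH (sub_nonneg.2 hab) p (continuous_fst_toH hG b),
    ← inner_shift_toH le_rfl p (continuous_fst_toH hG a), shift_zero]

/-- Green's formula for a wave travelling to the left. -/
lemma integral_inner_shift_left (hφ : ContDiff ℝ 2 fun p : ℝ × ℝ => φ p.1 p.2) {a b : ℝ}
    (hab : a ≤ b) (hfin : ∀ x ∈ Icc a b, dt φ x T + dx φ x T = 0) (p : L2 0 T) :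
    ∫ x in a..b, inner ℝ (shift (b - x) p) (toH (box φ x)) =
      inner ℝ (shift (b - a) p) (toH fun t => dt φ a t + dx φ a t) -
        inner ℝ p (toH fun t => dt φ b t + dx φ b t) := by
  have h := integral_inner_shift_right (T := T) (contDiff_reflect hφ) (neg_le_neg hab)
    (fun x hx => by
      rw [dt_reflect, dx_reflect, sub_neg_eq_add]
      exact hfin (-x) ⟨by linarith [hx.2], by linarith [hx.1]⟩) p
  simp only [dt_reflect, dx_reflect, sub_neg_eq_add, neg_neg] at h
  have hb : ∀ x, box (fun x t => φ (-x) t) x = box φ (-x) := fun x => funext (box_reflect x)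
  simp only [hb] at h
  rw [show -a + b = b - a by ring] at h
  rw [← h, ← intervalIntegral.integral_comp_neg]
  refine intervalIntegral.integral_congr fun x _ => ?_
  simp only [neg_neg]
  rw [show -x + b = b - x by ring]

/-- Integration by parts in time. -/
lemma inner_prim_toH_deriv (hT : 0 ≤ T) (h : L2 0 T) {ψ : ℝ → ℝ} (hψ : ContDiff ℝ 1 ψ)
    (hψT : ψ T = 0) : inner ℝ (prim h) (toH (deriv ψ)) = -inner ℝ h (toH ψ) := by
  have hI : IntervalIntegrable (zeroExt h) volume 0 T := (integrable_zeroExt h).intervalIntegrable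
  -- The primitive is only absolutely continuous. Both boundary terms vanish, at 0 because of
  -- `primFun` and at T because of ψ.
  have hac : AbsolutelyContinuousOnInterval (primFun h) 0 T :=
    hI.absolutelyContinuousOnInterval_intervalIntegral left_mem_uIcc
  have hparts := hac.integral_mul_deriv_eq_deriv_mul hψ.contDiffOn.absolutelyContinuousOnInterval
  rw [hψT, primFun_of_nonpos h le_rfl, mul_zero, zero_mul, sub_zero, zero_sub] at hparts
  rw [inner_toH _ (memLp_of_continuous (hψ.continuous_deriv le_rfl)),
    inner_toH _ (memLp_of_continuous hψ.continuous)]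
  have e1 : ∫ t in Ioo 0 T, prim h t * deriv ψ t = ∫ t in (0 : ℝ)..T, primFun h t * deriv ψ t := by
    rw [intervalIntegral.integral_of_le hT, integral_Ioc_eq_integral_Ioo]
    refine integral_congr_ae ?_
    filter_upwards [coeFn_prim h] with t ht
    rw [ht]
  have e2 : ∫ t in (0 : ℝ)..T, deriv (primFun h) t * ψ t = ∫ t in Ioo 0 T, h t * ψ t := by
    rw [intervalIntegral.integral_of_le hT, integral_Ioc_eq_integral_Ioo]
    refine setIntegral_congr_ae measurableSet_Ioo ?_
    filter_upwards [hI.ae_hasDerivAt_integral,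
      (ae_restrict_iff' measurableSet_Ioo).1 (zeroExt_ae h)] with t ht ht' hm
    rw [← ht' hm]
    congr 1
    exact (ht (Icc_subset_uIcc (Ioo_subset_Icc_self hm)) 0 left_mem_uIcc).deriv
  rw [e1, hparts, e2]

end Travelling

/-! ### Green's formula on an edge. -/

section Green

variable {T l : ℝ} {φ : ℝ → ℝ → ℝ} {F : ℝ → L2 0 T}

/-- Smooth functions with zero final data on the edge `(0, l)`. -/
structure HasZeroFinal (l T : ℝ) (φ : ℝ → ℝ → ℝ) : Prop where
  contDiff : ContDiff ℝ 2 fun p : ℝ × ℝ => φ p.1 p.2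
  final : ∀ x ∈ Icc 0 l, φ x T = 0
  final_dt : ∀ x ∈ Icc 0 l, dt φ x T = 0

/-- The final value vanishes on the closed edge only, so at its endpoints the derivative is computed
within the edge. -/
lemma HasZeroFinal.final_dx (h : HasZeroFinal l T φ) (hl : 0 < l) :
    ∀ x ∈ Icc 0 l, dx φ x T = 0 := by
  intro x hx
  have hd : DifferentiableAt ℝ (fun y => φ y T) x := (hasDerivAt_dx h.contDiff x T).differentiableAt
  rw [dx, ← hd.derivWithin (uniqueDiffOn_Icc hl x hx),
    derivWithin_congr (f := fun _ => 0) (fun y hy => h.final y hy) (h.final x hx)]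
  simp

lemma HasZeroFinal.contDiff_time (h : HasZeroFinal l T φ) (x : ℝ) : ContDiff ℝ 2 (φ x) :=
  h.contDiff.comp (contDiff_prodMk_right x)

lemma continuous_inner_toH {ψ : ℝ → ℝ → ℝ} (hψ : Continuous (Function.uncurry ψ))
    {k : ℝ → ℝ} (hk : Continuous k) (p : L2 0 T) :
    Continuous fun x => inner ℝ (shift (k x) p) (toH (ψ x)) :=
  (continuous_shift.comp (g := fun a : ℝ × L2 0 T => shift a.1 a.2) (f := fun x => (k x, p))
    (by fun_prop)).inner (continuous_toH hψ)

lemma inner_duhamel (hF : IntegrableOn F (Ioo 0 l)) (x : ℝ) (k : L2 0 T) :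
    inner ℝ (duhamel l (fun x y => |x - y|) F x) k =
      1 / 2 * ∫ y in Ioo 0 l, inner ℝ (prim (shift |x - y| (F y))) k := by
  have hI := integrableOn_prim_shift continuous_dist_kernel hF x
  rw [duhamel, inner_smul_left, real_inner_comm, ← integral_inner hI]
  simp only [real_inner_comm k]
  rfl

lemma integral_add_add {α : Type*} [MeasurableSpace α] {μ : Measure α} {f g h : α → ℝ}
    (hf : Integrable f μ) (hg : Integrable g μ) (hh : Integrable h μ) :
    ∫ x, (f x + g x + h x) ∂μ = (∫ x, f x ∂μ) + (∫ x, g x ∂μ) + ∫ x, h x ∂μ := by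
  rw [← integral_add hf hg]
  exact integral_add (hf.add hg) hh

/-- A source at y sends one wave to the left and one to the right. In the boundary terms at y the
derivatives φ_x cancel, and the two φ_t add up; integration by parts turns -2⟨`prim h`, φ_t⟩ into
2⟨h, φ⟩. -/
lemma integral_inner_duhamel_point (hT : 0 ≤ T) (hl : 0 < l) (hφ : HasZeroFinal l T φ)
    (h : L2 0 T) {y : ℝ} (hy : y ∈ Ioo 0 l) :
    ∫ x in Ioo 0 l, inner ℝ (prim (shift |x - y| h)) (toH (box φ x)) =
      2 * inner ℝ h (toH (φ y)) +
      inner ℝ (prim (shift |l - y| h)) (toH fun t => dt φ l t - dx φ l t) +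
      inner ℝ (prim (shift |0 - y| h)) (toH fun t => dt φ 0 t + dx φ 0 t) := by
  have hfx := hφ.final_dx hl
  have hbox := continuous_box hφ.contDiff
  have hdt := continuous_dt hφ.contDiff
  have hdx := continuous_dx hφ.contDiff
  have hcont : Continuous fun x => inner ℝ (shift |x - y| (prim h)) (toH (box φ x)) :=
    continuous_inner_toH hbox (by fun_prop) _
  simp only [prim_shift (abs_nonneg _)]
  rw [← integral_Ioc_eq_integral_Ioo, ← intervalIntegral.integral_of_le hl.le,
    ← intervalIntegral.integral_add_adjacent_intervals (hcont.intervalIntegrable 0 y)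
      (hcont.intervalIntegrable y l)]
  have e1 : ∫ x in (0 : ℝ)..y, inner ℝ (shift |x - y| (prim h)) (toH (box φ x)) =
      ∫ x in (0 : ℝ)..y, inner ℝ (shift (y - x) (prim h)) (toH (box φ x)) := by
    refine intervalIntegral.integral_congr fun x hx => ?_
    rw [uIcc_of_le hy.1.le] at hx
    simp only [abs_of_nonpos (sub_nonpos.2 hx.2), neg_sub]
  have e2 : ∫ x in y..l, inner ℝ (shift |x - y| (prim h)) (toH (box φ x)) =
      ∫ x in y..l, inner ℝ (shift (x - y) (prim h)) (toH (box φ x)) := by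
    refine intervalIntegral.integral_congr fun x hx => ?_
    rw [uIcc_of_le hy.2.le] at hx
    simp only [abs_of_nonneg (sub_nonneg.2 hx.1)]
  rw [e1, e2, integral_inner_shift_left hφ.contDiff hy.1.le (fun x hx => by
      have hx' : x ∈ Icc 0 l := ⟨hx.1, hx.2.trans hy.2.le⟩
      rw [hφ.final_dt x hx', hfx x hx', add_zero]),
    integral_inner_shift_right hφ.contDiff hy.2.le (fun x hx => by
      have hx' : x ∈ Icc 0 l := ⟨hy.1.le.trans hx.1, hx.2⟩
      rw [hφ.final_dt x hx', hfx x hx', sub_zero])]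
  have m1 := memLp_of_continuous (T := T) (continuous_fst_toH hdt y)
  have m2 := memLp_of_continuous (T := T) (continuous_fst_toH hdx y)
  have e3 : inner ℝ (prim h) (toH (dt φ y)) = -inner ℝ h (toH (φ y)) :=
    inner_prim_toH_deriv hT h ((hφ.contDiff_time y).of_le (by norm_num))
      (hφ.final y (Ioo_subset_Icc_self hy))
  rw [toH_add m1 m2, toH_sub m1 m2, inner_add_right, inner_sub_right, e3,
    abs_of_nonneg (sub_nonneg.2 hy.2.le), zero_sub, abs_neg, abs_of_nonneg hy.1.le, sub_zero]
  ring

/-- Green's formula for the Duhamel integral. -/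
lemma integral_inner_duhamel (hT : 0 ≤ T) (hl : 0 < l) (hφ : HasZeroFinal l T φ)
    (hF : IntegrableOn F (Ioo 0 l)) :
    ∫ x in Ioo 0 l, inner ℝ (duhamel l (fun x y => |x - y|) F x) (toH (box φ x)) =
      (∫ y in Ioo 0 l, inner ℝ (F y) (toH (φ y))) +
      inner ℝ (duhamel l (fun x y => |x - y|) F l) (toH fun t => dt φ l t - dx φ l t) +
      inner ℝ (duhamel l (fun x y => |x - y|) F 0) (toH fun t => dt φ 0 t + dx φ 0 t) := by
  have hbox := continuous_toH (T := T) (continuous_box hφ.contDiff)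
  obtain ⟨C, hC⟩ := (isCompact_Icc (a := (0 : ℝ)) (b := l)).exists_bound_of_continuousOn
    hbox.continuousOn
  obtain ⟨C', hC'⟩ := (isCompact_Icc (a := (0 : ℝ)) (b := l)).exists_bound_of_continuousOn
    (continuous_toH (T := T) (ψ := φ) hφ.contDiff.continuous).continuousOn
  have hswap : ∫ x in Ioo 0 l, ∫ y in Ioo 0 l,
      inner ℝ (prim (shift |x - y| (F y))) (toH (box φ x)) =
      ∫ y in Ioo 0 l, ∫ x in Ioo 0 l,
        inner ℝ (prim (shift |x - y| (F y))) (toH (box φ x)) := by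
    refine integral_integral_swap ?_
    have hI : Integrable (fun z : ℝ × ℝ => (C * ‖(prim : L2 0 T →L[ℝ] L2 0 T)‖) * ‖F z.2‖)
        ((volume.restrict (Ioo 0 l)).prod (volume.restrict (Ioo 0 l))) :=
      (integrable_const _).mul_prod hF.norm
    refine hI.mono' ?_ ?_
    · refine AEStronglyMeasurable.inner (aestronglyMeasurable_prim_shift
        (k := fun z : ℝ × ℝ => |z.1 - z.2|) (G := fun z : ℝ × ℝ => F z.2) ?_ ?_) ?_
      · exact (by fun_prop : Continuous fun z : ℝ × ℝ => |z.1 - z.2|).aestronglyMeasurable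
      · exact hF.aestronglyMeasurable.comp_snd
      · exact (hbox.comp continuous_fst).aestronglyMeasurable
    · have h3 : ∀ᵐ z : ℝ × ℝ ∂((volume.restrict (Ioo 0 l)).prod (volume.restrict (Ioo 0 l))),
          z.1 ∈ Ioo 0 l := Measure.quasiMeasurePreserving_fst.ae (ae_restrict_mem measurableSet_Ioo)
      filter_upwards [h3] with z hz
      refine (norm_inner_le_norm _ _).trans ?_
      have h4 := hC z.1 (Ioo_subset_Icc_self hz)
      calc _ ≤ (‖(prim : L2 0 T →L[ℝ] L2 0 T)‖ * ‖F z.2‖) * C :=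
            mul_le_mul (norm_prim_shift_le _ _) h4 (norm_nonneg _) (by positivity)
        _ = _ := by ring
  have hI1 : ∀ (x : ℝ) (k : L2 0 T),
      IntegrableOn (fun y => inner ℝ (prim (shift |x - y| (F y))) k) (Ioo 0 l) := fun x k =>
    (integrableOn_prim_shift continuous_dist_kernel hF x).inner_const k
  have hI2 : IntegrableOn (fun y => inner ℝ (F y) (toH (φ y))) (Ioo 0 l) := by
    refine (hF.norm.mul_const C').mono' (hF.aestronglyMeasurable.inner
      (continuous_toH (T := T) (ψ := φ) hφ.contDiff.continuous).aestronglyMeasurable) ?_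
    rw [ae_restrict_iff' measurableSet_Ioo]
    refine Eventually.of_forall fun y hy => (norm_inner_le_norm _ _).trans ?_
    exact mul_le_mul_of_nonneg_left (hC' y (Ioo_subset_Icc_self hy)) (norm_nonneg _)
  simp only [inner_duhamel hF]
  rw [integral_const_mul, hswap, setIntegral_congr_fun measurableSet_Ioo fun y hy =>
    integral_inner_duhamel_point hT hl hφ (F y) hy]
  rw [integral_add_add (hI2.const_mul 2) (hI1 l _) (hI1 0 _), integral_const_mul]
  ring

/-- Green's formula on an edge. -/
lemma integral_inner_wave (hT : 0 ≤ T) (hl : 0 < l) (hφ : HasZeroFinal l T φ)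
    (hF : IntegrableOn F (Ioo 0 l)) {p r : L2 0 T} {U : ℝ → L2 0 T}
    (hU : ∀ x ∈ Icc 0 l, U x = shift x p + shift (l - x) r +
      duhamel l (fun x y => |x - y|) F x) :
    ∫ x in Ioo 0 l, inner ℝ (U x) (toH (box φ x)) =
      (∫ y in Ioo 0 l, inner ℝ (F y) (toH (φ y))) +
      inner ℝ (U 0) (toH (dx φ 0)) - inner ℝ (U l) (toH (dx φ l)) +
      inner ℝ (U 0 - (2 : ℝ) • p) (toH (dt φ 0)) +
      inner ℝ (U l - (2 : ℝ) • r) (toH (dt φ l)) := by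
  have hfx := hφ.final_dx hl
  have hbox := continuous_box hφ.contDiff
  have c1 : Continuous fun x => inner ℝ (shift x p) (toH (box φ x)) :=
    continuous_inner_toH hbox continuous_id _
  have c2 : Continuous fun x => inner ℝ (shift (l - x) r) (toH (box φ x)) :=
    continuous_inner_toH hbox (by fun_prop) _
  have c3 : Continuous fun x =>
      inner ℝ (duhamel l (fun x y => |x - y|) F x) (toH (box φ x)) :=
    (continuous_duhamel continuous_dist_kernel hF).inner (continuous_toH hbox)
  have i1 : ∀ {f : ℝ → ℝ}, Continuous f → IntegrableOn f (Ioo 0 l) := fun hf =>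
    (hf.integrableOn_Icc).mono_set Ioo_subset_Icc_self
  have e0 : ∫ x in Ioo 0 l, inner ℝ (U x) (toH (box φ x)) =
      ∫ x in Ioo 0 l, (inner ℝ (shift x p) (toH (box φ x)) +
        inner ℝ (shift (l - x) r) (toH (box φ x)) +
        inner ℝ (duhamel l (fun x y => |x - y|) F x) (toH (box φ x))) := by
    refine setIntegral_congr_fun measurableSet_Ioo fun x hx => ?_
    simp only [hU x (Ioo_subset_Icc_self hx), inner_add_left]
  have e1 := integral_inner_shift_right (T := T) hφ.contDiff hl.le (fun x hx => by
      rw [hφ.final_dt x hx, hfx x hx, sub_zero]) p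
  have e2 := integral_inner_shift_left (T := T) hφ.contDiff hl.le (fun x hx => by
      rw [hφ.final_dt x hx, hfx x hx, add_zero]) r
  rw [intervalIntegral.integral_of_le hl.le, integral_Ioc_eq_integral_Ioo] at e1 e2
  simp only [sub_zero] at e1 e2
  -- At x = 0 the wave p is paired with φ_x - φ_t and all other parts with φ_x + φ_t. This produces
  -- U(0) - 2p against φ_t, and similarly U(l) - 2r at x = l.
  rw [e0, integral_add_add (i1 c1) (i1 c2) (i1 c3), e1, e2,
    integral_inner_duhamel hT hl hφ hF, hU 0 (left_mem_Icc.2 hl.le), hU l (right_mem_Icc.2 hl.le)]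
  have m1 := fun x => memLp_of_continuous (T := T) (continuous_fst_toH (continuous_dt hφ.contDiff) x)
  have m2 := fun x => memLp_of_continuous (T := T) (continuous_fst_toH (continuous_dx hφ.contDiff) x)
  simp only [toH_add (m1 _) (m2 _), toH_sub (m1 _) (m2 _), inner_add_right, inner_sub_right,
    inner_add_left, inner_sub_left, shift_zero, sub_zero, sub_self, inner_smul_left,
    RCLike.conj_to_real]
  ring

end Green

/-! ### From functions continuous in time to slices at fixed positions. -/

section Regular

/-- Functions in `C([0, T]; L²(0, l))`. -/
structure IsRegular (l T : ℝ) (u : ℝ → ℝ → ℝ) : Prop where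
  aestronglyMeasurable : AEStronglyMeasurable (fun p : ℝ × ℝ => u p.1 p.2)
    ((volume.restrict (Ioo 0 l)).prod (volume.restrict (Ioo 0 T)))
  memLp : ∀ t ∈ Icc 0 T, MemLp (fun x => u x t) 2 (volume.restrict (Ioo 0 l))
  continuous_time : ∀ t₀ ∈ Icc 0 T,
    Tendsto (fun t => eLpNorm (fun x => u x t - u x t₀) 2 (volume.restrict (Ioo 0 l)))
      (𝓝[Icc 0 T] t₀) (𝓝 0)

variable {l T : ℝ} {u : ℝ → ℝ → ℝ}

lemma eLpNorm_toH {ψ : ℝ → ℝ} (h : MemLp ψ 2 (volume.restrict (Ioo 0 T))) :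
    eLpNorm (toH ψ : L2 0 T) 2 (volume.restrict (Ioo 0 T)) =
      eLpNorm ψ 2 (volume.restrict (Ioo 0 T)) := eLpNorm_congr_ae (coeFn_toH h)

lemma edist_toH {ψ χ : ℝ → ℝ} (hψ : MemLp ψ 2 (volume.restrict (Ioo 0 T)))
    (hχ : MemLp χ 2 (volume.restrict (Ioo 0 T))) :
    edist (toH ψ : L2 0 T) (toH χ) =
      eLpNorm (fun t => ψ t - χ t) 2 (volume.restrict (Ioo 0 T)) := by
  rw [Lp.edist_def]
  refine eLpNorm_congr_ae ?_
  filter_upwards [coeFn_toH hψ, coeFn_toH hχ] with t h1 h2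
  rw [Pi.sub_apply, h1, h2]

lemma IsRegular.continuousOn (hu : IsRegular l T u) :
    ContinuousOn (fun t => (toH (fun x => u x t) : L2 0 l)) (Icc 0 T) := by
  intro t₀ ht₀
  rw [ContinuousWithinAt, tendsto_iff_edist_tendsto_0]
  refine (hu.continuous_time t₀ ht₀).congr' ?_
  filter_upwards [self_mem_nhdsWithin] with t ht
  rw [edist_toH (hu.memLp t ht) (hu.memLp t₀ ht₀)]

/-- By compactness of [0,T] the norms of the time slices are bounded. Square integrability on the
rectangle then makes the slices at almost every position square integrable in time. -/
lemma IsRegular.memLp_prod (hu : IsRegular l T u) :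
    MemLp (fun p : ℝ × ℝ => u p.1 p.2) 2
      ((volume.restrict (Ioo 0 l)).prod (volume.restrict (Ioo 0 T))) := by
  refine ⟨hu.aestronglyMeasurable, ?_⟩
  obtain ⟨C, hC⟩ := isCompact_Icc.exists_bound_of_continuousOn hu.continuousOn
  rw [eLpNorm_lt_top_iff_lintegral_rpow_enorm_lt_top (by norm_num) (by norm_num)]
  rw [lintegral_prod_symm _ (by
    exact hu.aestronglyMeasurable.enorm.pow_const _)]
  have h1 : ∀ t ∈ Ioo 0 T, ∫⁻ x in Ioo 0 l, ‖u x t‖ₑ ^ (2 : ENNReal).toReal ≤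
      ENNReal.ofReal C ^ (2 : ℝ) := by
    intro t ht
    have h2 := hC t (Ioo_subset_Icc_self ht)
    have h3 := hu.memLp t (Ioo_subset_Icc_self ht)
    have h4 : eLpNorm (fun x => u x t) 2 (volume.restrict (Ioo 0 l)) ≤ ENNReal.ofReal C := by
      rw [← eLpNorm_toH h3, ← ENNReal.ofReal_toReal (Lp.eLpNorm_ne_top _), ← Lp.norm_def]
      exact ENNReal.ofReal_le_ofReal h2
    rw [eLpNorm_eq_lintegral_rpow_enorm_toReal (by norm_num) (by norm_num)] at h4
    have h5 := ENNReal.rpow_le_rpow h4 (z := 2) (by norm_num)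
    rw [← ENNReal.rpow_mul] at h5
    simpa using h5
  refine (setLIntegral_mono' measurableSet_Ioo h1).trans_lt ?_
  rw [setLIntegral_const]
  exact ENNReal.mul_lt_top (by simp) measure_Ioo_lt_top

/-- In a second countable metric space every open set is a countable union of balls, whose preimages
are controlled by the distance functions. -/
lemma measurable_of_dist {α E : Type*} [MeasurableSpace α] [PseudoMetricSpace E]
    [SecondCountableTopology E] [MeasurableSpace E] [BorelSpace E] {f : α → E}
    (hf : ∀ c, Measurable fun a => dist (f a) c) : Measurable f := by
  refine measurable_of_isOpen fun O hO => ?_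
  obtain ⟨S, hS, hSO⟩ := TopologicalSpace.isOpen_iUnion_countable
    (fun c : {c : E × ℝ // Metric.ball c.1 c.2 ⊆ O} => Metric.ball c.1.1 c.1.2)
    fun c => Metric.isOpen_ball
  have h1 : O = ⋃ c : {c : E × ℝ // Metric.ball c.1 c.2 ⊆ O}, Metric.ball c.1.1 c.1.2 := by
    refine Subset.antisymm (fun x hx => ?_) (iUnion_subset fun c => c.2)
    obtain ⟨ε, hε, hb⟩ := Metric.isOpen_iff.1 hO x hx
    exact mem_iUnion.2 ⟨⟨(x, ε), hb⟩, Metric.mem_ball_self hε⟩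
  rw [h1, ← hSO, preimage_iUnion₂]
  exact MeasurableSet.biUnion hS fun c _ => measurableSet_lt (hf c.1.1) measurable_const

/-- As L²(0,T) is separable, it suffices that distances to fixed elements are measurable, and these
are parameter integrals. On the slices outside L² the default value 0 of `toH` gives the constant
distance `‖h‖`. -/
lemma measurable_toH {v : ℝ → ℝ → ℝ} (hv : Measurable (Function.uncurry v)) :
    StronglyMeasurable fun x => (toH (v x) : L2 0 T) := by
  have : Fact ((2 : ENNReal) ≠ ⊤) := ⟨by norm_num⟩
  borelize (L2 0 T)
  refine (measurable_of_dist fun h => ?_).stronglyMeasurable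
  have hvx : ∀ x, Measurable (v x) := fun x => hv.of_uncurry_left
  have hN : ∀ w : ℝ → ℝ → ℝ, Measurable (Function.uncurry w) → Measurable fun x =>
      eLpNorm (w x) 2 (volume.restrict (Ioo 0 T)) := by
    intro w hw
    simp only [eLpNorm_eq_lintegral_rpow_enorm_toReal (p := 2) (by norm_num) (by norm_num)]
    exact (Measurable.lintegral_prod_right' (hw.enorm.pow_const _)).pow_const _
  have hS : MeasurableSet {x | eLpNorm (v x) 2 (volume.restrict (Ioo 0 T)) < ⊤} :=
    measurableSet_lt (hN v hv) measurable_const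
  have hD := hN (fun x t => v x t - h t) (hv.sub
    ((Lp.stronglyMeasurable h).measurable.comp measurable_snd))
  classical
  have h1 : (fun x => dist (toH (v x)) h) = fun x =>
      if x ∈ {x | eLpNorm (v x) 2 (volume.restrict (Ioo 0 T)) < ⊤} then
        (eLpNorm (fun t => v x t - h t) 2 (volume.restrict (Ioo 0 T))).toReal else ‖h‖ := by
    ext x
    split_ifs with hx
    · have hm : MemLp (v x) 2 (volume.restrict (Ioo 0 T)) :=
        ⟨(hvx x).aestronglyMeasurable, hx⟩
      rw [← edist_toH hm (Lp.memLp h), toH_coe, edist_dist, ENNReal.toReal_ofReal dist_nonneg]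
    · rw [toH, dif_neg (fun hm => hx hm.2), dist_zero_left]
  rw [h1]
  exact Measurable.ite hS hD.ennreal_toReal measurable_const

lemma IsRegular.ae_memLp (hu : IsRegular l T u) :
    ∀ᵐ x ∂volume.restrict (Ioo 0 l), MemLp (u x) 2 (volume.restrict (Ioo 0 T)) := by
  have h1 := hu.memLp_prod.integrable_sq
  have h2 := hu.aestronglyMeasurable
  filter_upwards [h1.prod_right_ae, h2.prodMk_left] with x h3 h4
  exact (memLp_two_iff_integrable_sq h4).2 h3

lemma IsRegular.ae_coeFn_toH (hu : IsRegular l T u) :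
    ∀ᵐ x ∂volume.restrict (Ioo 0 l), (toH (u x) : L2 0 T) =ᵐ[volume.restrict (Ioo 0 T)] u x := by
  filter_upwards [hu.ae_memLp] with x hx using coeFn_toH hx

lemma IsRegular.integrableOn_toH (hu : IsRegular l T u) :
    IntegrableOn (fun x => (toH (u x) : L2 0 T)) (Ioo 0 l) := by
  have hm : AEStronglyMeasurable (fun x => (toH (u x) : L2 0 T)) (volume.restrict (Ioo 0 l)) := by
    obtain ⟨w, hw, huw⟩ := hu.aestronglyMeasurable
    refine (measurable_toH (T := T) (v := fun x t => w (x, t))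
      hw.measurable).aestronglyMeasurable.congr ?_
    filter_upwards [Measure.ae_ae_of_ae_prod huw] with x hx
    exact (toH_congr hx).symm
  refine (memLp_two_iff_integrable_sq_norm hm).2 ?_ |>.integrable (by norm_num)
  have h1 := hu.memLp_prod.integrable_sq.integral_prod_left
  refine h1.congr ?_
  filter_upwards [hu.ae_coeFn_toH] with x hx
  rw [← real_inner_self_eq_norm_sq, inner_eq]
  refine integral_congr_ae ?_
  filter_upwards [hx] with t ht
  rw [ht, sq]

lemma ae_prod_of_forall {a b c d : ℝ} {P : ℝ × ℝ → Prop}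
    (h : ∀ x ∈ Ioo a b, ∀ t ∈ Ioo c d, P (x, t)) :
    ∀ᵐ p ∂(volume.restrict (Ioo a b)).prod (volume.restrict (Ioo c d)), P p := by
  rw [Measure.prod_restrict]
  exact ae_restrict_of_forall_mem (measurableSet_Ioo.prod measurableSet_Ioo)
    fun p hp => h p.1 hp.1 p.2 hp.2

lemma IsRegular.integrable_mul (hu : IsRegular l T u) {w : ℝ → ℝ → ℝ}
    (hw : Continuous (Function.uncurry w)) :
    Integrable (fun p : ℝ × ℝ => u p.1 p.2 * w p.1 p.2)
      ((volume.restrict (Ioo 0 l)).prod (volume.restrict (Ioo 0 T))) := by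
  obtain ⟨C, hC⟩ :=
    (isCompact_Icc (a := ((0 : ℝ), (0 : ℝ))) (b := (l, T))).exists_bound_of_continuousOn
      hw.continuousOn
  refine (hu.memLp_prod.integrable (by norm_num)).mul_bdd (c := C) hw.aestronglyMeasurable ?_
  exact ae_prod_of_forall fun x hx t ht => hC (x, t) ⟨⟨hx.1.le, ht.1.le⟩, ⟨hx.2.le, ht.2.le⟩⟩

/-- The left hand side of the weak formulation on an edge. -/
lemma IsRegular.integral_waveOp (hu : IsRegular l T u) (hl : 0 < l) (hT : 0 < T)
    {q : ℝ → ℝ} (hq : ContinuousOn q (Ioo 0 l))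
    (hQ : ∃ Q, ∀ x ∈ Ioo 0 l, |q x| ≤ Q) {φ : ℝ → ℝ → ℝ}
    (hφ : ContDiff ℝ 2 fun p : ℝ × ℝ => φ p.1 p.2) :
    ∫ t in (0 : ℝ)..T, ∫ x in (0 : ℝ)..l, u x t * (box φ x t + q x * φ x t) =
      (∫ x in Ioo 0 l, inner ℝ (toH (u x) : L2 0 T) (toH (box φ x))) +
        ∫ x in Ioo 0 l, inner ℝ (q x • toH (u x) : L2 0 T) (toH (φ x)) := by
  obtain ⟨Q, hQ⟩ := hQ
  have hb := continuous_box hφ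
  have hφc : Continuous (Function.uncurry φ) := hφ.continuous
  have h1 := hu.integrable_mul hb
  have hqm : AEStronglyMeasurable (fun p : ℝ × ℝ => q p.1)
      ((volume.restrict (Ioo 0 l)).prod (volume.restrict (Ioo 0 T))) :=
    (hq.aestronglyMeasurable measurableSet_Ioo).comp_fst
  have h2 := (hu.integrable_mul hφc).bdd_mul (c := Q) hqm
    (ae_prod_of_forall fun x hx t _ => hQ x hx)
  have h3 := h1.integral_prod_left
  have h4 := h2.integral_prod_left
  simp only [intervalIntegral.integral_of_le hl.le, intervalIntegral.integral_of_le hT.le,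
    integral_Ioc_eq_integral_Ioo]
  rw [← integral_integral_swap (f := fun x t => u x t * (box φ x t + q x * φ x t))
    ((h1.add h2).congr (ae_of_all _ fun p => by
      simp only [Pi.add_apply, Function.uncurry]; ring))]
  have e1 : ∀ᵐ x ∂volume.restrict (Ioo 0 l), ∫ t in Ioo 0 T, u x t * box φ x t =
      inner ℝ (toH (u x) : L2 0 T) (toH (box φ x)) := by
    filter_upwards [hu.ae_coeFn_toH] with x hx
    rw [inner_toH _ (memLp_of_continuous (continuous_fst_toH hb x))]
    refine integral_congr_ae ?_
    filter_upwards [hx] with t ht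
    rw [ht]
  have e2 : ∀ᵐ x ∂volume.restrict (Ioo 0 l), ∫ t in Ioo 0 T, q x * (u x t * φ x t) =
      inner ℝ (q x • toH (u x) : L2 0 T) (toH (φ x)) := by
    filter_upwards [hu.ae_coeFn_toH] with x hx
    rw [inner_smul_left, inner_toH _ (memLp_of_continuous (continuous_fst_toH hφc x)),
      integral_const_mul]
    refine congrArg (q x * ·) (integral_congr_ae ?_)
    filter_upwards [hx] with t ht
    rw [ht]
  rw [← integral_congr_ae e1, ← integral_congr_ae e2, ← integral_add h3 h4]
  refine integral_congr_ae ?_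
  filter_upwards [h1.prod_right_ae, h2.prod_right_ae] with x hx1 hx2
  rw [← integral_add hx1 hx2]
  exact integral_congr_ae (ae_of_all _ fun t => by ring)

end Regular

/-! ### Pointwise representatives of waves. -/

section Representative

variable {l T : ℝ} {F : ℝ → L2 0 T}

/-- The Duhamel integral as a function of position and time. -/
noncomputable def duhamelFun (l : ℝ) (F : ℝ → L2 0 T) (x t : ℝ) : ℝ :=
  1 / 2 * ∫ y in Ioo 0 l, primFun (F y) (t - |x - y|)

lemma continuous_duhamelFun (hF : IntegrableOn F (Ioo 0 l)) :
    Continuous (Function.uncurry (duhamelFun l F)) := by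
  have h1 : Continuous fun p : ℝ × ℝ => ∫ y in Ioo 0 l, primFun (F y) (p.2 - |p.1 - y|) := ?_
  · exact h1.const_mul (1 / 2 : ℝ)
  refine continuous_of_dominated (bound := fun y => √(volume.real (Ioo 0 T)) * ‖F y‖)
    (fun p => ?_) (fun p => Eventually.of_forall fun y => abs_primFun_le _ _)
    (hF.norm.const_mul _) (Eventually.of_forall fun y => ?_)
  · exact Continuous.comp_aestronglyMeasurable
      (g := fun a : BoundedContinuousFunction ℝ ℝ × ℝ => a.1 a.2)
      (f := fun y => (primB (F y), p.2 - |p.1 - y|)) ContinuousEval.continuous_eval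
      ((primB.continuous.comp_aestronglyMeasurable hF.aestronglyMeasurable).prodMk
        (by fun_prop : Continuous fun y => p.2 - |p.1 - y|).aestronglyMeasurable)
  · exact (continuous_primFun (F y)).comp (by fun_prop)

lemma integrableOn_shift {κ : ℝ → ℝ} (hκ : Continuous κ) (hF : IntegrableOn F (Ioo 0 l)) :
    IntegrableOn (fun y => shift (κ y) (F y)) (Ioo 0 l) :=
  hF.norm.mono' (Continuous.comp_aestronglyMeasurable (g := fun p : ℝ × L2 0 T => shift p.1 p.2)
    (f := fun y => (κ y, F y)) continuous_shift
    (hκ.aestronglyMeasurable.prodMk hF.aestronglyMeasurable))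
    (Eventually.of_forall fun _ => norm_shift_le _ _)

/-- Evaluation at a time is not defined on L². So `prim` is first pulled out of the integral; its
values are continuous functions, on which evaluation is a bounded functional and commutes with the
integral. -/
lemma coeFn_duhamel (hF : IntegrableOn F (Ioo 0 l)) (x : ℝ) :
    duhamel l (fun x y => |x - y|) F x =ᵐ[volume.restrict (Ioo 0 T)] duhamelFun l F x := by
  have hI := integrableOn_shift (κ := fun y => |x - y|) (by fun_prop) hF
  have h1 : ∫ y in Ioo 0 l, prim (shift |x - y| (F y)) =
      prim (∫ y in Ioo 0 l, shift |x - y| (F y)) := prim.integral_comp_comm hI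
  rw [duhamel, h1]
  filter_upwards [Lp.coeFn_smul (1 / 2 : ℝ) (prim (∫ y in Ioo 0 l, shift |x - y| (F y))),
    coeFn_prim (∫ y in Ioo 0 l, shift |x - y| (F y)), ae_restrict_mem measurableSet_Ioo]
    with t e1 e2 ht
  have e3 : primFun (∫ y in Ioo 0 l, shift |x - y| (F y)) t =
      ∫ y in Ioo 0 l, primFun (shift |x - y| (F y)) t :=
    (((BoundedContinuousFunction.evalCLM ℝ t).comp primB).integral_comp_comm hI).symm
  rw [e1, Pi.smul_apply, e2, e3, duhamelFun, smul_eq_mul]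
  congr 1
  refine integral_congr_ae (Eventually.of_forall fun y => ?_)
  exact primFun_shift (abs_nonneg _) _ ht.2.le

/-- A function of position and time that represents the edge wave emitted from the endpoints
as `p` and `r`, with source `F`. -/
noncomputable def waveFun (l : ℝ) (p r : L2 0 T) (F : ℝ → L2 0 T) (x t : ℝ) : ℝ :=
  zeroExt p (t - x) + zeroExt r (t - (l - x)) + duhamelFun l F x t

lemma coeFn_waveFun (p r : L2 0 T) (hF : IntegrableOn F (Ioo 0 l)) (x : ℝ) :
    (shift x p + shift (l - x) r + duhamel l (fun x y => |x - y|) F x : L2 0 T)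
      =ᵐ[volume.restrict (Ioo 0 T)] waveFun l p r F x := by
  filter_upwards [Lp.coeFn_add (shift x p + shift (l - x) r) (duhamel l (fun x y => |x - y|) F x),
    Lp.coeFn_add (shift x p) (shift (l - x) r), coeFn_shift x p, coeFn_shift (l - x) r,
    coeFn_duhamel hF x] with t h1 h2 h3 h4 h5
  rw [h1, Pi.add_apply, h2, Pi.add_apply, h3, h4, h5, waveFun]

lemma memLp_translate {g : ℝ → ℝ} (hg : MemLp g 2 volume) (t : ℝ) :
    MemLp (fun x => g (x - t)) 2 (volume.restrict (Ioo 0 l)) :=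
  (hg.comp_measurePreserving (measurePreserving_subMap t)).restrict _

lemma continuous_toH_translate {g : ℝ → ℝ} (hg : MemLp g 2 volume) :
    Continuous fun t => (toH (fun x => g (x - t)) : L2 0 l) := by
  have h1 : Continuous fun t : ℝ => LpToLpRestrictCLM ℝ ℝ ℝ volume 2 (Ioo 0 l)
      (Lp.compMeasurePreserving (subMap t) (measurePreserving_subMap t) hg.toLp) := by
    refine (LpToLpRestrictCLM ℝ ℝ ℝ volume 2 (Ioo 0 l)).continuous.comp ?_
    exact Continuous.compMeasurePreservingLp continuous_const continuous_subMap
      (fun p => measurePreserving_subMap p) (by norm_num)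
  refine h1.congr fun t => Lp.ext ?_
  refine (LpToLpRestrictCLM_coeFn ℝ _ _).trans (EventuallyEq.trans (ae_restrict_of_ae ?_)
    (coeFn_toH (memLp_translate hg t)).symm)
  refine (Lp.coeFn_compMeasurePreserving _ (measurePreserving_subMap t)).trans ?_
  exact (measurePreserving_subMap t).quasiMeasurePreserving.ae_eq_comp hg.coeFn_toLp

/-- At fixed t the emitted parts are, as functions of x, translates of fixed functions in L²(ℝ), so
continuity in t is the continuity of translations. The Duhamel part is jointly continuous. -/
lemma isRegular_waveFun (p r : L2 0 T) (hF : IntegrableOn F (Ioo 0 l)) :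
    IsRegular l T (waveFun l p r F) := by
  have hd := continuous_duhamelFun hF
  have hp : MemLp (fun x => zeroExt p (-x)) 2 volume :=
    (memLp_zeroExt p).comp_measurePreserving (Measure.measurePreserving_neg volume)
  have hdt : ∀ t, Continuous fun x => duhamelFun l F x t := fun t =>
    hd.comp (Continuous.prodMk_left t)
  have e1 : ∀ t, (fun x => waveFun l p r F x t) = fun x =>
      zeroExt p (-(x - t)) + zeroExt r (x - (l - t)) + duhamelFun l F x t := by
    intro t; ext x
    rw [waveFun]
    congr 3 <;> ring
  have m1 := fun t => memLp_translate (l := l) hp t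
  have m2 := fun t => memLp_translate (l := l) (memLp_zeroExt r) (l - t)
  have m3 := fun t => memLp_of_continuous (T := l) (hdt t)
  have hm : ∀ t, MemLp (fun x => waveFun l p r F x t) 2 (volume.restrict (Ioo 0 l)) := fun t => by
    rw [e1]; exact ((m1 t).add (m2 t)).add (m3 t)
  refine ⟨?_, fun t _ => hm t, fun t₀ _ => ?_⟩
  · refine Measurable.aestronglyMeasurable ?_
    exact (((measurable_zeroExt p).comp (measurable_snd.sub measurable_fst)).add
      ((measurable_zeroExt r).comp (measurable_snd.sub (measurable_const.sub measurable_fst)))).add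
      hd.measurable
  · have hc : Continuous fun t => (toH (fun x => waveFun l p r F x t) : L2 0 l) := by
      have e2 : ∀ t, (toH (fun x => waveFun l p r F x t) : L2 0 l) =
          toH (fun x => zeroExt p (-(x - t))) + toH (fun x => zeroExt r (x - (l - t))) +
            toH fun x => duhamelFun l F x t := fun t => by
        rw [e1, toH_add (ψ := fun x => zeroExt p (-(x - t)) + zeroExt r (x - (l - t)))
          ((m1 t).add (m2 t)) (m3 t), toH_add (m1 t) (m2 t)]
      simp only [e2]
      refine ((continuous_toH_translate hp).add ?_).add ?_
      · exact (continuous_toH_translate (memLp_zeroExt r)).comp (g := fun s =>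
          (toH (fun x => zeroExt r (x - s)) : L2 0 l)) (continuous_const.sub continuous_id)
      · exact continuous_toH (ψ := fun t x => duhamelFun l F x t) (hd.comp continuous_swap)
    have h2 := tendsto_iff_edist_tendsto_0.1
      ((hc.tendsto t₀).mono_left (nhdsWithin_le_nhds (s := Icc 0 T)))
    exact h2.congr fun t => edist_toH (hm t) (hm t₀)

end Representative

/-! ### The weak formulation for systems of waves. -/

section WeakFormulation

variable {T : ℝ}

lemma IsEdgeWave.integral_waveOp {l : ℝ} {u φ : ℝ → ℝ → ℝ} {q : ℝ → ℝ} {p r : L2 0 T}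
    {U : ℝ → L2 0 T} (hU : IsEdgeWave l q p r U) (hu : IsRegular l T u) (hl : 0 < l) (hT : 0 < T)
    (hq : ContinuousOn q (Ioo 0 l)) (hQ : ∃ Q, ∀ x ∈ Ioo 0 l, |q x| ≤ Q)
    (hφ : HasZeroFinal l T φ)
    (huU : ∀ᵐ x ∂volume.restrict (Ioo 0 l), (toH (u x) : L2 0 T) = U x) :
    ∫ t in (0 : ℝ)..T, ∫ x in (0 : ℝ)..l, u x t * (box φ x t + q x * φ x t) =
      inner ℝ (U 0) (toH (dx φ 0)) - inner ℝ (U l) (toH (dx φ l)) +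
      (inner ℝ (U 0 - (2 : ℝ) • p) (toH (dt φ 0)) +
      inner ℝ (U l - (2 : ℝ) • r) (toH (dt φ l))) := by
  have h1 := integral_inner_wave hT.le hl hφ (integrableOn_potential' hq hQ hU.continuousOn) hU.eq
  have e1 : ∫ x in Ioo 0 l, inner ℝ (toH (u x) : L2 0 T) (toH (box φ x)) =
      ∫ x in Ioo 0 l, inner ℝ (U x) (toH (box φ x)) := by
    refine integral_congr_ae ?_
    filter_upwards [huU] with x hx
    rw [hx]
  have e2 : ∫ x in Ioo 0 l, inner ℝ (q x • toH (u x) : L2 0 T) (toH (φ x)) =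
      -∫ x in Ioo 0 l, inner ℝ (-q x • U x) (toH (φ x)) := by
    rw [← integral_neg]
    refine integral_congr_ae ?_
    filter_upwards [huU] with x hx
    rw [hx, neg_smul, inner_neg_left, neg_neg]
  rw [hu.integral_waveOp hl hT hq hQ hφ.contDiff, e1, e2, h1]
  ring

lemma integral_mul_eq_inner (hT : 0 < T) {a ψ : ℝ → ℝ}
    (ha : MemLp a 2 (volume.restrict (Ioo 0 T))) (hψ : Continuous ψ) :
    ∫ t in (0 : ℝ)..T, a t * ψ t = inner ℝ (toH a : L2 0 T) (toH ψ) := by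
  rw [inner_toH _ (memLp_of_continuous hψ), intervalIntegral.integral_of_le hT.le,
    integral_Ioc_eq_integral_Ioo]
  refine integral_congr_ae ?_
  filter_upwards [coeFn_toH ha] with t ht
  rw [ht]

lemma Edge.head_ne_tail (e : Edge) : e.head ≠ e.tail := by cases e <;> decide

lemma pos_tail (l : Edge → ℝ) (e : Edge) : pos l e e.tail = 0 := if_pos rfl

lemma pos_head (l : Edge → ℝ) (e : Edge) : pos l e e.head = l e := if_neg e.head_ne_tail

variable {l : Edge → ℝ} {q : Edge → ℝ → ℝ}

lemma IsTestFunction.hasZeroFinal {φ : Edge → ℝ → ℝ → ℝ} (hφ : IsTestFunction l T φ) (e : Edge) :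
    HasZeroFinal (l e) T (φ e) := ⟨hφ.contDiff e, hφ.final e, hφ.final_deriv e⟩

/-- For functions that are waves on every edge, the weak formulation is a condition on the
emitted waves at the vertices. -/
lemma weak_iff (hl : ∀ e, 0 < l e) (hT : 0 < T) (hq : ∀ e, ContinuousOn (q e) (Ioo 0 (l e)))
    (hqb : ∀ e, ∃ M, ∀ x ∈ Ioo 0 (l e), |q e x| ≤ M) {u : Edge → ℝ → ℝ → ℝ}
    {tr : Edge → Vertex → ℝ → ℝ} {p r : Edge → L2 0 T} {U : Edge → ℝ → L2 0 T}
    (hu : ∀ e, IsRegular (l e) T (u e))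
    (htr : ∀ e v, Incident e v → MemLp (tr e v) 2 (volume.restrict (Ioo 0 T)))
    (hU : ∀ e, IsEdgeWave (l e) (q e) (p e) (r e) (U e))
    (huU : ∀ e, ∀ᵐ x ∂volume.restrict (Ioo 0 (l e)), (toH (u e x) : L2 0 T) = U e x)
    (htail : ∀ e, toH (tr e e.tail) = U e 0) (hhead : ∀ e, toH (tr e e.head) = U e (l e))
    {φ : Edge → ℝ → ℝ → ℝ} (hφ : IsTestFunction l T φ) :
    (∑ e, ∫ t in 0..T, ∫ x in 0..l e, u e x t * waveOp q φ e x t =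
      ∑ e, ((∫ t in 0..T, tr e e.tail t * outDeriv l φ e e.tail t) +
        ∫ t in 0..T, tr e e.head t * outDeriv l φ e e.head t)) ↔
    ∑ e, (inner ℝ (U e 0 - (2 : ℝ) • p e) (toH (dt (φ e) 0)) +
      inner ℝ (U e (l e) - (2 : ℝ) • r e) (toH (dt (φ e) (l e)))) = 0 := by
  have e1 : ∀ e, ∫ t in 0..T, ∫ x in 0..l e, u e x t * waveOp q φ e x t =
      ((∫ t in 0..T, tr e e.tail t * outDeriv l φ e e.tail t) +
        ∫ t in 0..T, tr e e.head t * outDeriv l φ e e.head t) +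
      (inner ℝ (U e 0 - (2 : ℝ) • p e) (toH (dt (φ e) 0)) +
      inner ℝ (U e (l e) - (2 : ℝ) • r e) (toH (dt (φ e) (l e)))) := by
    intro e
    have hdx := continuous_dx (hφ.contDiff e)
    have h1 : ∀ t, outDeriv l φ e e.tail t = dx (φ e) 0 t := fun t => if_pos rfl
    have h2 : ∀ t, outDeriv l φ e e.head t = -dx (φ e) (l e) t := fun t =>
      if_neg e.head_ne_tail
    simp only [h1, h2, mul_neg, intervalIntegral.integral_neg]
    rw [integral_mul_eq_inner hT (htr e _ (Or.inl rfl)) (continuous_fst_toH hdx 0),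
      integral_mul_eq_inner hT (htr e _ (Or.inr rfl)) (continuous_fst_toH hdx (l e)),
      htail, hhead, ← sub_eq_add_neg]
    exact (hU e).integral_waveOp (hu e) (hl e) hT (hq e) (hqb e) (hφ.hasZeroFinal e) (huU e)
  rw [Finset.sum_congr rfl fun e _ => e1 e, Finset.sum_add_distrib, add_eq_left]

lemma sum_edge (f : Edge → ℝ) : ∑ e, f e = f .e1 + f .e2 + f .e3 + f .e4 := by
  have : (Finset.univ : Finset Edge) = {.e1, .e2, .e3, .e4} := rfl
  rw [this]
  rw [Finset.sum_insert (by decide), Finset.sum_insert (by decide), Finset.sum_insert (by decide),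
    Finset.sum_singleton]
  ring

/-- At a vertex, the time derivatives of a test function agree. -/
lemma IsTestFunction.toH_dt_eq {φ : Edge → ℝ → ℝ → ℝ} (hφ : IsTestFunction l T φ) {v : Vertex}
    {e e' : Edge} (he : Incident e v) (he' : Incident e' v) :
    (toH (dt (φ e) (pos l e v)) : L2 0 T) = toH (dt (φ e') (pos l e' v)) := by
  refine toH_congr ?_
  filter_upwards [ae_restrict_mem measurableSet_Ioo] with t ht
  refine Filter.EventuallyEq.deriv_eq ?_
  filter_upwards [Ioo_mem_nhds ht.1 ht.2] with s hs
  exact hφ.continuous_at_vertex v e e' he he' s (Ioo_subset_Icc_self hs)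

lemma IsTestFunction.toH_dt_eq_zero {φ : Edge → ℝ → ℝ → ℝ} (hφ : IsTestFunction l T φ) {v : Vertex}
    {e : Edge} (hv : IsBoundary v) (he : Incident e v) :
    (toH (dt (φ e) (pos l e v)) : L2 0 T) = 0 := by
  have h1 : (toH (dt (φ e) (pos l e v)) : L2 0 T) = toH fun t => ((0 : L2 0 T) : ℝ → ℝ) t := by
    refine toH_congr ?_
    filter_upwards [ae_restrict_mem measurableSet_Ioo, Lp.coeFn_zero ℝ 2 (volume.restrict (Ioo 0 T))]
      with t ht h0
    rw [h0, Pi.zero_apply, dt, Filter.EventuallyEq.deriv_eq (f := fun _ => (0 : ℝ)), deriv_const]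
    filter_upwards [Ioo_mem_nhds ht.1 ht.2] with s hs
    exact hφ.boundary v e hv he s (Ioo_subset_Icc_self hs)
  rw [h1, toH_coe]

/-- The vertex terms of the weak formulation. -/
lemma IsTestFunction.sum_inner {φ : Edge → ℝ → ℝ → ℝ} (hφ : IsTestFunction l T φ)
    (A B : Edge → L2 0 T) :
    ∑ e, (inner ℝ (A e) (toH (dt (φ e) 0)) + inner ℝ (B e) (toH (dt (φ e) (l e)))) =
      inner ℝ (A .e1 + A .e2 + A .e3) (toH (dt (φ .e1) 0)) +
      inner ℝ (B .e2 + B .e3 + A .e4) (toH (dt (φ .e4) 0)) := by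
  have h2 : (toH (dt (φ .e2) 0) : L2 0 T) = toH (dt (φ .e1) 0) :=
    hφ.toH_dt_eq (v := .v2) (e := .e2) (e' := .e1) (Or.inl rfl) (Or.inl rfl)
  have h3 : (toH (dt (φ .e3) 0) : L2 0 T) = toH (dt (φ .e1) 0) :=
    hφ.toH_dt_eq (v := .v2) (e := .e3) (e' := .e1) (Or.inl rfl) (Or.inl rfl)
  have h4 : (toH (dt (φ .e2) (l .e2)) : L2 0 T) = toH (dt (φ .e4) 0) :=
    hφ.toH_dt_eq (v := .v3) (e := .e2) (e' := .e4) (Or.inr rfl) (Or.inl rfl)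
  have h5 : (toH (dt (φ .e3) (l .e3)) : L2 0 T) = toH (dt (φ .e4) 0) :=
    hφ.toH_dt_eq (v := .v3) (e := .e3) (e' := .e4) (Or.inr rfl) (Or.inl rfl)
  have h6 : (toH (dt (φ .e1) (l .e1)) : L2 0 T) = 0 :=
    hφ.toH_dt_eq_zero (v := .v1) (Or.inl rfl) (e := .e1) (Or.inr rfl)
  have h7 : (toH (dt (φ .e4) (l .e4)) : L2 0 T) = 0 :=
    hφ.toH_dt_eq_zero (v := .v4) (Or.inr rfl) (e := .e4) (Or.inr rfl)
  rw [sum_edge, h2, h3, h4, h5, h6, h7]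
  simp only [inner_add_left, inner_zero_right]
  ring

lemma ae_mem_iff {P : ℝ → Prop} :
    (∀ᵐ t, t ∈ Ioo 0 T → P t) ↔ ∀ᵐ t ∂volume.restrict (Ioo 0 T), P t :=
  (ae_restrict_iff' measurableSet_Ioo).symm

/-- The boundary values of a system of waves. -/
noncomputable def traceOf (l : Edge → ℝ) (U : Edge → ℝ → L2 0 T) (e : Edge) (v : Vertex) : ℝ → ℝ :=
  U e (pos l e v)

lemma pos_mem (hl : ∀ e, 0 < l e) (e : Edge) (v : Vertex) : pos l e v ∈ Icc 0 (l e) := by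
  unfold pos
  split_ifs
  exacts [⟨le_rfl, (hl e).le⟩, ⟨(hl e).le, le_rfl⟩]

/-- Existence: a system of waves gives a generalized solution. -/
lemma IsSystem.exists_isGeneralizedSolution (hl : ∀ e, 0 < l e) (hT : 0 < T)
    (hq : ∀ e, ContinuousOn (q e) (Ioo 0 (l e)))
    (hqb : ∀ e, ∃ M, ∀ x ∈ Ioo 0 (l e), |q e x| ≤ M) {f g : L2 0 T}
    {p r : Edge → L2 0 T} {U : Edge → ℝ → L2 0 T} (hS : IsSystem l q f g p r U) :
    ∃ u, IsGeneralizedSolution l q T (zeroExt f) (zeroExt g) u (traceOf l U) := by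
  set F : Edge → ℝ → L2 0 T := fun e y => -q e y • U e y with hFdef
  have hF : ∀ e, IntegrableOn (F e) (Ioo 0 (l e)) := fun e =>
    integrableOn_potential' (hq e) (hqb e) (hS.wave e).continuousOn
  set u : Edge → ℝ → ℝ → ℝ := fun e => waveFun (l e) (p e) (r e) (F e) with hu
  have hreg : ∀ e, IsRegular (l e) T (u e) := fun e => isRegular_waveFun _ _ (hF e)
  have hcoe : ∀ e, ∀ x ∈ Icc 0 (l e), U e x =ᵐ[volume.restrict (Ioo 0 T)] u e x := fun e x hx => by
    rw [(hS.wave e).eq x hx]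
    exact coeFn_waveFun _ _ (hF e) x
  have huU : ∀ e, ∀ x ∈ Icc 0 (l e), (toH (u e x) : L2 0 T) = U e x := fun e x hx => by
    rw [← toH_congr (hcoe e x hx), toH_coe]
  have hmem : ∀ e v, MemLp (traceOf l U e v) 2 (volume.restrict (Ioo 0 T)) := fun e v => Lp.memLp _
  refine ⟨u, ?_⟩
  constructor
  · exact fun e => (hreg e).aestronglyMeasurable
  · exact fun e => (hreg e).memLp
  · exact fun e => (hreg e).continuous_time
  · intro e v _
    -- This representative agrees with U(x) at every position x of the edge, so the trace is a limit
    -- without exceptional null sets.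
    refine ⟨hmem e v, Tendsto.mono_left ?_ inf_le_left⟩
    have hp := pos_mem hl e v
    have h1 := tendsto_iff_edist_tendsto_0.1
      (((hS.wave e).continuousOn _ hp).mono_left (nhdsWithin_mono _ Ioo_subset_Icc_self))
    refine h1.congr' ?_
    filter_upwards [self_mem_nhdsWithin] with x hx
    have hx' := Ioo_subset_Icc_self hx
    rw [← huU e x hx', ← toH_coe (U e (pos l e v)),
      edist_toH ((Lp.memLp (U e x)).ae_eq (hcoe e x hx')) (Lp.memLp _)]
    rfl
  · rw [ae_mem_iff]
    have h1 : traceOf l U .e1 .v1 = (f : ℝ → ℝ) := by rw [← hS.bc_v1]; rfl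
    rw [h1]; exact (zeroExt_ae f).symm
  · rw [ae_mem_iff]
    have h1 : traceOf l U .e4 .v4 = ((0 : L2 0 T) : ℝ → ℝ) := by rw [← hS.bc_v4]; rfl
    rw [h1]; exact Lp.coeFn_zero ℝ 2 _
  · rw [ae_mem_iff]
    have h1 : traceOf l U .e2 .v2 = traceOf l U .e1 .v2 :=
      congrArg (fun a : L2 0 T => (a : ℝ → ℝ)) hS.dc_v2
    have h2 : traceOf l U .e3 .v2 = ((U .e1 0 + g : L2 0 T) : ℝ → ℝ) := by rw [← hS.dc_v2']; rfl
    filter_upwards [Lp.coeFn_add (U .e1 0) g, zeroExt_ae g] with t h3 h4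
    refine ⟨by rw [h1, sub_self], ?_⟩
    rw [h2, h3, h4]
    exact add_sub_cancel_left _ _
  · refine Eventually.of_forall fun t _ => ⟨?_, ?_⟩
    · exact congrArg (fun a : L2 0 T => (a : ℝ → ℝ) t) hS.dc_v3
    · exact congrArg (fun a : L2 0 T => (a : ℝ → ℝ) t) hS.dc_v3'
  · intro φ hφ
    rw [weak_iff hl hT hq hqb hreg (fun e v _ => hmem e v) hS.wave
      (fun e => ae_restrict_of_forall_mem measurableSet_Ioo fun x hx =>
        huU e x (Ioo_subset_Icc_self hx)) (fun e => by rw [traceOf, toH_coe, pos_tail])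
      (fun e => by rw [traceOf, toH_coe, pos_head]) hφ,
      hφ.sum_inner (fun e => U e 0 - (2 : ℝ) • p e) (fun e => U e (l e) - (2 : ℝ) • r e)]
    have h1 : U .e1 0 - (2 : ℝ) • p .e1 + (U .e2 0 - (2 : ℝ) • p .e2) +
        (U .e3 0 - (2 : ℝ) • p .e3) = 0 := by
      linear_combination (norm := module) hS.kirchhoff_v2
    have h2 : U .e2 (l .e2) - (2 : ℝ) • r .e2 + (U .e3 (l .e3) - (2 : ℝ) • r .e3) +
        (U .e4 0 - (2 : ℝ) • p .e4) = 0 := by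
      linear_combination (norm := module) hS.kirchhoff_v3
    rw [h1, h2, inner_zero_left, inner_zero_left, add_zero]

end WeakFormulation

/-! ### Completeness of the sine system. -/

section Sine

variable {l : ℝ} {E : Type*} [NormedAddCommGroup E] [NormedSpace ℝ E]

lemma integrableOn_continuous_smul {w : ℝ → E} (hw : IntegrableOn w (Ioo 0 l)) {c : ℝ → ℝ}
    (hc : Continuous c) : IntegrableOn (fun x => c x • w x) (Ioo 0 l) := by
  obtain ⟨C, hC⟩ := (isCompact_Icc (a := (0 : ℝ)) (b := l)).exists_bound_of_continuousOn
    hc.continuousOn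
  exact Integrable.bdd_smul hw C hc.aestronglyMeasurable
    (ae_restrict_of_forall_mem measurableSet_Ioo fun x hx => hC x (Ioo_subset_Icc_self hx))

/-- Induction on k, by 2 sin(nθ) cos θ = sin((n+1)θ) + sin((n-1)θ). -/
lemma integral_sin_mul_cos_pow_smul {w : ℝ → E} (hw : IntegrableOn w (Ioo 0 l))
    (c : ℝ) (h : ∀ n : ℕ, ∫ x in Ioo 0 l, Real.sin (n * (c * x)) • w x = 0) (k n : ℕ) :
    ∫ x in Ioo 0 l, (Real.sin (n * (c * x)) * Real.cos (c * x) ^ k) • w x = 0 := by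
  induction k generalizing n with
  | zero => simpa using h n
  | succ k ih =>
    rcases n with _ | m
    · simp
    have e1 : ∀ x, (Real.sin ((m + 1 : ℕ) * (c * x)) * Real.cos (c * x) ^ (k + 1)) • w x =
        (1 / 2 : ℝ) • ((Real.sin ((m + 2 : ℕ) * (c * x)) * Real.cos (c * x) ^ k) • w x) +
        (1 / 2 : ℝ) • ((Real.sin (m * (c * x)) * Real.cos (c * x) ^ k) • w x) := by
      intro x
      have h1 : ((m + 2 : ℕ) : ℝ) * (c * x) = ((m + 1 : ℕ) : ℝ) * (c * x) + c * x := by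
        push_cast; ring
      have h2 : (m : ℝ) * (c * x) = ((m + 1 : ℕ) : ℝ) * (c * x) - c * x := by push_cast; ring
      rw [h1, h2, Real.sin_add, Real.sin_sub]
      module
    have hI : ∀ n : ℕ, IntegrableOn
        (fun x => (Real.sin (n * (c * x)) * Real.cos (c * x) ^ k) • w x) (Ioo 0 l) := fun n =>
      integrableOn_continuous_smul hw (by fun_prop)
    have hI' : ∀ n : ℕ, IntegrableOn
        (fun x => (1 / 2 : ℝ) • ((Real.sin (n * (c * x)) * Real.cos (c * x) ^ k) • w x))
        (Ioo 0 l) := fun n => (hI n).smul (1 / 2 : ℝ)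
    simp only [e1]
    rw [integral_add (hI' (m + 2)) (hI' m), integral_smul,
      integral_smul, ih, ih]
    simp

lemma integral_sin_mul_polynomial_smul {w : ℝ → E} (hw : IntegrableOn w (Ioo 0 l))
    (c : ℝ) (h : ∀ n : ℕ, ∫ x in Ioo 0 l, Real.sin (n * (c * x)) • w x = 0) (P : Polynomial ℝ) :
    ∫ x in Ioo 0 l, (Real.sin (c * x) * P.eval (Real.cos (c * x))) • w x = 0 := by
  have hI : ∀ P : Polynomial ℝ, IntegrableOn
      (fun x => (Real.sin (c * x) * P.eval (Real.cos (c * x))) • w x) (Ioo 0 l) := fun P =>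
    integrableOn_continuous_smul hw (by fun_prop)
  induction P using Polynomial.induction_on' with
  | add P Q hP hQ =>
    simp only [Polynomial.eval_add, mul_add, add_smul]
    rw [integral_add (hI P) (hI Q), hP, hQ, add_zero]
  | monomial n a =>
    have h1 := integral_sin_mul_cos_pow_smul hw c h n 1
    simp only [Nat.cast_one, one_mul] at h1
    have e1 : ∀ x, (Real.sin (c * x) * (Polynomial.monomial n a).eval (Real.cos (c * x))) • w x =
        a • ((Real.sin (c * x) * Real.cos (c * x) ^ n) • w x) := fun x => by
      rw [Polynomial.eval_monomial]; module
    simp only [e1]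
    rw [integral_smul, h1, smul_zero]

/-- Completeness of the sine system on `(0, l)`. -/
lemma ae_eq_zero_of_integral_sin_smul [CompleteSpace E] (hl : 0 < l) {w : ℝ → E}
    (hw : IntegrableOn w (Ioo 0 l))
    (h : ∀ n : ℕ, ∫ x in Ioo 0 l, Real.sin (n * (Real.pi / l * x)) • w x = 0) :
    ∀ᵐ x ∂volume.restrict (Ioo 0 l), w x = 0 := by
  rw [ae_restrict_iff' measurableSet_Ioo]
  refine isOpen_Ioo.ae_eq_zero_of_integral_contDiff_smul_eq_zero hw.locallyIntegrableOn ?_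
  intro g hg _ hsupp
  have hpi := Real.pi_pos
  set c := Real.pi / l with hc
  have hsin : ∀ x ∈ Ioo 0 l, 0 < Real.sin (c * x) := fun x hx => by
    refine Real.sin_pos_of_pos_of_lt_pi (mul_pos (div_pos hpi hl) hx.1) ?_
    rw [hc, div_mul_eq_mul_div, div_lt_iff₀ hl]
    exact mul_lt_mul_of_pos_left hx.2 hpi
  -- A test function g has its support inside (0,l), where the sine is positive. Hence g/sin is
  -- continuous and, through `arccos`, a continuous function of cos(cx). Weierstrass approximation
  -- then replaces g by sin · P(cos), against which w integrates to zero.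
  have hG : Continuous fun x => g x / Real.sin (c * x) := by
    refine continuous_iff_continuousAt.2 fun x => ?_
    by_cases hx : x ∈ tsupport g
    · exact hg.continuous.continuousAt.div (by fun_prop) (hsin x (hsupp hx)).ne'
    · refine (continuousAt_const (y := (0 : ℝ))).congr ?_
      filter_upwards [notMem_tsupport_iff_eventuallyEq.1 hx] with y hy
      rw [hy, Pi.zero_apply, zero_div]
  set G : ℝ → ℝ := fun x => g x / Real.sin (c * x)
  have hG2 : Continuous fun y => G (Real.arccos y / c) :=
    hG.comp (Real.continuous_arccos.div_const c)
  have hzero : ∀ x ∉ Ioo 0 l, g x = 0 := fun x hx => by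
    by_contra h0
    exact hx (hsupp (subset_tsupport g h0))
  rw [← setIntegral_eq_integral_of_forall_compl_eq_zero (s := Ioo 0 l)
    (fun x hx => by rw [hzero x hx, zero_smul])]
  rw [← norm_le_zero_iff]
  refine le_of_forall_pos_le_add fun δ hδ => ?_
  set C := ∫ x in Ioo 0 l, ‖w x‖ with hC
  have hC0 : 0 ≤ C := integral_nonneg fun x => norm_nonneg _
  obtain ⟨P, hP⟩ := exists_polynomial_near_of_continuousOn (-1) 1 _ hG2.continuousOn
    (δ / (C + 1)) (by positivity)
  have e1 : ∫ x in Ioo 0 l, g x • w x =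
      ∫ x in Ioo 0 l, (g x - Real.sin (c * x) * P.eval (Real.cos (c * x))) • w x := by
    simp only [sub_smul]
    rw [integral_sub (integrableOn_continuous_smul hw hg.continuous)
      (integrableOn_continuous_smul hw (by fun_prop)),
      integral_sin_mul_polynomial_smul hw c h P, sub_zero]
  rw [e1, zero_add]
  calc _ ≤ ∫ x in Ioo 0 l, δ / (C + 1) * ‖w x‖ := by
        refine norm_integral_le_of_norm_le (hw.norm.const_mul _)
          (ae_restrict_of_forall_mem measurableSet_Ioo fun x hx => ?_)
        rw [norm_smul]
        refine mul_le_mul_of_nonneg_right ?_ (norm_nonneg _)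
        have h1 := hP (Real.cos (c * x)) ⟨Real.neg_one_le_cos _, Real.cos_le_one _⟩
        have hs := hsin x hx
        have h2 : Real.arccos (Real.cos (c * x)) / c = x := by
          rw [Real.arccos_cos (by positivity [hx.1]) ?_, mul_div_cancel_left₀ _ (by positivity)]
          rw [hc, div_mul_eq_mul_div, div_le_iff₀ hl]
          exact mul_le_mul_of_nonneg_left hx.2.le hpi.le
        rw [h2] at h1
        have h3 : g x - Real.sin (c * x) * P.eval (Real.cos (c * x)) =
            -(Real.sin (c * x) * (P.eval (Real.cos (c * x)) - G x)) := by
          have : Real.sin (c * x) * G x = g x := mul_div_cancel₀ _ hs.ne'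
          rw [mul_sub, this]; ring
        rw [h3, norm_neg, Real.norm_eq_abs, abs_mul]
        calc _ ≤ 1 * |P.eval (Real.cos (c * x)) - G x| :=
              mul_le_mul_of_nonneg_right (Real.abs_sin_le_one _) (abs_nonneg _)
          _ ≤ _ := by rw [one_mul]; exact h1.le
    _ = δ / (C + 1) * C := integral_const_mul _ _
    _ ≤ δ := by
        rw [div_mul_eq_mul_div, div_le_iff₀ (by positivity)]
        nlinarith

end Sine

/-! ### Test functions in time. -/

section Auxiliary

variable {T : ℝ}

lemma eq_zero_of_inner_toH {A : L2 0 T} (h : ∀ ψ : ℝ → ℝ, ContDiff ℝ ((⊤ : ℕ∞) : WithTop ℕ∞) ψ →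
    HasCompactSupport ψ → tsupport ψ ⊆ Ioo 0 T → inner ℝ A (toH ψ) = 0) : A = 0 := by
  have hA : IntegrableOn A (Ioo 0 T) := (Lp.memLp A).integrable (by norm_num)
  refine (Lp.eq_zero_iff_ae_eq_zero).2 ?_
  rw [EventuallyEq, ae_restrict_iff' measurableSet_Ioo]
  refine isOpen_Ioo.ae_eq_zero_of_integral_contDiff_smul_eq_zero hA.locallyIntegrableOn ?_
  intro g hg hgc hsupp
  refine Eq.trans ?_ (h g hg hgc hsupp)
  rw [inner_toH _ (memLp_of_continuous hg.continuous),
    ← setIntegral_eq_integral_of_forall_compl_eq_zero (s := Ioo 0 T)]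
  · simp only [smul_eq_mul, mul_comm]
  · intro x hx
    have : g x = 0 := by
      by_contra h0
      exact hx (hsupp (subset_tsupport g h0))
    rw [this, zero_smul]

/-- The harmonic oscillator with a force `ψ` and zero data at time `T`. -/
lemma exists_oscillator {ω : ℝ} (hω : ω ≠ 0) (T : ℝ) {ψ : ℝ → ℝ} (hψ : Continuous ψ) :
    ∃ k : ℝ → ℝ, ContDiff ℝ 2 k ∧ k T = 0 ∧ deriv k T = 0 ∧
      ∀ t, iteratedDeriv 2 k t + ω ^ 2 * k t = ψ t := by
  -- Variation of constants: k(t) is the integral of sin(ω(t-s)) ψ(s)/ω from T to t, split by the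
  -- addition theorem into C and S.
  set C : ℝ → ℝ := fun t => ∫ s in T..t, Real.cos (ω * s) * ψ s with hC
  set S : ℝ → ℝ := fun t => ∫ s in T..t, Real.sin (ω * s) * ψ s with hS
  have hCd : ∀ t, HasDerivAt C (Real.cos (ω * t) * ψ t) t := fun t =>
    (Continuous.integral_hasStrictDerivAt (by fun_prop) T t).hasDerivAt
  have hSd : ∀ t, HasDerivAt S (Real.sin (ω * t) * ψ t) t := fun t =>
    (Continuous.integral_hasStrictDerivAt (by fun_prop) T t).hasDerivAt
  have hlin : ∀ t, HasDerivAt (fun s => ω * s) ω t := fun t => by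
    simpa using (hasDerivAt_id t).const_mul ω
  have hsin : ∀ t, HasDerivAt (fun s => Real.sin (ω * s)) (Real.cos (ω * t) * ω) t := fun t =>
    (hlin t).sin
  have hcos : ∀ t, HasDerivAt (fun s => Real.cos (ω * s)) (-Real.sin (ω * t) * ω) t := fun t =>
    (hlin t).cos
  set k : ℝ → ℝ := fun t => (Real.sin (ω * t) * C t - Real.cos (ω * t) * S t) / ω with hk
  have hk1 : ∀ t, HasDerivAt k (Real.cos (ω * t) * C t + Real.sin (ω * t) * S t) t := fun t => by
    refine ((((hsin t).mul (hCd t)).sub ((hcos t).mul (hSd t))).div_const ω).congr_deriv ?_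
    field_simp
    ring
  have hd1 : deriv k = fun t => Real.cos (ω * t) * C t + Real.sin (ω * t) * S t :=
    funext fun t => (hk1 t).deriv
  have hk2 : ∀ t, HasDerivAt (deriv k) (ψ t - ω ^ 2 * k t) t := fun t => by
    rw [hd1]
    refine (((hcos t).mul (hCd t)).add ((hsin t).mul (hSd t))).congr_deriv ?_
    have h1 := Real.sin_sq_add_cos_sq (ω * t)
    have h2 : ω ^ 2 * k t = ω * (Real.sin (ω * t) * C t - Real.cos (ω * t) * S t) := by
      simp only [hk]
      field_simp
    rw [h2]
    linear_combination ψ t * h1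
  have hkc : Continuous k := continuous_iff_continuousAt.2 fun t => (hk1 t).continuousAt
  refine ⟨k, ?_, by simp [hk, hC, hS], by simp [hd1, hC, hS], fun t => ?_⟩
  · have h1 : ContDiff ℝ 1 (deriv k) := by
      refine contDiff_one_iff_deriv.2 ⟨fun t => (hk2 t).differentiableAt, ?_⟩
      have : deriv (deriv k) = fun t => ψ t - ω ^ 2 * k t := funext fun t => (hk2 t).deriv
      rw [this]
      fun_prop
    have h2 : ContDiff ℝ (1 + 1) k := contDiff_succ_iff_deriv.2
      ⟨fun t => (hk1 t).differentiableAt, fun h => absurd h (by decide), h1⟩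
    simpa [one_add_one_eq_two] using h2
  · rw [iteratedDeriv_succ, iteratedDeriv_one, (hk2 t).deriv]
    ring

end Auxiliary

/-! ### Weak solutions on an edge are waves. -/

section Representation

variable {T : ℝ}

/-- The emitted waves are determined from prescribed endpoint values, as a small system: the
coupling is the delay l > 0. -/
lemma exists_emitted_waves {l : ℝ} (hl : 0 < l) (a b : L2 0 T) :
    ∃ p r : L2 0 T, p + shift l r = a ∧ shift l p + r = b := by
  let S : L2 0 T →ₗ[ℝ] L2 0 T := (shift l).toLinearMap
  have hS : IsSmall S := isSmall_shift hl
  let N : Bool → (Bool → L2 0 T) →ₗ[ℝ] L2 0 T := fun i => -(S ∘ₗ LinearMap.proj (!i))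
  have hN : ∀ i, IsSmallOn (N i) := fun i => (hS.comp_proj (!i)).neg
  obtain ⟨o, ho⟩ := (exists_solution_of_isSmallOn hN).1 (fun i => if i then a else b)
  have h1 : o true = a + -shift l (o false) := ho true
  have h2 : o false = b + -shift l (o true) := ho false
  exact ⟨o true, o false, by linear_combination (norm := module) h1,
    by linear_combination (norm := module) h2⟩

lemma duhamel_congr_ae {l x : ℝ} {F F' : ℝ → L2 0 T} {κ : ℝ → ℝ → ℝ}
    (h : ∀ᵐ y ∂volume.restrict (Ioo 0 l), F y = F' y) : duhamel l κ F x = duhamel l κ F' x := by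
  rw [duhamel, duhamel]
  congr 1
  refine integral_congr_ae ?_
  filter_upwards [h] with y hy
  rw [hy]

/-- The test functions `sin (a x) k(t)`. -/
lemma hasZeroFinal_sin_mul (l a : ℝ) {k : ℝ → ℝ} (hk : ContDiff ℝ 2 k) (hkT : k T = 0)
    (hkT' : deriv k T = 0) : HasZeroFinal l T fun x t => Real.sin (a * x) * k t := by
  refine ⟨?_, fun x _ => by rw [hkT, mul_zero], fun x _ => ?_⟩
  · exact (Real.contDiff_sin.comp (contDiff_const.mul contDiff_fst)).mul (hk.comp contDiff_snd)
  · rw [dt, deriv_const_mul _ (hk.differentiable (by norm_num) T), hkT', mul_zero]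

lemma box_sin_mul (a : ℝ) {k ψ : ℝ → ℝ} (hk : ContDiff ℝ 2 k)
    (hψ : ∀ t, iteratedDeriv 2 k t + a ^ 2 * k t = ψ t) (x t : ℝ) :
    box (fun x t => Real.sin (a * x) * k t) x t = Real.sin (a * x) * ψ t := by
  have hlin : ∀ y, HasDerivAt (fun s => a * s) a y := fun y => by
    simpa using (hasDerivAt_id y).const_mul a
  have h1 : deriv (fun y => Real.sin (a * y) * k t) = fun y => Real.cos (a * y) * a * k t :=
    funext fun y => ((hlin y).sin.mul_const (k t)).deriv
  have h2 : deriv (fun y => Real.cos (a * y) * a * k t) x = -Real.sin (a * x) * a * a * k t :=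
    (((hlin x).cos.mul_const a).mul_const (k t)).deriv
  have hk' : ContDiff ℝ 1 (deriv k) := hk.deriv' (n := 1)
  have h3 : deriv (fun s => Real.sin (a * x) * k s) = fun s => Real.sin (a * x) * deriv k s :=
    funext fun s => deriv_const_mul _ (hk.differentiable (by norm_num) s)
  have h4 : deriv (fun s => Real.sin (a * x) * deriv k s) t = Real.sin (a * x) * deriv (deriv k) t :=
    deriv_const_mul _ (hk'.differentiable (by norm_num) t)
  have h5 := hψ t
  rw [iteratedDeriv_succ, iteratedDeriv_one] at h5
  rw [box, iteratedDeriv_succ, iteratedDeriv_one, iteratedDeriv_succ, iteratedDeriv_one, h3, h4, h1,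
    h2, ← h5]
  ring

/-- A weak solution on an edge and the wave with the same boundary values have the same sine
coefficients. -/
lemma IsRegular.integral_sin_smul_sub {l : ℝ} {u : ℝ → ℝ → ℝ} {q : ℝ → ℝ} (hu : IsRegular l T u)
    (hl : 0 < l) (hT : 0 < T) (hq : ContinuousOn q (Ioo 0 l))
    (hQ : ∃ Q, ∀ x ∈ Ioo 0 l, |q x| ≤ Q) {p r : L2 0 T} {V : ℝ → L2 0 T}
    (hF : IntegrableOn (fun x => -q x • (toH (u x) : L2 0 T)) (Ioo 0 l))
    (hV : ∀ x ∈ Icc 0 l, V x = shift x p + shift (l - x) r +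
      duhamel l (fun x y => |x - y|) (fun x => -q x • (toH (u x) : L2 0 T)) x)
    (hVI : IntegrableOn V (Ioo 0 l))
    (hweak : ∀ φ, HasZeroFinal l T φ → (∀ t, φ 0 t = 0) → (∀ t, φ l t = 0) →
      ∫ t in (0 : ℝ)..T, ∫ x in (0 : ℝ)..l, u x t * (box φ x t + q x * φ x t) =
        inner ℝ (V 0) (toH (dx φ 0)) - inner ℝ (V l) (toH (dx φ l))) (n : ℕ) :
    ∫ x in Ioo 0 l, Real.sin (n * (Real.pi / l * x)) • (toH (u x) - V x) = 0 := by
  rcases Nat.eq_zero_or_pos n with rfl | hn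
  · simp
  have hn' : (0 : ℝ) < n := Nat.cast_pos.2 hn
  set ω := n * (Real.pi / l) with hω
  have hω0 : ω ≠ 0 := by have := Real.pi_pos; positivity
  simp only [← mul_assoc, ← hω]
  refine eq_zero_of_inner_toH fun ψ hψ _ _ => ?_
  -- The frequency is that of the n-th sine, so that the wave operator maps sin(ωx) k(t) to sin(ωx)
  -- ψ(t).
  obtain ⟨k, hk, hkT, hkT', hkψ⟩ := exists_oscillator hω0 T hψ.continuous
  set φ : ℝ → ℝ → ℝ := fun x t => Real.sin (ω * x) * k t with hφdef
  have hφ : HasZeroFinal l T φ := hasZeroFinal_sin_mul l ω hk hkT hkT'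
  have hφ0 : ∀ t, φ 0 t = 0 := fun t => by simp [hφdef]
  have hφl : ∀ t, φ l t = 0 := fun t => by
    have : ω * l = n * Real.pi := by rw [hω]; field_simp
    simp only [hφdef, this, Real.sin_nat_mul_pi, zero_mul]
  have hdt : ∀ x, (∀ t, φ x t = 0) → (toH (dt φ x) : L2 0 T) = 0 := fun x hx => by
    have h0 : dt φ x = fun t => 0 * (0 : ℝ) := by
      funext t
      have : φ x = fun _ => 0 := funext hx
      rw [dt, this, deriv_const, zero_mul]
    rw [h0, toH_smul (memLp_of_continuous continuous_const), zero_smul]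
  have g1 := hweak φ hφ hφ0 hφl
  rw [hu.integral_waveOp hl hT hq hQ hφ.contDiff] at g1
  have g2 := integral_inner_wave hT.le hl hφ hF hV
  rw [hdt 0 hφ0, hdt l hφl, inner_zero_right, inner_zero_right] at g2
  -- V has the source -qu, with u itself. Therefore the potential terms in the two identities are
  -- the same and cancel in the difference.
  have g3 : ∫ y in Ioo 0 l, inner ℝ (-q y • (toH (u y) : L2 0 T)) (toH (φ y)) =
      -∫ x in Ioo 0 l, inner ℝ (q x • toH (u x) : L2 0 T) (toH (φ x)) := by
    rw [← integral_neg]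
    simp only [neg_smul, inner_neg_left]
  have hbox : ∀ x, (toH (box φ x) : L2 0 T) = Real.sin (ω * x) • toH ψ := fun x => by
    have : box φ x = fun t => Real.sin (ω * x) * ψ t :=
      funext fun t => box_sin_mul ω hk hkψ x t
    rw [this, toH_smul (memLp_of_continuous hψ.continuous)]
  have hw : IntegrableOn (fun x => toH (u x) - V x) (Ioo 0 l) := hu.integrableOn_toH.sub hVI
  have hI := integrableOn_continuous_smul hw (c := fun x => Real.sin (ω * x)) (by fun_prop)
  have hI1 := (integrableOn_continuous_smul hu.integrableOn_toH (c := fun x => Real.sin (ω * x))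
    (by fun_prop)).inner_const (𝕜 := ℝ) (toH ψ : L2 0 T)
  have hI2 := (integrableOn_continuous_smul hVI (c := fun x => Real.sin (ω * x))
    (by fun_prop)).inner_const (𝕜 := ℝ) (toH ψ : L2 0 T)
  have e1 : inner ℝ (∫ x in Ioo 0 l, Real.sin (ω * x) • (toH (u x) - V x)) (toH ψ) =
      ∫ x in Ioo 0 l, inner ℝ (Real.sin (ω * x) • (toH (u x) - V x)) (toH ψ : L2 0 T) := by
    rw [real_inner_comm, ← integral_inner hI]
    simp only [real_inner_comm (toH ψ : L2 0 T)]
  have e2 : ∀ x, inner ℝ (Real.sin (ω * x) • (toH (u x) - V x)) (toH ψ : L2 0 T) =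
      inner ℝ (Real.sin (ω * x) • toH (u x) : L2 0 T) (toH ψ : L2 0 T) -
        inner ℝ (Real.sin (ω * x) • V x) (toH ψ : L2 0 T) := fun x => by
    rw [smul_sub, inner_sub_left]
  have e3 : ∀ (h : L2 0 T) x, inner ℝ h (toH (box φ x)) =
      inner ℝ (Real.sin (ω * x) • h) (toH ψ : L2 0 T) := fun h x => by
    rw [hbox, inner_smul_left, inner_smul_right]; rfl
  simp only [e3] at g1 g2
  simp only [e1, e2]
  rw [integral_sub hI1 hI2]
  linarith

/-- Weak solutions on an edge are waves. -/
lemma IsRegular.exists_isEdgeWave {l : ℝ} {u : ℝ → ℝ → ℝ} {q : ℝ → ℝ} (hu : IsRegular l T u)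
    (hl : 0 < l) (hT : 0 < T) (hq : ContinuousOn q (Ioo 0 l))
    (hQ : ∃ Q, ∀ x ∈ Ioo 0 l, |q x| ≤ Q) {a b : L2 0 T}
    (hweak : ∀ φ, HasZeroFinal l T φ → (∀ t, φ 0 t = 0) → (∀ t, φ l t = 0) →
      ∫ t in (0 : ℝ)..T, ∫ x in (0 : ℝ)..l, u x t * (box φ x t + q x * φ x t) =
        inner ℝ a (toH (dx φ 0)) - inner ℝ b (toH (dx φ l))) :
    ∃ p r U, IsEdgeWave l q p r U ∧ U 0 = a ∧ U l = b ∧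
      ∀ᵐ x ∂volume.restrict (Ioo 0 l), (toH (u x) : L2 0 T) = U x := by
  -- The source is formed with u, so V is given explicitly. Only after u = V has been shown does its
  -- formula become the edge wave equation for V.
  obtain ⟨F, hFdef⟩ : ∃ F : ℝ → L2 0 T, F = fun x => -q x • toH (u x) := ⟨_, rfl⟩
  have hF : IntegrableOn F (Ioo 0 l) := by
    obtain ⟨Q, hQ⟩ := hQ
    rw [hFdef]
    exact Integrable.bdd_smul hu.integrableOn_toH Q
      (hq.neg.aestronglyMeasurable measurableSet_Ioo)
      (ae_restrict_of_forall_mem measurableSet_Ioo fun x hx => by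
        change ‖-q x‖ ≤ Q; rw [norm_neg]; exact hQ x hx)
  have hDc := continuous_duhamel continuous_dist_kernel hF
  obtain ⟨D, hD⟩ : ∃ D, D = duhamel l (fun x y => |x - y|) F := ⟨_, rfl⟩
  rw [← hD] at hDc
  obtain ⟨p, r, hp, hr⟩ := exists_emitted_waves hl (a - D 0) (b - D l)
  obtain ⟨V, hV⟩ : ∃ V : ℝ → L2 0 T, V = fun x => shift x p + shift (l - x) r + D x := ⟨_, rfl⟩
  have hVc : Continuous V := by
    rw [hV]
    refine (Continuous.add ?_ ?_).add hDc
    · exact continuous_shift.comp (g := fun a : ℝ × L2 0 T => shift a.1 a.2)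
        (f := fun x : ℝ => (x, p)) (by fun_prop)
    · exact continuous_shift.comp (g := fun a : ℝ × L2 0 T => shift a.1 a.2)
        (f := fun x : ℝ => (l - x, r)) (by fun_prop)
  have hV0 : V 0 = a := by
    simp only [hV, shift_zero, sub_zero, hp]; abel
  have hVl : V l = b := by
    simp only [hV, shift_zero, sub_self, hr]; abel
  have hVI : IntegrableOn V (Ioo 0 l) :=
    (hVc.integrableOn_Icc).mono_set Ioo_subset_Icc_self
  have horth := hu.integral_sin_smul_sub hl hT hq hQ (hFdef ▸ hF) (V := V)
    (fun x _ => by rw [hV, hD, hFdef]) hVI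
    (by rw [hV0, hVl]; exact hweak)
  have huV : ∀ᵐ x ∂volume.restrict (Ioo 0 l), (toH (u x) : L2 0 T) = V x := by
    filter_upwards [ae_eq_zero_of_integral_sin_smul hl
      (hu.integrableOn_toH.sub hVI) horth] with x hx
    exact sub_eq_zero.1 hx
  refine ⟨p, r, V, ⟨hVc.continuousOn, fun x _ => ?_⟩, hV0, hVl, huV⟩
  have hVx : V x = shift x p + shift (l - x) r + D x := by rw [hV]
  rw [hVx, hD]
  refine congrArg (fun h => shift x p + shift (l - x) r + h) (duhamel_congr_ae ?_)
  filter_upwards [huV] with y hy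
  simp only [hFdef, hy]

end Representation

/-! ### Generalized solutions come from systems of waves. -/

section Uniqueness

variable {T : ℝ} {l : Edge → ℝ} {q : Edge → ℝ → ℝ} {f g : ℝ → ℝ} {u : Edge → ℝ → ℝ → ℝ}
  {tr : Edge → Vertex → ℝ → ℝ}

lemma IsGeneralizedSolution.isRegular (h : IsGeneralizedSolution l q T f g u tr) (e : Edge) :
    IsRegular (l e) T (u e) :=
  ⟨h.aestronglyMeasurable e, h.memLp e, h.continuous_time e⟩

lemma pos_eq_or (l : Edge → ℝ) (e : Edge) (v : Vertex) : pos l e v = 0 ∨ pos l e v = l e := by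
  unfold pos
  split_ifs
  exacts [Or.inl rfl, Or.inr rfl]

/-- Test functions that are supported on a single edge. -/
lemma isTestFunction_single (e : Edge) {φ : ℝ → ℝ → ℝ} (hφ : HasZeroFinal (l e) T φ)
    (h0 : ∀ t, φ 0 t = 0) (h1 : ∀ t, φ (l e) t = 0) :
    IsTestFunction l T fun e' x t => if e' = e then φ x t else 0 := by
  have hv : ∀ v e' t, (if e' = e then φ (pos l e' v) t else 0) = 0 := by
    intro v e' t
    split_ifs with h
    · subst h
      rcases pos_eq_or l e' v with hp | hp <;> rw [hp]
      exacts [h0 t, h1 t]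
    · rfl
  refine ⟨fun e' => ?_, fun v e' e'' _ _ t _ => ?_, fun v e' _ _ t _ => hv v e' t,
    fun e' x hx => ?_, fun e' x hx => ?_⟩
  · by_cases h : e' = e
    · simpa only [if_pos h] using hφ.contDiff
    · simpa only [if_neg h] using contDiff_const
  · rw [hv, hv]
  · split_ifs with h
    · subst h; exact hφ.final x hx
    · rfl
  · by_cases h : e' = e
    · subst h
      simp only [if_true]
      exact hφ.final_dt x hx
    · simp only [if_neg h, deriv_const]

/-- A test function that vanishes at both ends of one edge can be extended by zero to the graph: no
condition is imposed on its derivatives at the vertices. -/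
lemma IsGeneralizedSolution.weak_edge (h : IsGeneralizedSolution l q T f g u tr) (hT : 0 < T)
    (e : Edge) {φ : ℝ → ℝ → ℝ} (hφ : HasZeroFinal (l e) T φ)
    (h0 : ∀ t, φ 0 t = 0) (h1 : ∀ t, φ (l e) t = 0) :
    ∫ t in (0 : ℝ)..T, ∫ x in (0 : ℝ)..l e, u e x t * (box φ x t + q e x * φ x t) =
      inner ℝ (toH (tr e e.tail) : L2 0 T) (toH (dx φ 0)) -
        inner ℝ (toH (tr e e.head) : L2 0 T) (toH (dx φ (l e))) := by
  have hw := h.weak _ (isTestFunction_single e hφ h0 h1)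
  have hdx := continuous_dx hφ.contDiff
  rw [Finset.sum_eq_single e, Finset.sum_eq_single e] at hw
  · have e1 : ∀ x t, waveOp q (fun e' x t => if e' = e then φ x t else 0) e x t =
        box φ x t + q e x * φ x t := fun x t => by simp only [waveOp, if_true, box]
    have e2 : ∀ t, outDeriv l (fun e' x t => if e' = e then φ x t else 0) e e.tail t =
        dx φ 0 t := fun t => by simp only [outDeriv, if_true, dx]
    have e3 : ∀ t, outDeriv l (fun e' x t => if e' = e then φ x t else 0) e e.head t =
        -dx φ (l e) t := fun t => by
      simp only [outDeriv, if_true, dx, if_neg e.head_ne_tail]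
    simp only [e1, e2, e3, mul_neg, intervalIntegral.integral_neg] at hw
    rw [hw, integral_mul_eq_inner hT (h.hasTrace e _ (Or.inl rfl)).1 (continuous_fst_toH hdx 0),
      integral_mul_eq_inner hT (h.hasTrace e _ (Or.inr rfl)).1 (continuous_fst_toH hdx (l e)),
      sub_eq_add_neg]
  · intro e' _ he'
    simp [outDeriv, he']
  · exact fun he => absurd (Finset.mem_univ e) he
  · intro e' _ he'
    have e1 : ∀ x t, waveOp q (fun e' x t => if e' = e then φ x t else 0) e' x t = 0 :=
      fun x t => by
        simp only [waveOp, if_neg he', iteratedDeriv_succ, iteratedDeriv_zero, mul_zero]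
        simp
    simp [e1]
  · exact fun he => absurd (Finset.mem_univ e) he

/-- Test functions with prescribed values at the vertices. -/
lemma isTestFunction_affine (hl : ∀ e, 0 < l e) {c : Vertex → ℝ} (h1 : c .v1 = 0) (h4 : c .v4 = 0)
    {k : ℝ → ℝ} (hk : ContDiff ℝ 2 k) (hkT : k T = 0) (hkT' : deriv k T = 0) :
    IsTestFunction l T fun e x t =>
      (c e.tail + (c e.head - c e.tail) / l e * x) * k t := by
  have hv : ∀ e v, Incident e v →
      c e.tail + (c e.head - c e.tail) / l e * pos l e v = c v := by
    rintro e v (rfl | rfl)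
    · rw [pos_tail, mul_zero, add_zero]
    · rw [pos_head, div_mul_cancel₀ _ (hl e).ne', add_sub_cancel]
  refine ⟨fun e => ?_, fun v e e' he he' t _ => ?_, fun v e hb he t _ => ?_,
    fun e x _ => by rw [hkT, mul_zero], fun e x _ => ?_⟩
  · exact (contDiff_const.add (contDiff_const.mul contDiff_fst)).mul (hk.comp contDiff_snd)
  · rw [hv e v he, hv e' v he']
  · rw [hv e v he]
    rcases hb with rfl | rfl
    · rw [h1, zero_mul]
    · rw [h4, zero_mul]
  · rw [deriv_const_mul _ (hk.differentiable (by norm_num) T), hkT', mul_zero]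

lemma exists_primitive (T : ℝ) {ψ : ℝ → ℝ} (hψ : ContDiff ℝ 1 ψ) :
    ∃ k : ℝ → ℝ, ContDiff ℝ 2 k ∧ k T = 0 ∧ deriv k = ψ := by
  have hd : ∀ t, HasDerivAt (fun t => ∫ s in T..t, ψ s) (ψ t) t := fun t =>
    (Continuous.integral_hasStrictDerivAt hψ.continuous T t).hasDerivAt
  have h1 : deriv (fun t => ∫ s in T..t, ψ s) = ψ := funext fun t => (hd t).deriv
  refine ⟨fun t => ∫ s in T..t, ψ s, ?_, by simp, h1⟩
  have h2 : ContDiff ℝ (1 + 1) fun t => ∫ s in T..t, ψ s := contDiff_succ_iff_deriv.2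
    ⟨fun t => (hd t).differentiableAt, fun h => absurd h (by decide), by rwa [h1]⟩
  simpa [one_add_one_eq_two] using h2

lemma toH_eq_of_ae_eq {a b : ℝ → ℝ} (h : ∀ᵐ t, t ∈ Ioo 0 T → a t = b t) :
    (toH a : L2 0 T) = toH b := toH_congr (ae_mem_iff.1 h)

/-- Every generalized solution is given by a system of waves. -/
lemma IsGeneralizedSolution.exists_isSystem (hl : ∀ e, 0 < l e) (hT : 0 < T)
    (hq : ∀ e, ContinuousOn (q e) (Ioo 0 (l e)))
    (hqb : ∀ e, ∃ M, ∀ x ∈ Ioo 0 (l e), |q e x| ≤ M)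
    (hg : MemLp g 2 (volume.restrict (Ioo 0 T))) (h : IsGeneralizedSolution l q T f g u tr) :
    ∃ p r U, IsSystem l q (toH f) (toH g) p r U ∧
      (∀ e, ∀ᵐ x ∂volume.restrict (Ioo 0 (l e)), (toH (u e x) : L2 0 T) = U e x) ∧
      ∀ e v, Incident e v → toH (tr e v) = U e (pos l e v) := by
  have htr : ∀ e v, Incident e v → MemLp (tr e v) 2 (volume.restrict (Ioo 0 T)) :=
    fun e v hv => (h.hasTrace e v hv).1
  choose p r U hU h0 h1 hae using fun e => (h.isRegular e).exists_isEdgeWave (hl e) hT (hq e) (hqb e)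
    fun φ hφ hφ0 hφl => h.weak_edge hT e hφ hφ0 hφl
  -- The tests are affine on each edge with prescribed vertex values c, times a primitive k of ψ;
  -- thus φ_t = c ψ at the vertices. Choosing c at v2 and v3 independently separates the two
  -- Kirchhoff conditions.
  have hkir : ∀ c : Vertex → ℝ, c .v1 = 0 → c .v4 = 0 → ∀ ψ : ℝ → ℝ,
      ContDiff ℝ ((⊤ : ℕ∞) : WithTop ℕ∞) ψ → tsupport ψ ⊆ Ioo 0 T →
      c .v2 * inner ℝ (U .e1 0 - (2 : ℝ) • p .e1 + (U .e2 0 - (2 : ℝ) • p .e2) +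
        (U .e3 0 - (2 : ℝ) • p .e3)) (toH ψ) +
      c .v3 * inner ℝ (U .e2 (l .e2) - (2 : ℝ) • r .e2 + (U .e3 (l .e3) - (2 : ℝ) • r .e3) +
        (U .e4 0 - (2 : ℝ) • p .e4)) (toH ψ) = 0 := by
    intro c hc1 hc4 ψ hψ hsupp
    obtain ⟨k, hk, hkT, hkd⟩ := exists_primitive T (hψ.of_le (by exact_mod_cast le_top))
    -- The support of ψ lies in the open interval, so ψ(T) = 0.
    have hψT : deriv k T = 0 := by
      rw [hkd]
      by_contra hne
      exact lt_irrefl T (hsupp (subset_tsupport ψ hne)).2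
    have hφ := isTestFunction_affine (T := T) hl hc1 hc4 hk hkT hψT
    have hw := (weak_iff hl hT hq hqb h.isRegular htr hU hae (fun e => (h0 e).symm)
      (fun e => (h1 e).symm) hφ).1 (h.weak _ hφ)
    rw [hφ.sum_inner (fun e => U e 0 - (2 : ℝ) • p e) (fun e => U e (l e) - (2 : ℝ) • r e)] at hw
    have e1 : ∀ e : Edge, (toH (dt (fun x t =>
        (c e.tail + (c e.head - c e.tail) / l e * x) * k t) 0) : L2 0 T) = c e.tail • toH ψ := by
      intro e
      rw [← toH_smul (memLp_of_continuous hψ.continuous)]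
      congr 1
      funext t
      rw [dt, deriv_const_mul _ (hk.differentiable (by norm_num) t), hkd, mul_zero, add_zero]
    rw [e1, e1, inner_smul_right, inner_smul_right] at hw
    exact hw
  have k2 : U .e1 0 - (2 : ℝ) • p .e1 + (U .e2 0 - (2 : ℝ) • p .e2) +
      (U .e3 0 - (2 : ℝ) • p .e3) = 0 := by
    refine eq_zero_of_inner_toH fun ψ hψ _ hs => ?_
    simpa using hkir (fun v => if v = .v2 then 1 else 0) (by simp) (by simp) ψ hψ hs
  have k3 : U .e2 (l .e2) - (2 : ℝ) • r .e2 + (U .e3 (l .e3) - (2 : ℝ) • r .e3) +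
      (U .e4 0 - (2 : ℝ) • p .e4) = 0 := by
    refine eq_zero_of_inner_toH fun ψ hψ _ hs => ?_
    simpa using hkir (fun v => if v = .v3 then 1 else 0) (by simp) (by simp) ψ hψ hs
  have m1 := htr .e1 Edge.e1.tail (Or.inl rfl)
  refine ⟨p, r, U, ⟨hU, ?_, ?_, ?_, ?_, ?_, ?_, ?_, ?_⟩, hae, ?_⟩
  · rw [h1]; exact toH_eq_of_ae_eq h.bc_v1
  · rw [h1, toH_eq_of_ae_eq (a := tr .e4 Edge.e4.head) (b := fun t => 0 * (0 : ℝ)) (by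
      simp only [mul_zero]; exact h.bc_v4), toH_smul (memLp_of_continuous continuous_const), zero_smul]
  · rw [h0, h0]
    refine toH_eq_of_ae_eq ?_
    filter_upwards [h.dc_v2] with t ht ht'
    exact sub_eq_zero.1 (ht ht').1
  · rw [h0, h0, ← toH_add m1 hg]
    refine toH_eq_of_ae_eq ?_
    filter_upwards [h.dc_v2] with t ht ht'
    rw [← (ht ht').2]
    exact (add_sub_cancel _ _).symm
  · rw [h1, h1]
    refine toH_eq_of_ae_eq ?_
    filter_upwards [h.dc_v3] with t ht ht'
    exact (ht ht').1
  · rw [h1, h0]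
    refine toH_eq_of_ae_eq ?_
    filter_upwards [h.dc_v3] with t ht ht'
    exact (ht ht').2
  · linear_combination (norm := module) k2
  · linear_combination (norm := module) k3
  · rintro e v (rfl | rfl)
    · rw [pos_tail, h0]
    · rw [pos_head, h1]

end Uniqueness

/-! ### Well-posedness and the matching condition. -/

section WellPosed

variable {T : ℝ} {l : Edge → ℝ} {q : Edge → ℝ → ℝ}

lemma IsSystem.neg_add (hq : ∀ e, ContinuousOn (q e) (Ioo 0 (l e)))
    (hqb : ∀ e, ∃ M, ∀ x ∈ Ioo 0 (l e), |q e x| ≤ M) {f g g' : L2 0 T}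
    {p r p' r' : Edge → L2 0 T} {U U' : Edge → ℝ → L2 0 T} (h : IsSystem l q f g p r U)
    (h' : IsSystem l q f g' p' r' U') :
    IsSystem l q 0 (g + (-1 : ℝ) • g') (p + (-1 : ℝ) • p') (r + (-1 : ℝ) • r')
      (fun e x => U e x + (-1 : ℝ) • U' e x) := by
  have h1 := h.add hq hqb (h'.smul (-1))
  have h2 : f + (-1 : ℝ) • f = 0 := by module
  rwa [h2] at h1

/-- The difference of the systems is homogeneous, so all emitted waves agree, and these determine
the waves on the edges. -/
lemma IsSystem.eqOn (R : ∀ e, EdgeResponse T (l e) (q e))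
    (hq : ∀ e, ContinuousOn (q e) (Ioo 0 (l e)))
    (hqb : ∀ e, ∃ M, ∀ x ∈ Ioo 0 (l e), |q e x| ≤ M) {f g g' : L2 0 T}
    {p r p' r' : Edge → L2 0 T} {U U' : Edge → ℝ → L2 0 T} (h : IsSystem l q f g p r U)
    (h' : IsSystem l q f g' p' r' U') (hg : g = g' ∨ U .e3 0 = U' .e3 0) (e : Edge) :
    EqOn (U e) (U' e) (Icc 0 (l e)) := by
  obtain ⟨hp, hr⟩ := (h.neg_add hq hqb h').eq_zero R (hg.imp
    (fun h => by rw [h]; module) (fun h => by simp only [h]; module))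
  have hp' : p = p' := by linear_combination (norm := module) hp
  have hr' : r = r' := by linear_combination (norm := module) hr
  subst hp' hr'
  exact (R e).unique (h.wave e) (h'.wave e)

lemma ae_ae_eq_zero_swap {α β : Type*} [MeasurableSpace α] [MeasurableSpace β] {μ : Measure α}
    {ν : Measure β} [SFinite μ] [SFinite ν] {w : α × β → ℝ}
    (hw : AEStronglyMeasurable w (μ.prod ν)) (h : ∀ᵐ x ∂μ, ∀ᵐ t ∂ν, w (x, t) = 0) :
    ∀ᵐ t ∂ν, ∀ᵐ x ∂μ, w (x, t) = 0 := by
  obtain ⟨w', hw', hww⟩ := hw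
  have h1 : ∀ᵐ x ∂μ, ∀ᵐ t ∂ν, w' (x, t) = 0 := by
    filter_upwards [h, Measure.ae_ae_of_ae_prod hww] with x h1 h2
    filter_upwards [h1, h2] with t h3 h4
    rw [← h4, h3]
  have h2 : ∀ᵐ p ∂μ.prod ν, w' p = 0 :=
    (Measure.ae_prod_iff_ae_ae (hw'.measurable (measurableSet_singleton 0))).2 h1
  have h3 : ∀ᵐ p ∂μ.prod ν, w p = 0 := by
    filter_upwards [hww, h2] with p h4 h5
    rw [h4, h5]
  exact Measure.ae_ae_of_ae_prod
    ((Measure.measurePreserving_swap (μ := ν) (ν := μ)).quasiMeasurePreserving.ae h3)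

/-- Fubini gives equality in x for almost every t, and continuity in time extends it to every t in
[0,T]. -/
lemma IsRegular.ae_eq_of_toH_eq {L : ℝ} {u u' : ℝ → ℝ → ℝ} (hT : 0 < T) (hu : IsRegular L T u)
    (hu' : IsRegular L T u')
    (h : ∀ᵐ x ∂volume.restrict (Ioo 0 L), (toH (u x) : L2 0 T) = toH (u' x)) :
    ∀ t ∈ Icc 0 T, ∀ᵐ x ∂volume.restrict (Ioo 0 L), u x t = u' x t := by
  have h1 : ∀ᵐ x ∂volume.restrict (Ioo 0 L), ∀ᵐ t ∂volume.restrict (Ioo 0 T),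
      u x t - u' x t = 0 := by
    filter_upwards [h, hu.ae_coeFn_toH, hu'.ae_coeFn_toH] with x h2 h3 h4
    rw [h2] at h3
    filter_upwards [h3, h4] with t h5 h6
    rw [← h5, ← h6, sub_self]
  have h2 := ae_ae_eq_zero_swap (w := fun p : ℝ × ℝ => u p.1 p.2 - u' p.1 p.2)
    (hu.aestronglyMeasurable.sub hu'.aestronglyMeasurable) h1
  have h3 : (fun t => (toH (fun x => u x t) : L2 0 L)) =ᵐ[volume.restrict (Icc 0 T)]
      fun t => toH (fun x => u' x t) := by
    rw [← restrict_Ioo_eq_restrict_Icc]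
    filter_upwards [h2] with t ht
    refine toH_congr ?_
    filter_upwards [ht] with x hx using sub_eq_zero.1 hx
  have h4 := Measure.eqOn_Icc_of_ae_eq volume hT.ne h3 hu.continuousOn hu'.continuousOn
  intro t ht
  have h5 : (toH (fun x => u x t) : L2 0 L) = toH (fun x => u' x t) := h4 ht
  have h6 := coeFn_toH (hu.memLp t ht)
  rw [h5] at h6
  filter_upwards [h6, coeFn_toH (hu'.memLp t ht)] with x h7 h8
  rw [← h7, ← h8]

lemma memLp_zeroExt_restrict {a b : ℝ} (h : L2 a b) :
    MemLp (zeroExt h) 2 (volume.restrict (Ioo 0 T)) := (memLp_zeroExt h).restrict _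

lemma toH_zeroExt (h : L2 0 T) : toH (zeroExt h) = h := by
  rw [toH_congr (zeroExt_ae h), toH_coe]

lemma zeroExt_toH {ψ : ℝ → ℝ} (hψ : MemLp ψ 2 (volume.restrict (Ioo 0 T))) :
    ∀ᵐ t, t ∈ Ioo 0 T → zeroExt (toH ψ : L2 0 T) t = ψ t :=
  ae_mem_iff.2 ((zeroExt_ae _).trans (coeFn_toH hψ))

lemma IsGeneralizedSolution.congr {f f' g g' : ℝ → ℝ} {u : Edge → ℝ → ℝ → ℝ}
    {tr : Edge → Vertex → ℝ → ℝ} (h : IsGeneralizedSolution l q T f g u tr)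
    (hf : ∀ᵐ t, t ∈ Ioo 0 T → f t = f' t) (hg : ∀ᵐ t, t ∈ Ioo 0 T → g t = g' t) :
    IsGeneralizedSolution l q T f' g' u tr :=
  { h with
    bc_v1 := by
      filter_upwards [h.bc_v1, hf] with t h1 h2 ht
      rw [h1 ht, h2 ht]
    dc_v2 := by
      filter_upwards [h.dc_v2, hg] with t h1 h2 ht
      exact ⟨(h1 ht).1, by rw [(h1 ht).2, h2 ht]⟩ }

/-- A system of waves determines the boundary values of the generalized solution. -/
lemma IsSystem.isVertexValue (hl : ∀ e, 0 < l e) (hT : 0 < T)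
    (hq : ∀ e, ContinuousOn (q e) (Ioo 0 (l e)))
    (hqb : ∀ e, ∃ M, ∀ x ∈ Ioo 0 (l e), |q e x| ≤ M) {f g a : ℝ → ℝ}
    (hf : MemLp f 2 (volume.restrict (Ioo 0 T))) (hg : MemLp g 2 (volume.restrict (Ioo 0 T)))
    {p r : Edge → L2 0 T} {U : Edge → ℝ → L2 0 T} (h : IsSystem l q (toH f) (toH g) p r U)
    {e : Edge} {v : Vertex} (ha : U e (pos l e v) =ᵐ[volume.restrict (Ioo 0 T)] a) :
    IsVertexValue l q T f g e v a := by
  obtain ⟨u, hu⟩ := h.exists_isGeneralizedSolution hl hT hq hqb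
  exact ⟨u, _, hu.congr (zeroExt_toH hf) (zeroExt_toH hg), ae_mem_iff.2 ha⟩

lemma hasUniqueSolution (R : ∀ e, EdgeResponse T (l e) (q e)) (hl : ∀ e, 0 < l e) (hT : 0 < T)
    (hq : ∀ e, ContinuousOn (q e) (Ioo 0 (l e)))
    (hqb : ∀ e, ∃ M, ∀ x ∈ Ioo 0 (l e), |q e x| ≤ M) (f g : L2 0 T) :
    HasUniqueSolution l q T (zeroExt f) (zeroExt g) := by
  refine ⟨?_, fun u tr u' tr' h h' => ?_⟩
  · obtain ⟨p, r, U, hS⟩ := exists_isSystem R f g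
    obtain ⟨u, hu⟩ := hS.exists_isGeneralizedSolution hl hT hq hqb
    exact ⟨u, _, hu⟩
  · obtain ⟨p, r, U, hS, hae, htr⟩ := h.exists_isSystem hl hT hq hqb (memLp_zeroExt_restrict g)
    obtain ⟨p', r', U', hS', hae', htr'⟩ :=
      h'.exists_isSystem hl hT hq hqb (memLp_zeroExt_restrict g)
    have hU := hS.eqOn R hq hqb hS' (Or.inl rfl)
    refine ⟨fun e t ht => ?_, fun e v hv => ?_⟩
    · rw [ae_mem_iff]
      refine (h.isRegular e).ae_eq_of_toH_eq hT (h'.isRegular e) ?_ t ht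
      filter_upwards [hae e, hae' e, ae_restrict_mem measurableSet_Ioo] with x h1 h2 hx
      rw [h1, h2, hU e (Ioo_subset_Icc_self hx)]
    · rw [ae_mem_iff]
      have h1 := coeFn_toH (h.hasTrace e v hv).1
      rw [htr e v hv, hU e (pos_mem hl e v), ← htr' e v hv] at h1
      exact h1.symm.trans (coeFn_toH (h'.hasTrace e v hv).1)

/-- The matching condition in terms of systems of waves. -/
lemma matching_iff (R : ∀ e, EdgeResponse T (l e) (q e)) (hl : ∀ e, 0 < l e) (hT : 0 < T)
    (hq : ∀ e, ContinuousOn (q e) (Ioo 0 (l e)))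
    (hqb : ∀ e, ∃ M, ∀ x ∈ Ioo 0 (l e), |q e x| ≤ M) {f g : ℝ → ℝ}
    (hf : MemLp f 2 (volume.restrict (Ioo 0 T))) (hg : MemLp g 2 (volume.restrict (Ioo 0 T))) :
    Matching l q T f g ↔
      ∃ (p r : Edge → L2 0 T) (U : Edge → ℝ → L2 0 T),
        IsSystem l q (toH f) (toH g) p r U ∧ U .e3 0 = 0 := by
  have hm0 : MemLp (0 : ℝ → ℝ) 2 (volume.restrict (Ioo 0 T)) := MemLp.zero
  have hz : (toH (0 : ℝ → ℝ) : L2 0 T) = 0 := by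
    rw [← toH_coe (0 : L2 0 T)]
    exact toH_congr (Lp.coeFn_zero ℝ 2 _).symm
  have hv : Incident .e3 .v2 := Or.inl rfl
  constructor
  -- By linearity the two solutions add up to the one with controls f and g, whose value u_3(v2) is
  -- b + a.
  · rintro ⟨a, b, ⟨u, tr, hu, hb⟩, ⟨u', tr', hu', ha⟩, hab⟩
    obtain ⟨p, r, U, hS, -, htr⟩ := hu.exists_isSystem hl hT hq hqb hg
    obtain ⟨p', r', U', hS', -, htr'⟩ := hu'.exists_isSystem hl hT hq hqb hm0
    have h1 := hS.add hq hqb hS'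
    rw [hz, zero_add, add_zero] at h1
    refine ⟨_, _, _, h1, ?_⟩
    have h2 : U .e3 0 = toH (tr .e3 .v2) := (htr .e3 .v2 hv).symm
    have h3 : U' .e3 0 = toH (tr' .e3 .v2) := (htr' .e3 .v2 hv).symm
    simp only [h2, h3]
    rw [← toH_add (hu.hasTrace _ _ hv).1 (hu'.hasTrace _ _ hv).1, ← hz]
    refine toH_eq_of_ae_eq ?_
    filter_upwards [ha, hb, hab] with t h4 h5 h6 ht
    rw [h4 ht, h5 ht, h6 ht, neg_add_cancel, Pi.zero_apply]
  · rintro ⟨p, r, U, hS, h0⟩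
    obtain ⟨p₁, r₁, U₁, hS₁⟩ := exists_isSystem R (0 : L2 0 T) (toH g)
    obtain ⟨p₂, r₂, U₂, hS₂⟩ := exists_isSystem R (toH f : L2 0 T) 0
    have h1 := hS₁.add hq hqb hS₂
    rw [zero_add, add_zero] at h1
    have h2 := h1.eqOn R hq hqb hS (Or.inl rfl) .e3 (left_mem_Icc.2 (hl .e3).le)
    rw [h0] at h2
    rw [← hz] at hS₁ hS₂
    refine ⟨U₂ .e3 0, U₁ .e3 0, hS₁.isVertexValue hl hT hq hqb hm0 hg EventuallyEq.rfl,
      hS₂.isVertexValue hl hT hq hqb hf hm0 EventuallyEq.rfl, ae_mem_iff.2 ?_⟩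
    have h3 : U₁ .e3 0 = -U₂ .e3 0 := eq_neg_of_add_eq_zero_left h2
    rw [h3]
    exact Lp.coeFn_neg _

end WellPosed

/-! ### Identification of L²(l₁,T) with the range of the delay. -/

section Late

variable {a T : ℝ}

lemma zeroExt_injective_toH (ha : 0 ≤ a) {k k' : L2 a T}
    (h : (toH (zeroExt k) : L2 0 T) = toH (zeroExt k')) : k = k' := by
  have h1 := coeFn_toH (memLp_zeroExt_restrict (T := T) k)
  rw [h] at h1
  have h2 := ae_mem_iff.2 (h1.symm.trans (coeFn_toH (memLp_zeroExt_restrict (T := T) k')))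
  apply Lp.ext
  have h3 : zeroExt k =ᵐ[volume.restrict (Ioo a T)] zeroExt k' := by
    rw [EventuallyEq, ae_restrict_iff' measurableSet_Ioo]
    filter_upwards [h2] with t ht hta using ht ⟨ha.trans_lt hta.1, hta.2⟩
  exact (zeroExt_ae k).symm.trans (h3.trans (zeroExt_ae k'))

/-- A delayed function vanishes before time a, so its restriction to (a,T) loses nothing. -/
lemma exists_toH_zeroExt_eq_shift (c : L2 0 T) :
    ∃ k : L2 a T, toH (zeroExt k) = shift a c := by
  have hm : MemLp (fun t => zeroExt c (t - a)) 2 (volume.restrict (Ioo a T)) :=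
    ((memLp_zeroExt c).comp_measurePreserving (measurePreserving_subMap a)).restrict _
  refine ⟨hm.toLp, ?_⟩
  rw [← toH_coe (shift a c)]
  refine toH_congr ?_
  refine EventuallyEq.trans ?_ (coeFn_shift a c).symm
  rw [EventuallyEq, ae_restrict_iff' measurableSet_Ioo]
  filter_upwards [zeroExt_congr hm.coeFn_toLp] with t h1 htT
  rw [h1]
  by_cases ht : t ∈ Ioo a T
  · rw [indicator_of_mem ht]
  · rw [indicator_of_notMem ht]
    exact (zeroExt_of_notMem c fun h => ht ⟨by linarith [h.1], htT.2⟩).symm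

/-- The preimage is k advanced by a; nothing is lost at time 0 because k vanishes before a. -/
lemma exists_shift_eq_toH_zeroExt (ha : 0 ≤ a) (k : L2 a T) :
    ∃ c : L2 0 T, shift a c = toH (zeroExt k) := by
  have hm : MemLp (fun t => zeroExt k (t - -a)) 2 (volume.restrict (Ioo 0 T)) :=
    ((memLp_zeroExt k).comp_measurePreserving (measurePreserving_subMap (-a))).restrict _
  refine ⟨toH fun t => zeroExt k (t - -a), ?_⟩
  rw [← toH_coe (shift a _)]
  refine toH_congr ((coeFn_shift a _).trans ?_)
  rw [EventuallyEq, ae_restrict_iff' measurableSet_Ioo]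
  filter_upwards [ae_sub a (zeroExt_toH hm)] with t h1 ht
  by_cases hta : a < t
  · rw [h1 ⟨by linarith, by linarith [ht.2]⟩, sub_neg_eq_add, sub_add_cancel]
  · rw [zeroExt_of_notMem _ fun h => hta (by linarith [h.1]), zeroExt_of_notMem _ fun h => hta h.1]

end Late

end RingGraph

theorem lemmaL1 (l : Edge → ℝ) (hl : ∀ e, 0 < l e) (q : Edge → ℝ → ℝ)
    (hq : ∀ e, ContinuousOn (q e) (Ioo 0 (l e)))
    (hqb : ∀ e, ∃ M, ∀ x ∈ Ioo 0 (l e), |q e x| ≤ M)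
    (T : ℝ) (hT : l .e1 < T) :
    (∀ f g : L2 0 T, HasUniqueSolution l q T (zeroExt f) (zeroExt g)) ∧
    ∃ γ : L2 0 T → L2 (l .e1) T,
      (∀ f g, Matching l q T (zeroExt f) (zeroExt g) ↔ g = γ f) ∧
      ∃ Φ : L2 0 T → L2 (l .e1) T,
        (∀ f, IsVertexValue l q T (zeroExt f) (zeroExt (γ f)) .e1 .v2 (zeroExt (Φ f))) ∧
        Function.Surjective Φ := by
  have hT0 : 0 < T := (hl .e1).trans hT
  have hl1 : 0 ≤ l .e1 := (hl .e1).le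
  have R : ∀ e, EdgeResponse T (l e) (q e) := fun e =>
    (nonempty_edgeResponse T (hl e) (hq e) (hqb e)).some
  refine ⟨hasUniqueSolution R hl hT0 hq hqb, ?_⟩
  -- Here g and u_1(v2) are opposite to each other, since u_3(v2) = 0 forces g = -u_1(v2); hence c
  -- enters with both signs.
  have hex : ∀ f : L2 0 T, ∃ (k k₂ : L2 (l .e1) T) (p r : Edge → L2 0 T) (U : Edge → ℝ → L2 0 T),
      IsSystem l q f (toH (zeroExt k)) p r U ∧ U .e3 0 = 0 ∧ U .e1 0 = toH (zeroExt k₂) := by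
    intro f
    obtain ⟨c, p, r, U, hS, h3, h1⟩ := exists_isSystem_matching R hl hq hqb f
    obtain ⟨k, hk⟩ := exists_toH_zeroExt_eq_shift (a := l .e1) (-c)
    obtain ⟨k₂, hk₂⟩ := exists_toH_zeroExt_eq_shift (a := l .e1) c
    exact ⟨k, k₂, p, r, U, by rwa [hk, map_neg], h3, by rw [h1, hk₂]⟩
  choose γ Φ p r U hS h3 h1 using hex
  -- Uniqueness under u_3(v2) = 0 holds for arbitrary g in L²(0,T). It serves both for the
  -- uniqueness of the matching control and for recognising Φ f in the proof of surjectivity.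
  have huniq : ∀ (f g : L2 0 T) (p' r' : Edge → L2 0 T) (U' : Edge → ℝ → L2 0 T),
      IsSystem l q f g p' r' U' → U' .e3 0 = 0 →
      g = toH (zeroExt (γ f)) ∧ U' .e1 0 = toH (zeroExt (Φ f)) := by
    intro f g p' r' U' hS' h3'
    have hE := fun e => hS'.eqOn R hq hqb (hS f) (Or.inr (h3'.trans (h3 f).symm)) e
      (left_mem_Icc.2 (hl e).le)
    refine ⟨?_, by rw [hE, h1]⟩
    have e1 := hS'.dc_v2'
    have e2 := (hS f).dc_v2'
    rw [hE, hE, e2] at e1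
    exact (add_left_cancel e1).symm
  refine ⟨γ, fun f g => ?_, Φ, fun f => ?_, fun k => ?_⟩
  · rw [matching_iff R hl hT0 hq hqb (memLp_zeroExt_restrict f) (memLp_zeroExt_restrict g),
      toH_zeroExt]
    constructor
    · rintro ⟨p', r', U', hS', h3'⟩
      exact zeroExt_injective_toH hl1 (huniq f _ p' r' U' hS' h3').1
    · rintro rfl
      exact ⟨_, _, _, hS f, h3 f⟩
  -- That u_1(v2) vanishes before l₁ is contained in its being the extension by zero of an element
  -- of L²(l₁,T).
  · refine IsSystem.isVertexValue hl hT0 hq hqb (memLp_zeroExt_restrict f)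
      (memLp_zeroExt_restrict (γ f)) (by rw [toH_zeroExt]; exact hS f) ?_
    have h2 : U f .e1 (pos l .e1 .v2) = toH (zeroExt (Φ f)) := h1 f
    rw [h2]
    exact coeFn_toH (memLp_zeroExt_restrict (Φ f))
  · obtain ⟨c, hc⟩ := exists_shift_eq_toH_zeroExt hl1 k
    obtain ⟨f, p', r', U', hS', h3', h1'⟩ := exists_isSystem_surjective R hl hq hqb c
    have h2 := (huniq f _ p' r' U' hS' h3').2
    rw [h1', hc] at h2
    exact ⟨f, (zeroExt_injective_toH hl1 h2).symm⟩
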